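/- Let $W=\bigoplus_{k\ge 0}W^{-k}$ be a finite-dimensional non-positively graded real vector space, $U\subset W^0$ an open subset, and $\mathcal A_{W|_U}=C^\infty(U)\otimes S\bigl((W^{<0})^*\bigr)$, with $S$ the graded symmetric algebra. Let $Q$ be a differential on $\mathcal A_{W|_U}$, i.e. a graded derivation of degree $1$ with $Q^2=0$. Let $\xi^i$ be a homogeneous basis of $W^*$ ($\deg\xi^i=k$ if $\xi^i\in (W^{-k})^*$), and $F_Q^i=Q\xi^i$. For a manifold $X$, possibly with corners, let $\Omega(X,W)^m=\bigoplus_{k\ge0}\Omega^{m+k}(X)\otimes W^{-k}$ (smooth forms; the components of $A\in\Omega(X,W)^m$ are forms $A^i$ of degree $m+\deg\xi^i$), let $\Omega(X,W|_U)^0\subset\Omega(X,W)^0$ be the set of those $A$ whose function part $X\to W^0$ takes values in $U$, and let $\Omega(X,W|_U)^{MC}$ be the set of those $A\in\Omega(X,W|_U)^0$ with $dA^i=F_Q^i(A)$ for all $i$, where $F(A)$ is obtained from $F\in\mathcal A_{W|_U}$ by substituting $A^k$ for $\xi^k$. On $X=N\times[0,\epsilon]$, with $t$ the coordinate on $[0,\epsilon]$,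 write $\alpha=\alpha_h+dt\,\alpha_v$ with $\alpha_v=i_{\partial_t}\alpha$, and $d_h\alpha=(d\alpha)_h$. Let $N$ be a compact manifold, possibly with corners, let $I=[0,1]$, and let $A_0\in\Omega(N,W|_U)^{MC}$. (1) For every $H\in\Omega(N\times I,W)^{-1}$ that is horizontal ($i_{\partial_t}H=0$) there is $0<\epsilon\le1$ such that there is a unique $A\in\Omega(N\times[0,\epsilon],W|_U)^{MC}$ with $A|_{t=0}=A_0$ and $A_v=H$. It is given by $A=A_h+dt\,H$, where $A_h\in\Omega(N\times[0,\epsilon],W|_U)^0$ is the unique horizontal solution of $$\frac{d}{dt}A_h^k=d_hH^k+\sum_i H^i\,\frac{\partial F_Q^k}{\partial\xi^i}(A_h)\quad\text{for all }k,\qquad A_h|_{t=0}=A_0$$ (with left partial derivatives). (2) There is $\delta>0$ such that for every horizontal $H\in\Omega(N\times I,W)^{-1}$ for which the $C^0$-norm of its $0$-form part $H^{(0)}:N\times I\to W^{-1}$ is at most $\delta$, the conclusion of (1) holds with $\epsilon=1$. -/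

import Mathlib

open Set TopologicalSpace
open scoped Manifold ContDiff TensorProduct

noncomputable section

namespace HtopyMC

/-! ### The exterior algebra of a cotangent space -/

/-- The exterior algebra `⋀ V*` of the dual of a vector space `V`. -/
abbrev Lam (V : Type*) [AddCommGroup V] [Module ℝ V] : Type _ :=
  ExteriorAlgebra ℝ (Module.Dual ℝ V)

section Fiber

variable (V : Type*) [AddCommGroup V] [Module ℝ V]

instance finite_lam [FiniteDimensional ℝ V] : FiniteDimensional ℝ (Lam V) :=
  Module.Finite.of_basis (Module.finBasis ℝ (Module.Dual ℝ V)).ExteriorAlgebra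

/-- A norm on the finite-dimensional vector space `⋀ V*` (the sup norm of the coordinates in some
basis). All norms are equivalent; it serves only to speak of smoothness and of derivatives. -/
instance normedAddCommGroup_lam [FiniteDimensional ℝ V] : NormedAddCommGroup (Lam V) :=
  NormedAddCommGroup.induced (Lam V) (Fin (Module.finrank ℝ (Lam V)) → ℝ)
    (Module.finBasis ℝ (Lam V)).equivFun (Module.finBasis ℝ (Lam V)).equivFun.injective

instance normedSpace_lam [FiniteDimensional ℝ V] : NormedSpace ℝ (Lam V) :=
  NormedSpace.induced ℝ (Lam V) (Fin (Module.finrank ℝ (Lam V)) → ℝ)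
    (Module.finBasis ℝ (Lam V)).equivFun

/-- The homogeneous part `⋀^k V*`, for an integer `k` (zero if `k < 0`). -/
def homogPart : ℤ → Submodule ℝ (Lam V)
  | Int.ofNat n => ⋀[ℝ]^n (Module.Dual ℝ V)
  | Int.negSucc _ => ⊥

variable {V}

/-- Pullback `⋀ V'* → ⋀ V*` along a linear map `V → V'`. -/
def pull {V' : Type*} [AddCommGroup V'] [Module ℝ V'] (L : V →ₗ[ℝ] V') : Lam V' →ₐ[ℝ] Lam V :=
  ExteriorAlgebra.map L.dualMap

/-- The interior product `i_v`, the odd derivation of `⋀ V*` with `i_v φ = φ v` for `φ ∈ V*`. -/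
def contract (v : V) : Lam V →ₗ[ℝ] Lam V :=
  CliffordAlgebra.contractLeft (Module.Dual.eval ℝ V v)

/-- The scalar (degree 0) component of an element of `⋀ V*`. -/
def scalar : Lam V →ₐ[ℝ] ℝ := ExteriorAlgebra.algebraMapInv

end Fiber

section GradedComm

variable {M : Type*} [AddCommGroup M] [Module ℝ M]

theorem ι_mul_comm_of_mem (v : M) (n : ℕ) (y : ExteriorAlgebra ℝ M)
    (hy : y ∈ ⋀[ℝ]^n M) :
    ExteriorAlgebra.ι ℝ v * y = (-1 : ℝ) ^ n • (y * ExteriorAlgebra.ι ℝ v) := by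
  induction hy using Submodule.pow_induction_on_left' with
  | algebraMap r => simp [Algebra.commutes]
  | add x y i hx hy ihx ihy => rw [mul_add, ihx, ihy, add_mul, smul_add]
  | mem_mul m hm i x hx ih =>
    obtain ⟨w, rfl⟩ := hm
    have h := ExteriorAlgebra.ι_add_mul_swap (R := ℝ) v w
    rw [← mul_assoc, eq_neg_of_add_eq_zero_left h, neg_mul, mul_assoc, ih, pow_succ, mul_smul_comm,
      mul_assoc]
    simp

theorem mul_comm_of_mem (m n : ℕ) (x y : ExteriorAlgebra ℝ M)
    (hx : x ∈ ⋀[ℝ]^m M) (hy : y ∈ ⋀[ℝ]^n M) :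
    x * y = (-1 : ℝ) ^ (m * n) • (y * x) := by
  induction hx using Submodule.pow_induction_on_left' with
  | algebraMap r => simp [Algebra.commutes]
  | add x y i hx hy ihx ihy => rw [add_mul, ihx, ihy, mul_add, smul_add]
  | mem_mul v hv i x hx ih =>
    obtain ⟨w, rfl⟩ := hv
    rw [mul_assoc, ih, mul_smul_comm, ← mul_assoc, ι_mul_comm_of_mem w n y hy, smul_mul_assoc,
      smul_smul, ← pow_add, mul_assoc]
    congr 2
    rw [Nat.succ_mul]

theorem mem_center_of_even {n : ℕ} (hn : Even n) (x : ExteriorAlgebra ℝ M)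
    (hx : x ∈ ⋀[ℝ]^n M) : x ∈ Subalgebra.center ℝ (ExteriorAlgebra ℝ M) := by
  rw [Subalgebra.mem_center_iff]
  intro b
  induction b using ExteriorAlgebra.induction with
  | algebraMap r => exact Algebra.commutes _ _
  | ι v => rw [ι_mul_comm_of_mem v n x hx, hn.neg_one_pow, one_smul]
  | mul a b ha hb => rw [mul_assoc, hb, ← mul_assoc, ha, mul_assoc]
  | add a b ha hb => rw [add_mul, mul_add, ha, hb]

theorem mul_add_mul_of_odd {m n : ℕ} (hm : Odd m) (hn : Odd n) (x y : ExteriorAlgebra ℝ M)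
    (hx : x ∈ ⋀[ℝ]^m M) (hy : y ∈ ⋀[ℝ]^n M) : x * y + y * x = 0 := by
  rw [mul_comm_of_mem m n x y hx hy, (hm.mul hn).neg_one_pow]
  simp

theorem sum_sq_of_odd {J : Type*} [Fintype J] (d : J → ℕ) (hd : ∀ j, Odd (d j))
    (a : J → ExteriorAlgebra ℝ M) (ha : ∀ j, a j ∈ ⋀[ℝ]^(d j) M) (c : J → ℝ) :
    (∑ j, c j • a j) * (∑ j, c j • a j) = 0 := by
  have h : (∑ j, c j • a j) * (∑ j, c j • a j) + (∑ j, c j • a j) * (∑ j, c j • a j) = 0 := by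
    simp only [Finset.sum_mul_sum]
    conv_lhs => arg 2; rw [Finset.sum_comm]
    rw [← Finset.sum_add_distrib]
    refine Finset.sum_eq_zero fun i _ => ?_
    rw [← Finset.sum_add_distrib]
    refine Finset.sum_eq_zero fun j _ => ?_
    simp only [smul_mul_smul_comm]
    rw [mul_comm (c j) (c i), ← smul_add,
      mul_add_mul_of_odd (hd i) (hd j) _ _ (ha i) (ha j), smul_zero]
  rw [← two_smul ℝ] at h
  exact (smul_eq_zero.mp h).resolve_left two_ne_zero

end GradedComm

/-! ### The graded algebra of functions on `W|_U`

The non-positively graded vector space `W` is given by a homogeneous basis indexed by a finite type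
`ι`; the dual coordinate `ξ^i` has degree `deg i ≥ 0`, i.e. the `i`-th basis vector of `W` has
degree `- deg i`. -/

section Algebra

variable {ι : Type*} (deg : ι → ℕ)

/-- The degree 0 part `W⁰`. -/
abbrev Base : Type _ := {i : ι // deg i = 0} → ℝ

/-- Indices of the coordinates of positive even degree. -/
abbrev EvenIdx : Type _ := {i : ι // deg i ≠ 0 ∧ Even (deg i)}

/-- Indices of the coordinates of odd degree. -/
abbrev OddIdx : Type _ := {i : ι // Odd (deg i)}

variable [Fintype ι] (U : Opens (Base deg))

/-- `C^∞(U)` for `U ⊆ W⁰` open, as an algebra of functions on `U`. -/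
def smoothFn : Subalgebra ℝ (U → ℝ) where
  carrier := {f | ContMDiff 𝓘(ℝ, Base deg) 𝓘(ℝ, ℝ) ∞ f}
  mul_mem' hf hg := ContMDiff.mul hf hg
  add_mem' hf hg := ContMDiff.add hf hg
  algebraMap_mem' _ := contMDiff_const

/-- `C^∞(U)` as a type. -/
abbrev SmoothFn : Type _ := smoothFn deg U

/-- The commutative algebra `C^∞(U) ⊗ S(even part of (W^{<0})*)`. -/
def EvenAlg : Type _ := SmoothFn deg U ⊗[ℝ] MvPolynomial (EvenIdx deg) ℝ

instance : CommRing (EvenAlg deg U) :=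
  inferInstanceAs (CommRing (SmoothFn deg U ⊗[ℝ] MvPolynomial (EvenIdx deg) ℝ))

instance : Algebra ℝ (EvenAlg deg U) :=
  inferInstanceAs (Algebra ℝ (SmoothFn deg U ⊗[ℝ] MvPolynomial (EvenIdx deg) ℝ))

/-- The graded-commutative algebra `C^∞(U) ⊗ S((W^{<0})*)`: the symmetric algebra of a graded vector
space is the polynomial algebra on its even part tensored with the exterior algebra on its odd
part. (All elements of `EvenAlg` are even, so the tensor product of algebras needs no signs.) -/
def FnAlg : Type _ := EvenAlg deg U ⊗[ℝ] ExteriorAlgebra ℝ (OddIdx deg → ℝ)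

instance : Ring (FnAlg deg U) :=
  inferInstanceAs (Ring (EvenAlg deg U ⊗[ℝ] ExteriorAlgebra ℝ (OddIdx deg → ℝ)))

instance : Algebra ℝ (FnAlg deg U) :=
  inferInstanceAs (Algebra ℝ (EvenAlg deg U ⊗[ℝ] ExteriorAlgebra ℝ (OddIdx deg → ℝ)))

variable {deg U}

/-- `f p w ∈ C^∞(U) ⊗ S((W^{<0})*)` for `f ∈ C^∞(U)`, `p` a polynomial in the coordinates of positive
even degree, and `w` in the exterior algebra on the coordinates of odd degree. -/
def mkFn (f : SmoothFn deg U) (p : MvPolynomial (EvenIdx deg) ℝ)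
    (w : ExteriorAlgebra ℝ (OddIdx deg → ℝ)) : FnAlg deg U :=
  ((f ⊗ₜ[ℝ] p : SmoothFn deg U ⊗[ℝ] MvPolynomial (EvenIdx deg) ℝ) : EvenAlg deg U) ⊗ₜ[ℝ] w

/-- The inclusion of functions on `U`. -/
def ofFn (f : SmoothFn deg U) : FnAlg deg U := mkFn f 1 1

variable (U) in
/-- The coordinate function of degree 0 on `U`. -/
def coordFn (i : {i : ι // deg i = 0}) : SmoothFn deg U :=
  ⟨fun u => u.1 i,
    (contDiff_apply ℝ ℝ i).contMDiff.comp (contMDiff_subtype_val (I := 𝓘(ℝ, Base deg)))⟩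

theorem smoothAt_extend (f : SmoothFn deg U) (x : U) :
    ContDiffAt ℝ ∞ (Function.extend Subtype.val f.1 0) x.1 := by
  rw [← contMDiffAt_iff_contDiffAt, ← contMDiffAt_subtype_iff]
  have : (fun x : U => Function.extend Subtype.val f.1 0 x.1) = f.1 := by
    funext y
    exact Subtype.val_injective.extend_apply _ _ _
  rw [this]
  exact f.2 x

variable [DecidableEq ι]

variable (U) in
/-- The generator `ξ^i`. -/
def gen (i : ι) : FnAlg deg U :=
  if h0 : deg i = 0 then ofFn (coordFn U ⟨i, h0⟩)
  else if he : Even (deg i) then mkFn 1 (MvPolynomial.X ⟨i, h0, he⟩) 1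
  else mkFn 1 1 (ExteriorAlgebra.ι ℝ (Pi.single ⟨i, Nat.not_even_iff_odd.mp he⟩ 1))

variable (deg U) in
/-- The part of degree `k`, spanned by the elements `f ξ^{i₁} ⋯ ξ^{iᵣ}` with `f ∈ C^∞(U)` and
`deg i₁ + ⋯ + deg iᵣ = k`. -/
def degPart (k : ℕ) : Submodule ℝ (FnAlg deg U) :=
  Submodule.span ℝ {a | ∃ (f : SmoothFn deg U) (l : List ι),
    (l.map deg).sum = k ∧ a = ofFn f * (l.map (gen U)).prod}

/-- The partial derivative of a smooth function on `U`. -/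
def partialFn (i : {i : ι // deg i = 0}) : SmoothFn deg U →ₗ[ℝ] SmoothFn deg U where
  toFun f :=
    ⟨fun x => fderiv ℝ (Function.extend Subtype.val f.1 0) x.1 (Pi.single i 1), by
      intro x
      refine (contMDiffAt_subtype_iff (I := 𝓘(ℝ, Base deg)) (f := fun y : Base deg =>
        fderiv ℝ (Function.extend Subtype.val f.1 0) y (Pi.single i 1))).mpr ?_
      rw [contMDiffAt_iff_contDiffAt]
      exact ((smoothAt_extend f x).fderiv_right (m := ∞) (by simp)).clm_apply contDiffAt_const⟩
  map_add' f g := by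
    ext x
    have h : Function.extend Subtype.val (f + g : SmoothFn deg U).1 0
        = Function.extend Subtype.val f.1 0 + Function.extend Subtype.val g.1 0 := by
      have h' := Function.extend_add (Subtype.val : U → Base deg) f.1 g.1 0 0
      rwa [add_zero] at h'
    have h2 := fderiv_add ((smoothAt_extend f x).differentiableAt (by simp))
      ((smoothAt_extend g x).differentiableAt (by simp))
    rw [← h] at h2
    exact congrArg (fun L => L (Pi.single i 1)) h2
  map_smul' c f := by
    ext x
    have h : Function.extend Subtype.val (c • f : SmoothFn deg U).1 0
        = c • Function.extend Subtype.val f.1 0 := by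
      have h' := Function.extend_smul c (Subtype.val : U → Base deg) f.1 0
      rwa [smul_zero] at h'
    have h2 := fderiv_const_smul ((smoothAt_extend f x).differentiableAt (by simp)) c
    rw [← h] at h2
    exact congrArg (fun L => L (Pi.single i 1)) h2

/-- The tensor product of three linear maps, `f p w ↦ L₀(f) L₁(p) L₂(w)`. -/
def mapFn (L₀ : SmoothFn deg U →ₗ[ℝ] SmoothFn deg U)
    (L₁ : MvPolynomial (EvenIdx deg) ℝ →ₗ[ℝ] MvPolynomial (EvenIdx deg) ℝ)
    (L₂ : ExteriorAlgebra ℝ (OddIdx deg → ℝ) →ₗ[ℝ] ExteriorAlgebra ℝ (OddIdx deg → ℝ)) :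
    FnAlg deg U →ₗ[ℝ] FnAlg deg U :=
  let L : EvenAlg deg U →ₗ[ℝ] EvenAlg deg U := TensorProduct.map L₀ L₁
  TensorProduct.map L L₂

/-- The left partial derivative `∂/∂ξ^i` of the algebra of functions: the graded derivation of
degree `- deg i` with `∂ξ^j/∂ξ^i = δ_ij`. -/
def partialGen (i : ι) : FnAlg deg U →ₗ[ℝ] FnAlg deg U :=
  if h0 : deg i = 0 then mapFn (partialFn ⟨i, h0⟩) LinearMap.id LinearMap.id
  else if he : Even (deg i) then
    mapFn LinearMap.id (MvPolynomial.pderiv ⟨i, h0, he⟩).toLinearMap LinearMap.id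
  else
    mapFn LinearMap.id LinearMap.id
      (CliffordAlgebra.contractLeft (LinearMap.proj ⟨i, Nat.not_even_iff_odd.mp he⟩))

variable (deg U) in
/-- A differential on the graded algebra of functions: a graded derivation of degree 1 and
square 0. -/
structure Differential where
  toLin : FnAlg deg U →ₗ[ℝ] FnAlg deg U
  degree : ∀ k, ∀ a ∈ degPart deg U k, toLin a ∈ degPart deg U (k + 1)
  leibniz : ∀ k, ∀ a ∈ degPart deg U k, ∀ b,
    toLin (a * b) = toLin a * b + (-1 : ℝ) ^ k • (a * toLin b)
  sq_zero : ∀ a, toLin (toLin a) = 0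

/-- `F_Q^i = Q ξ^i`. -/
def Differential.F (Q : Differential deg U) (i : ι) : FnAlg deg U := Q.toLin (gen U i)

/-! #### Substitution of forms for the generators -/

/-- The degree 0 components of a tuple of elements of `⋀ V*`, as a vector of `W⁰`. -/
def baseValue {V : Type*} [AddCommGroup V] [Module ℝ V] (a : ι → Lam V) : Base deg :=
  fun i => scalar (a i.1)

variable (deg U) in
/-- Value at one point of a form in `Ω(N, W|_U)⁰`: an element of degree 0 of `⋀ V* ⊗ W`, with
`W⁰`-component in `U`. -/
structure FiberPt (V : Type*) [AddCommGroup V] [Module ℝ V] where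
  comp : ι → Lam V
  homog : ∀ i, comp i ∈ ⋀[ℝ]^(deg i) (Module.Dual ℝ V)
  mem : baseValue comp ∈ U

section Subst

variable {V : Type*} [AddCommGroup V] [Module ℝ V] (a : FiberPt deg U V)

/-- Substitution in functions of the coordinates of degree 0. -/
def FiberPt.substFn : SmoothFn deg U →ₐ[ℝ] Lam V where
  toFun f := algebraMap ℝ (Lam V) (f.1 ⟨baseValue a.comp, a.mem⟩)
  map_one' := map_one _
  map_mul' f g := map_mul _ (f.1 ⟨baseValue a.comp, a.mem⟩) (g.1 ⟨baseValue a.comp, a.mem⟩)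
  map_zero' := map_zero _
  map_add' f g := map_add _ (f.1 ⟨baseValue a.comp, a.mem⟩) (g.1 ⟨baseValue a.comp, a.mem⟩)
  commutes' _ := rfl

/-- Substitution in polynomials of the coordinates of positive even degree. -/
def FiberPt.substEven : MvPolynomial (EvenIdx deg) ℝ →ₐ[ℝ] Subalgebra.center ℝ (Lam V) :=
  MvPolynomial.aeval fun j => ⟨a.comp j.1, mem_center_of_even j.2.2 _ (a.homog j.1)⟩

/-- Substitution in the coordinates of odd degree. -/
def FiberPt.substOdd : ExteriorAlgebra ℝ (OddIdx deg → ℝ) →ₐ[ℝ] Lam V :=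
  ExteriorAlgebra.lift ℝ ⟨∑ j : OddIdx deg, (LinearMap.proj j).smulRight (a.comp j.1), fun c => by
    simpa using sum_sq_of_odd (fun j : OddIdx deg => deg j.1) (fun j => j.2)
      (fun j => a.comp j.1) (fun j => a.homog j.1) c⟩

theorem FiberPt.commute_substFn (f : SmoothFn deg U) (z : Lam V) : Commute (a.substFn f) z :=
  Algebra.commutes (f.1 ⟨baseValue a.comp, a.mem⟩) z

theorem FiberPt.commute_substEven (p : MvPolynomial (EvenIdx deg) ℝ) (z : Lam V) :
    Commute (((Subalgebra.center ℝ (Lam V)).val.comp a.substEven) p) z :=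
  ((Subalgebra.mem_center_iff.mp (a.substEven p).2) z).symm

/-- Substitution in the coordinates of even degree. -/
def FiberPt.substEvenAlg : EvenAlg deg U →ₐ[ℝ] Lam V :=
  Algebra.TensorProduct.lift a.substFn ((Subalgebra.center ℝ (Lam V)).val.comp a.substEven)
    fun f _ => a.commute_substFn f _

theorem FiberPt.commute_substEvenAlg (x : EvenAlg deg U) (z : Lam V) :
    Commute (a.substEvenAlg x) z := by
  induction x using TensorProduct.induction_on with
  | zero => exact (map_zero a.substEvenAlg).symm ▸ Commute.zero_left z
  | add x y hx hy => exact (map_add a.substEvenAlg x y).symm ▸ hx.add_left hy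
  | tmul f p => exact (a.commute_substFn f z).mul_left (a.commute_substEven p z)

/-- The algebra morphism `F ↦ F(a)` that substitutes `a^i` for `ξ^i`. -/
def FiberPt.subst : FnAlg deg U →ₐ[ℝ] Lam V :=
  Algebra.TensorProduct.lift a.substEvenAlg a.substOdd fun x _ => a.commute_substEvenAlg x _

end Subst

end Algebra

/-! ### Differential forms on manifolds with corners

Differential forms are (not necessarily homogeneous) sections of `⋀ T*M`. In Mathlib the tangent
space `T_pM` of a manifold modelled on `E` is `E` itself, through the preferred chart at `p`. So a
form is a function `M → ⋀ E*`. Forms are considered on a subset `s` of `M`: the whole of `M`,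
or `N × [0,ε]` inside `M = N × ℝ`, which is a submanifold with corners of codimension 0. Only the
values on `s` matter. -/

section Forms

variable {E : Type*} [NormedAddCommGroup E] [NormedSpace ℝ E] [FiniteDimensional ℝ E]
  {H : Type*} [TopologicalSpace H] (I : ModelWithCorners ℝ E H)
  {M : Type*} [TopologicalSpace M] [ChartedSpace H M]

/-- The expression of a form in the preferred chart at `p₀`, i.e. its pullback along the inverse
`ψ` of that chart. The derivative of `ψ` at `y` is a map `E → T_pM`, `p = ψ y`; as `T_pM` is
identified with `E` through the preferred chart at `p`, it is the derivative at `y` of the transition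
map from the chart at `p₀` to the chart at `p`. -/
def inChart (p₀ : M) (α : M → Lam E) (y : E) : Lam E :=
  pull (fderivWithin ℝ (extChartAt I ((extChartAt I p₀).symm y) ∘ (extChartAt I p₀).symm)
    (range I) y).toLinearMap (α ((extChartAt I p₀).symm y))

/-- Smoothness (up to the boundary) on `s`: smoothness of the expressions in charts. -/
def SmoothFormOn (s : Set M) (α : M → Lam E) : Prop :=
  ∀ p₀ : M, ContDiffOn ℝ ∞ (inChart I p₀ α)
    ((extChartAt I p₀).target ∩ (extChartAt I p₀).symm ⁻¹' s)

/-- The exterior derivative on `s`, `dα = ∑ₖ dxᵏ ∧ ∂α/∂xᵏ` in the chart at the given point. -/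
def extD (s : Set M) (α : M → Lam E) (p : M) : Lam E :=
  ∑ k, ExteriorAlgebra.ι ℝ ((Module.finBasis ℝ E).coord k) *
    fderivWithin ℝ (inChart I p α) (range I ∩ (extChartAt I p).symm ⁻¹' s) (extChartAt I p p)
      (Module.finBasis ℝ E k)

variable {ι : Type*} (deg : ι → ℕ)

/-- `A ∈ Ω(s, W)^m`: the component `A^i` is a smooth form of degree `m + deg i` on `s`. -/
structure IsWForm (m : ℤ) (s : Set M) (A : ι → M → Lam E) : Prop where
  smooth : ∀ i, SmoothFormOn I s (A i)
  homog : ∀ i, ∀ p ∈ s, A i p ∈ homogPart E (m + deg i)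

variable [Fintype ι] [DecidableEq ι] (U : Opens (Base deg))

/-- `Ω(s, W|_U)⁰`: forms in `Ω(s, W)⁰` whose `W⁰`-valued function part takes values in `U`. -/
structure WUForm (s : Set M) where
  toFun : ι → M → Lam E
  isWForm : IsWForm I deg 0 s toFun
  mem : ∀ p ∈ s, baseValue (fun i => toFun i p) ∈ U

variable {I deg U}

/-- The value of a form in `Ω(s, W|_U)⁰` at a point of `s`. -/
def WUForm.pt {s : Set M} (A : WUForm I deg U s) (p : M) (hp : p ∈ s) : FiberPt deg U E where
  comp i := A.toFun i p
  homog i := by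
    have h := A.isWForm.homog i p hp
    rw [zero_add] at h
    exact h
  mem := A.mem p hp

/-- The generalized Maurer-Cartan equation `dA = F_Q(A)`. -/
def WUForm.IsMC {s : Set M} (Q : Differential deg U) (A : WUForm I deg U s) : Prop :=
  ∀ (p : M) (hp : p ∈ s) (i : ι), extD I s (A.toFun i) p = (A.pt p hp).subst (Q.F i)

end Forms

/-! ### Forms on `N × [0,ε]` -/

section Cylinder

variable {E : Type*} [NormedAddCommGroup E] [NormedSpace ℝ E] [FiniteDimensional ℝ E]
  {H : Type*} [TopologicalSpace H] (I : ModelWithCorners ℝ E H)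
  {N : Type*} [TopologicalSpace N] [ChartedSpace H N]

/-- `N × [0,ε] ⊆ N × ℝ`. -/
def cyl (N : Type*) (ε : ℝ) : Set (N × ℝ) := univ ×ˢ Icc 0 ε

/-- The contraction `i_{∂_t}`, giving the vertical part; `T_{(x,t)}(N × ℝ) = E × ℝ` and
`∂_t = (0, 1)`. -/
def vert : Lam (E × ℝ) →ₗ[ℝ] Lam (E × ℝ) := contract ((0 : E), (1 : ℝ))

/-- The 1-form `dt`. -/
def dt : Lam (E × ℝ) := ExteriorAlgebra.ι ℝ (LinearMap.snd ℝ E ℝ)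

/-- The horizontal part `α_h = α - dt α_v`. -/
def horiz (α : Lam (E × ℝ)) : Lam (E × ℝ) := α - dt * vert α

/-- The restriction `α|_{t=t₀}`: pullback along `x ↦ (x, t₀)`, whose derivative `T_xN → T_xN × ℝ` is
`v ↦ (v, 0)`. -/
def restrictAt (t₀ : ℝ) (α : N × ℝ → Lam (E × ℝ)) (x : N) : Lam E :=
  pull (LinearMap.inl ℝ E ℝ) (α (x, t₀))

variable {ι : Type*} {deg : ι → ℕ}

variable (deg) in
/-- A horizontal form in `Ω(N × [0,1], W)^{-1}`. -/
structure IsHorizontalNegOne (η : ι → N × ℝ → Lam (E × ℝ)) : Prop where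
  isWForm : IsWForm (I.prod 𝓘(ℝ, ℝ)) deg (-1) (cyl N 1) η
  horizontal : ∀ i, ∀ p ∈ cyl N 1, vert (η i p) = 0

variable (deg) in
/-- The `C⁰`-norm of the 0-form part `η^{(0)} : N × [0,1] → W^{-1}` is at most `δ` (with the sup norm
of the coordinates on `W^{-1}`). -/
def C0NormLE (η : ι → N × ℝ → Lam (E × ℝ)) (δ : ℝ) : Prop :=
  ∀ p ∈ cyl N 1, ∀ i, deg i = 1 → |scalar (η i p)| ≤ δ

variable [Fintype ι] [DecidableEq ι] {U : Opens (Base deg)}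

variable {I}

/-- `A` is a Maurer-Cartan form on `N × [0,ε]` with `A|_{t=0} = A₀` and `A_v = η`. -/
structure IsMCHomotopy (Q : Differential deg U) (A₀ : WUForm I deg U (univ : Set N))
    (η : ι → N × ℝ → Lam (E × ℝ)) (ε : ℝ)
    (A : WUForm (I.prod 𝓘(ℝ, ℝ)) deg U (cyl N ε)) : Prop where
  isMC : A.IsMC Q
  initial : ∀ i x, restrictAt 0 (A.toFun i) x = A₀.toFun i x
  vertical : ∀ i, ∀ p ∈ cyl N ε, vert (A.toFun i p) = η i p

/-- `B` is a horizontal form on `N × [0,ε]` that solves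
`dB/dt = d_h η + η^j (∂F_Q/∂ξ^j)(B)` with `B|_{t=0} = A₀`. -/
structure IsODESolution (Q : Differential deg U) (A₀ : WUForm I deg U (univ : Set N))
    (η : ι → N × ℝ → Lam (E × ℝ)) (ε : ℝ)
    (B : WUForm (I.prod 𝓘(ℝ, ℝ)) deg U (cyl N ε)) : Prop where
  horizontal : ∀ i, ∀ p ∈ cyl N ε, vert (B.toFun i p) = 0
  initial : ∀ i x, restrictAt 0 (B.toFun i) x = A₀.toFun i x
  ode : ∀ (x : N) (t : ℝ) (ht : (x, t) ∈ cyl N ε) (i : ι),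
    HasDerivWithinAt (fun τ => B.toFun i (x, τ))
      (horiz (extD (I.prod 𝓘(ℝ, ℝ)) (cyl N 1) (η i) (x, t)) +
        ∑ j, η j (x, t) * (B.pt (x, t) ht).subst (partialGen j (Q.F i)))
      (Icc 0 ε) t

/-- There is a unique Maurer-Cartan form `A` on `N × [0,ε]` with `A|_{t=0} = A₀` and `A_v = η`, and
it is `A = A_h + dt η`, where `A_h` is the (unique) solution of the differential equation. -/
def HasUniqueHomotopy (Q : Differential deg U) (A₀ : WUForm I deg U (univ : Set N))
    (η : ι → N × ℝ → Lam (E × ℝ)) (ε : ℝ) : Prop :=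
  ∃ A Ah : WUForm (I.prod 𝓘(ℝ, ℝ)) deg U (cyl N ε),
    IsMCHomotopy Q A₀ η ε A ∧
    (∀ A', IsMCHomotopy Q A₀ η ε A' → ∀ i, EqOn (A'.toFun i) (A.toFun i) (cyl N ε)) ∧
    IsODESolution Q A₀ η ε Ah ∧
    (∀ B, IsODESolution Q A₀ η ε B → ∀ i, EqOn (B.toFun i) (Ah.toFun i) (cyl N ε)) ∧
    ∀ i, ∀ p ∈ cyl N ε, A.toFun i p = Ah.toFun i p + dt * η i p

end Cylinder

end HtopyMC

end

noncomputable section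

namespace HtopyMC

/-! ### Ordinary differential equations with parameters -/

section ODE

open Metric Filter
open scoped Topology NNReal

/-- A Gronwall inequality in which the bound on the derivative is only required as long as the
conclusion holds. -/
theorem norm_le_mul_exp_of_deriv_right {G : Type*} [NormedAddCommGroup G] [NormedSpace ℝ G]
    {f f' : ℝ → G} {K δ T : ℝ} (hK : 0 ≤ K) (hδ : 0 < δ) (hf : ContinuousOn f (Icc 0 T))
    (hf' : ∀ t ∈ Ico 0 T, HasDerivWithinAt f (f' t) (Ici t) t) (h0 : ‖f 0‖ ≤ δ)
    (bound : ∀ t ∈ Ico 0 T, ‖f t‖ ≤ δ * Real.exp ((2 * K + 1) * T) →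
      ‖f' t‖ ≤ K * (‖f t‖ + δ)) :
    ∀ t ∈ Icc 0 T, ‖f t‖ ≤ δ * Real.exp ((2 * K + 1) * T) := by
  intro t ht
  have hmono : ∀ s ∈ Icc 0 T,
      δ * Real.exp ((2 * K + 1) * s) ≤ δ * Real.exp ((2 * K + 1) * T) := fun s hs => by
    have := hs.2
    gcongr
  have hB : ∀ s, HasDerivAt (fun s => δ * Real.exp ((2 * K + 1) * s))
      ((2 * K + 1) * (δ * Real.exp ((2 * K + 1) * s))) s := fun s => by
    have h := (((hasDerivAt_id s).const_mul (2 * K + 1)).exp).const_mul δ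
    refine h.congr_deriv ?_
    simp only [id]
    ring
  refine le_trans (image_norm_le_of_norm_deriv_right_lt_deriv_boundary' hf hf'
    (B := fun s => δ * Real.exp ((2 * K + 1) * s)) ?_ (fun s _ => (hB s).continuousAt.continuousWithinAt)
    (fun s _ => (hB s).hasDerivWithinAt) ?_ ht) (hmono t ht)
  · simpa using h0
  · intro s hs hfs
    have h1 := bound s hs (hfs.le.trans (hmono s (Ico_subset_Icc_self hs)))
    have h2 : δ ≤ ‖f s‖ := by
      rw [hfs]
      have : 1 ≤ Real.exp ((2 * K + 1) * s) :=
        Real.one_le_exp (mul_nonneg (by linarith) hs.1)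
      nlinarith
    rw [← hfs]
    nlinarith

theorem hasDerivWithinAt_Ici_of_Icc {G : Type*} [NormedAddCommGroup G] [NormedSpace ℝ G]
    {f : ℝ → G} {f' : G} {t T : ℝ} (ht : t ∈ Ico 0 T)
    (h : HasDerivWithinAt f f' (Icc 0 T) t) : HasDerivWithinAt f f' (Ici t) t :=
  (h.mono (Icc_subset_Icc_left ht.1)).mono_of_mem_nhdsWithin (Icc_mem_nhdsGE ht.2)

/-- The radial retraction onto the ball of radius `R`. -/
def radialRetract {G : Type*} [NormedAddCommGroup G] [NormedSpace ℝ G] (R : ℝ) (x : G) : G :=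
  (R / max R ‖x‖) • x

section Retract

variable {G : Type*} [NormedAddCommGroup G] [NormedSpace ℝ G] {R : ℝ}

theorem norm_radialRetract_le (hR : 0 < R) (x : G) : ‖radialRetract R x‖ ≤ ‖x‖ := by
  rw [radialRetract, norm_smul, Real.norm_of_nonneg (by positivity)]
  refine mul_le_of_le_one_left (norm_nonneg x) ?_
  exact div_le_one_of_le₀ (le_max_left _ _) (by positivity)

theorem norm_radialRetract_le' (hR : 0 < R) (x : G) : ‖radialRetract R x‖ ≤ R := by
  rw [radialRetract, norm_smul, Real.norm_of_nonneg (by positivity), div_mul_eq_mul_div]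
  exact div_le_of_le_mul₀ (by positivity) hR.le (by gcongr; exact le_max_right _ _)

theorem radialRetract_of_norm_le (hR : 0 < R) {x : G} (hx : ‖x‖ ≤ R) : radialRetract R x = x := by
  rw [radialRetract, max_eq_left hx, div_self hR.ne', one_smul]

theorem lipschitzWith_radialRetract (hR : 0 < R) :
    LipschitzWith 2 (radialRetract R : G → G) := by
  refine LipschitzWith.of_dist_le_mul fun x y => ?_
  rw [dist_eq_norm, dist_eq_norm, radialRetract, radialRetract]
  set m := max R ‖x‖ with hm
  set n := max R ‖y‖ with hn
  have hm0 : 0 < m := lt_max_of_lt_left hR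
  have hn0 : 0 < n := lt_max_of_lt_left hR
  have h1 : (R / m) • x - (R / n) • y = (R / m) • (x - y) + ((R / m) * ((n - m) / n)) • y := by
    rw [smul_sub, sub_add, ← sub_smul]
    congr 2
    field_simp
    ring
  have h2 : R / m ≤ 1 := div_le_one_of_le₀ (le_max_left _ _) hm0.le
  have h3 : |n - m| ≤ ‖x - y‖ := by
    rw [hm, hn, abs_sub_comm]
    refine (abs_max_sub_max_le_max _ _ _ _).trans ?_
    rw [sub_self, abs_zero, max_eq_right (abs_nonneg _)]
    exact abs_norm_sub_norm_le x y
  rw [h1]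
  refine (norm_add_le _ _).trans ?_
  rw [norm_smul, norm_smul, Real.norm_of_nonneg (by positivity), norm_mul,
    Real.norm_of_nonneg (by positivity : 0 ≤ R / m), norm_div, Real.norm_of_nonneg hn0.le,
    Real.norm_eq_abs]
  have h4 : |n - m| / n * ‖y‖ ≤ ‖x - y‖ := by
    rw [div_mul_eq_mul_div]
    exact div_le_of_le_mul₀ hn0.le (norm_nonneg _) (mul_le_mul h3 (le_max_right _ _)
      (norm_nonneg _) (norm_nonneg _))
  have h5 : R / m * ‖x - y‖ ≤ 1 * ‖x - y‖ := by gcongr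
  have h6 : R / m * (|n - m| / n * ‖y‖) ≤ 1 * ‖x - y‖ :=
    mul_le_mul h2 h4 (by positivity) zero_le_one
  rw [← mul_assoc] at h6
  change _ ≤ (2 : ℝ) * _
  linarith

end Retract

/-- Global existence for inhomogeneous linear equations on a compact interval. -/
theorem exists_linear_ODE_solution {G : Type*} [NormedAddCommGroup G] [NormedSpace ℝ G]
    [CompleteSpace G] {T : ℝ} (hT : 0 ≤ T) (A : ℝ → G →L[ℝ] G) (b : ℝ → G)
    (hA : ContinuousOn A (Icc 0 T)) (hb : ContinuousOn b (Icc 0 T)) (x₀ : G) :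
    ∃ v : ℝ → G, v 0 = x₀ ∧
      ∀ t ∈ Icc 0 T, HasDerivWithinAt v (A t (v t) + b t) (Icc 0 T) t := by
  obtain ⟨K₁, hK₁⟩ := isCompact_Icc.exists_bound_of_continuousOn hA
  obtain ⟨K₂, hK₂⟩ := isCompact_Icc.exists_bound_of_continuousOn hb
  set K : ℝ := max K₁ K₂ with hKdef
  have hKA : ∀ t ∈ Icc 0 T, ‖A t‖ ≤ K := fun t ht => (hK₁ t ht).trans (le_max_left _ _)
  have hKb : ∀ t ∈ Icc 0 T, ‖b t‖ ≤ K := fun t ht => (hK₂ t ht).trans (le_max_right _ _)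
  have hK : 0 ≤ K := (norm_nonneg _).trans (hKA 0 ⟨le_rfl, hT⟩)
  set δ : ℝ := ‖x₀‖ + 1 with hδ
  have hδ1 : 1 ≤ δ := by rw [hδ]; linarith [norm_nonneg x₀]
  set R : ℝ := δ * Real.exp ((2 * K + 1) * T) with hRdef
  have hR : 0 < R := by positivity
  have hbd : ∀ t ∈ Icc 0 T, ∀ x, ‖A t (radialRetract R x) + b t‖ ≤ K * ‖radialRetract R x‖ + K :=
    fun t ht x => (norm_add_le _ _).trans
      (add_le_add ((A t).le_of_opNorm_le (hKA t ht) _) (hKb t ht))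
  let L : ℝ≥0 := ⟨K * R + K, by positivity⟩
  have hPL : IsPicardLindelof (fun t x => A t (radialRetract R x) + b t)
      (⟨0, le_rfl, hT⟩ : Icc 0 T) x₀ (L * ⟨T, hT⟩) 0 L (⟨K, hK⟩ * 2) := by
    refine ⟨fun t ht => LipschitzWith.lipschitzOnWith ?_, fun x _ => ?_, fun t ht x _ => ?_, ?_⟩
    · have h1 : LipschitzWith ⟨K, hK⟩ (A t) := (A t).lipschitz.weaken (hKA t ht)
      have h2 := (h1.comp (lipschitzWith_radialRetract (G := G) hR)).add
        (LipschitzWith.const (b t))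
      simpa using h2
    · exact (hA.clm_apply continuousOn_const).add hb
    · refine (hbd t ht x).trans ?_
      change _ ≤ K * R + K
      gcongr
      exact norm_radialRetract_le' hR x
    · change (L : ℝ) * max (T - 0) (0 - 0) ≤ (L : ℝ) * T - 0
      simp [hT]
  obtain ⟨v, hv0, hv⟩ := hPL.exists_eq_forall_mem_Icc_hasDerivWithinAt₀
  have hvR : ∀ t ∈ Icc 0 T, ‖v t‖ ≤ R := by
    refine norm_le_mul_exp_of_deriv_right hK (by linarith)
      (fun t ht => (hv t ht).continuousWithinAt)
      (fun t ht => hasDerivWithinAt_Ici_of_Icc ht (hv t (Ico_subset_Icc_self ht))) ?_ ?_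
    · change v 0 = x₀ at hv0
      rw [hv0, hδ]
      linarith
    · intro t ht _
      refine (hbd t (Ico_subset_Icc_self ht) (v t)).trans ?_
      have := norm_radialRetract_le hR (v t)
      nlinarith
  refine ⟨v, hv0, fun t ht => ?_⟩
  have h := hv t ht
  rwa [radialRetract_of_norm_le hR (hvR t ht)] at h

section Param

set_option linter.unusedSectionVars false

variable {E G : Type*} [NormedAddCommGroup E] [NormedSpace ℝ E] [NormedAddCommGroup G]
  [NormedSpace ℝ G] {P : Set E} {T : ℝ} {O : Set G}

theorem exists_close_along_curve {Y : Type*} [NormedAddCommGroup Y] {D : E × ℝ × G → Y}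
    (hO : IsOpen O) (hD : ContinuousOn D (P ×ˢ Icc 0 T ×ˢ O)) {γ : ℝ → G}
    (hγ : ContinuousOn γ (Icc 0 T)) (hγO : ∀ t ∈ Icc 0 T, γ t ∈ O) {y₀ : E} (hy₀ : y₀ ∈ P)
    {η : ℝ} (hη : 0 < η) :
    ∃ r > 0, ∀ t ∈ Icc 0 T, ∀ y ∈ P, ‖y - y₀‖ < r → ∀ g, ‖g - γ t‖ < r →
      g ∈ O ∧ ‖D (y, t, g) - D (y₀, t, γ t)‖ < η := by
  have key : ∀ᶠ z : E × G in 𝓝 (y₀, 0), ∀ t ∈ Icc 0 T, z.1 ∈ P → t ∈ Icc 0 T →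
      γ t + z.2 ∈ O ∧ ‖D (z.1, t, γ t + z.2) - D (y₀, t, γ t)‖ < η := by
    refine isCompact_Icc.eventually_forall_of_forall_eventually fun t₀ ht₀ => ?_
    let S : Set ((E × G) × ℝ) := {z | z.1.1 ∈ P ∧ z.2 ∈ Icc 0 T}
    have hγc : ContinuousWithinAt (fun z : (E × G) × ℝ => γ z.2) S ((y₀, 0), t₀) :=
      ContinuousWithinAt.comp (f := fun z : (E × G) × ℝ => z.2) (hγ t₀ ht₀) continuous_snd.continuousWithinAt fun z hz => hz.2
    have hg : ContinuousWithinAt (fun z : (E × G) × ℝ => γ z.2 + z.1.2) S ((y₀, 0), t₀) :=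
      hγc.add (by fun_prop)
    have h1 : ∀ᶠ z : (E × G) × ℝ in 𝓝[S] ((y₀, 0), t₀), γ z.2 + z.1.2 ∈ O :=
      hg (hO.mem_nhds (by simpa using hγO t₀ ht₀))
    have h2 : ContinuousWithinAt (fun z : (E × G) × ℝ => D (z.1.1, z.2, γ z.2 + z.1.2))
        {z ∈ S | γ z.2 + z.1.2 ∈ O} ((y₀, 0), t₀) := by
      refine ContinuousWithinAt.comp (t := P ×ˢ Icc 0 T ×ˢ O)
        (f := fun z : (E × G) × ℝ => (z.1.1, z.2, γ z.2 + z.1.2))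
        (hD _ ⟨hy₀, ht₀, by simpa using hγO t₀ ht₀⟩) ?_ fun z hz => ⟨hz.1.1, hz.1.2, hz.2⟩
      exact (by fun_prop : ContinuousWithinAt (fun z : (E × G) × ℝ => z.1.1) _ _).prodMk
        ((by fun_prop : ContinuousWithinAt (fun z : (E × G) × ℝ => z.2) _ _).prodMk
          (hg.mono fun z hz => hz.1))
    have h3 : ContinuousWithinAt (fun z : (E × G) × ℝ => D (y₀, z.2, γ z.2)) S ((y₀, 0), t₀) := by
      refine ContinuousWithinAt.comp (t := P ×ˢ Icc 0 T ×ˢ O)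
        (f := fun z : (E × G) × ℝ => (y₀, z.2, γ z.2))
        (hD _ ⟨hy₀, ht₀, hγO t₀ ht₀⟩) ?_ fun z hz => ⟨hy₀, hz.2, hγO _ hz.2⟩
      exact continuousWithinAt_const.prodMk
        ((by fun_prop : ContinuousWithinAt (fun z : (E × G) × ℝ => z.2) _ _).prodMk hγc)
    have h4 := (h2.sub (h3.mono fun z hz => hz.1)).norm
    have h5 : ∀ᶠ z : (E × G) × ℝ in 𝓝[{z ∈ S | γ z.2 + z.1.2 ∈ O}] ((y₀, 0), t₀),
        ‖D (z.1.1, z.2, γ z.2 + z.1.2) - D (y₀, z.2, γ z.2)‖ < η :=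
      h4 (gt_mem_nhds (by simpa using hη))
    rw [eventually_nhdsWithin_iff] at h1 h5
    filter_upwards [h1, h5] with z hz1 hz5 hP ht
    exact ⟨hz1 ⟨hP, ht⟩, hz5 ⟨⟨hP, ht⟩, hz1 ⟨hP, ht⟩⟩⟩
  obtain ⟨r, hr, h⟩ := Metric.eventually_nhds_iff.mp key
  refine ⟨r, hr, fun t ht y hy hyr g hg => ?_⟩
  have h1 := h (y := (y, g - γ t))
    (by rw [Prod.dist_eq, max_lt_iff]; simpa [dist_eq_norm] using ⟨hyr, hg⟩) t ht hy ht
  simpa using h1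

/-- Linear approximation of the field, uniformly along a curve. -/
theorem exists_approx_along_curve {F : E × ℝ × G → G} (hO : IsOpen O)
    (hF : ContDiffOn ℝ ∞ F (P ×ˢ Icc 0 T ×ˢ O)) (hS : UniqueDiffOn ℝ (P ×ˢ Icc 0 T ×ˢ O))
    {γ : ℝ → G} (hγ : ContinuousOn γ (Icc 0 T)) (hγO : ∀ t ∈ Icc 0 T, γ t ∈ O) {y₀ : E}
    (hy₀ : y₀ ∈ P) (hloc : ∃ r > 0, Convex ℝ (P ∩ ball y₀ r)) {η : ℝ} (hη : 0 < η) :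
    ∃ r > 0, ∀ t ∈ Icc 0 T, ∀ y ∈ P, ‖y - y₀‖ < r → ∀ g, ‖g - γ t‖ < r →
      ‖F (y, t, g) - F (y₀, t, γ t) - fderivWithin ℝ F (P ×ˢ Icc 0 T ×ˢ O) (y₀, t, γ t)
        (y - y₀, 0, g - γ t)‖ ≤ η * (‖y - y₀‖ + ‖g - γ t‖) := by
  obtain ⟨r₁, hr₁, h₁⟩ := exists_close_along_curve hO
    (hF.continuousOn_fderivWithin hS (by simp)) hγ hγO hy₀ hη
  obtain ⟨r₂, hr₂, hconv⟩ := hloc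
  set S := P ×ˢ Icc 0 T ×ˢ O with hSdef
  refine ⟨min r₁ r₂, lt_min hr₁ hr₂, fun t ht y hy hyr g hg => ?_⟩
  set C : Set (E × G) := ((P ∩ ball y₀ r₂) ∩ ball y₀ r₁) ×ˢ ball (γ t) r₁ with hC
  have hCconv : Convex ℝ C := (hconv.inter (convex_ball _ _)).prod (convex_ball _ _)
  let j : E × G →L[ℝ] E × ℝ × G :=
    (ContinuousLinearMap.fst ℝ E G).prod
      ((0 : E × G →L[ℝ] ℝ).prod (ContinuousLinearMap.snd ℝ E G))
  have hclose : ∀ z ∈ C, z.2 ∈ O ∧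
      ‖fderivWithin ℝ F S (z.1, t, z.2) - fderivWithin ℝ F S (y₀, t, γ t)‖ < η := fun z hz =>
    h₁ t ht z.1 hz.1.1.1 (by simpa [dist_eq_norm] using hz.1.2) z.2
      (by simpa [dist_eq_norm] using hz.2)
  have hmem : ∀ z ∈ C, ((z.1, t, z.2) : E × ℝ × G) ∈ S := fun z hz =>
    ⟨hz.1.1.1, ht, (hclose z hz).1⟩
  have hder : ∀ z ∈ C, HasFDerivWithinAt (fun z : E × G => F (z.1, t, z.2))
      ((fderivWithin ℝ F S (z.1, t, z.2)).comp j) C z := fun z hz => by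
    have h1 : HasFDerivWithinAt (fun z : E × G => ((z.1, t, z.2) : E × ℝ × G)) j C z :=
      (hasFDerivWithinAt_fst).prodMk ((hasFDerivWithinAt_const t z C).prodMk hasFDerivWithinAt_snd)
    exact (((hF _ (hmem z hz)).differentiableWithinAt (by simp)).hasFDerivWithinAt).comp z h1
      fun w hw => hmem w hw
  have hz₀ : ((y₀, γ t) : E × G) ∈ C :=
    ⟨⟨⟨hy₀, mem_ball_self hr₂⟩, mem_ball_self hr₁⟩, mem_ball_self hr₁⟩
  have hz : ((y, g) : E × G) ∈ C := by
    refine ⟨⟨⟨hy, ?_⟩, ?_⟩, ?_⟩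
    · simpa [dist_eq_norm] using hyr.trans_le (min_le_right _ _)
    · simpa [dist_eq_norm] using hyr.trans_le (min_le_left _ _)
    · simpa [dist_eq_norm] using hg.trans_le (min_le_left _ _)
  have hj : ‖j‖ ≤ 1 := by
    refine ContinuousLinearMap.opNorm_le_bound _ zero_le_one fun z => ?_
    simp [j, Prod.norm_def]
  have hmv := hCconv.norm_image_sub_le_of_norm_hasFDerivWithin_le' (C := η) hder
    (φ := (fderivWithin ℝ F S (y₀, t, γ t)).comp j) (fun z hz => by
      rw [← ContinuousLinearMap.sub_comp]
      refine (ContinuousLinearMap.opNorm_comp_le _ _).trans ?_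
      have := (hclose z hz).2.le
      calc _ ≤ η * 1 := by gcongr
        _ = η := mul_one η) hz₀ hz
  refine hmv.trans ?_
  gcongr
  simp only [Prod.mk_sub_mk, Prod.norm_def]
  exact max_le_add_of_nonneg (norm_nonneg _) (norm_nonneg _)

/-- Solutions with close initial values and close parameters are close. -/
theorem exists_stability {F : E × ℝ × G → G} (hO : IsOpen O)
    (hF : ContDiffOn ℝ ∞ F (P ×ˢ Icc 0 T ×ˢ O)) (hS : UniqueDiffOn ℝ (P ×ˢ Icc 0 T ×ˢ O))
    {γ : ℝ → G} {y₀ : E} (hγO : ∀ t ∈ Icc 0 T, γ t ∈ O)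
    (hγ : ∀ t ∈ Icc 0 T, HasDerivWithinAt γ (F (y₀, t, γ t)) (Icc 0 T) t)
    (hy₀ : y₀ ∈ P) (hloc : ∃ r > 0, Convex ℝ (P ∩ ball y₀ r)) :
    ∃ r > 0, ∃ C > 0, ∀ y ∈ P, ∀ c : ℝ → G,
      (∀ t ∈ Icc 0 T, HasDerivWithinAt c (F (y, t, c t)) (Icc 0 T) t) →
      ∀ δ > 0, δ < r → ‖y - y₀‖ ≤ δ → ‖c 0 - γ 0‖ ≤ δ →
      ∀ t ∈ Icc 0 T, ‖c t - γ t‖ ≤ C * δ := by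
  have hγc : ContinuousOn γ (Icc 0 T) := fun t ht => (hγ t ht).continuousWithinAt
  obtain ⟨r, hr, h⟩ := exists_approx_along_curve hO hF hS hγc hγO hy₀ hloc one_pos
  set S := P ×ˢ Icc 0 T ×ˢ O with hSdef
  have hDc : ContinuousOn (fun t => fderivWithin ℝ F S (y₀, t, γ t)) (Icc 0 T) :=
    (hF.continuousOn_fderivWithin hS (by simp)).comp
      (continuousOn_const.prodMk (continuousOn_id.prodMk hγc)) fun t ht => ⟨hy₀, ht, hγO t ht⟩
  obtain ⟨L, hL⟩ := isCompact_Icc.exists_bound_of_continuousOn hDc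
  set K : ℝ := max L 0 + 1 with hK
  have hK0 : 0 ≤ K := by positivity
  refine ⟨r / Real.exp ((2 * K + 1) * T) / 2 ⊓ r, by positivity, Real.exp ((2 * K + 1) * T),
    Real.exp_pos _, fun y hy c hc δ hδ hδr hyδ hcδ t ht => ?_⟩
  have hδ1 : δ * Real.exp ((2 * K + 1) * T) < r := by
    have h1 := hδr.trans_le inf_le_left
    rw [div_div, lt_div_iff₀ (by positivity)] at h1
    nlinarith [Real.exp_pos ((2 * K + 1) * T)]
  rw [mul_comm]
  have hder := fun t ht => (hc t ht).sub (hγ t ht)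
  refine norm_le_mul_exp_of_deriv_right (f := fun t => c t - γ t) hK0 hδ
    (fun t ht => (hder t ht).continuousWithinAt)
    (fun t ht => hasDerivWithinAt_Ici_of_Icc ht (hder t (Ico_subset_Icc_self ht))) hcδ ?_ t ht
  intro t ht hle
  have ht' := Ico_subset_Icc_self ht
  have h1 := h t ht' y hy (hyδ.trans_lt (hδr.trans_le inf_le_right)) (c t) (hle.trans_lt hδ1)
  have h2 : ‖fderivWithin ℝ F S (y₀, t, γ t) (y - y₀, 0, c t - γ t)‖ ≤
      max L 0 * (‖y - y₀‖ + ‖c t - γ t‖) := by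
    refine (ContinuousLinearMap.le_of_opNorm_le _ ((hL t ht').trans (le_max_left L 0)) _).trans ?_
    gcongr
    simp only [Prod.norm_def, norm_zero]
    exact max_le_add_of_nonneg (norm_nonneg _) (norm_nonneg _) |>.trans' (by simp)
  have h3 := norm_add_le (F (y, t, c t) - F (y₀, t, γ t) - fderivWithin ℝ F S (y₀, t, γ t)
        (y - y₀, 0, c t - γ t)) (fderivWithin ℝ F S (y₀, t, γ t) (y - y₀, 0, c t - γ t))
  rw [sub_add_cancel] at h3
  refine h3.trans ((add_le_add h1 h2).trans ?_)
  have h4 : K * (‖y - y₀‖ + ‖c t - γ t‖) ≤ K * (‖c t - γ t‖ + δ) := by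
    refine mul_le_mul_of_nonneg_left ?_ hK0
    linarith
  linarith [hK]

/-- Uniqueness of solutions. -/
theorem ODE_unique {F : ℝ × G → G} (hO : IsOpen O) (hT : 0 < T)
    (hF : ContDiffOn ℝ ∞ F (Icc 0 T ×ˢ O)) {γ c : ℝ → G} (hγO : ∀ t ∈ Icc 0 T, γ t ∈ O)
    (hγ : ∀ t ∈ Icc 0 T, HasDerivWithinAt γ (F (t, γ t)) (Icc 0 T) t)
    (hc : ∀ t ∈ Icc 0 T, HasDerivWithinAt c (F (t, c t)) (Icc 0 T) t) (h0 : c 0 = γ 0) :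
    ∀ t ∈ Icc 0 T, c t = γ t := by
  intro t ht
  obtain ⟨r, hr, C, hC, h⟩ := exists_stability (E := ℝ) (P := univ) (y₀ := 0)
    (F := fun z => F z.2) hO
    (hF.comp (t := Icc 0 T ×ˢ O) contDiff_snd.contDiffOn fun z hz => hz.2)
    (uniqueDiffOn_univ.prod ((uniqueDiffOn_Icc hT).prod hO.uniqueDiffOn)) hγO hγ (mem_univ _)
    ⟨1, one_pos, by simpa using convex_ball (0 : ℝ) 1⟩
  have h1 : ∀ δ > 0, δ < r → ‖c t - γ t‖ ≤ C * δ := fun δ hδ hδr =>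
    h 0 (mem_univ _) c hc δ hδ hδr (by simpa using hδ.le) (by simpa [h0] using hδ.le) t ht
  have h2 : ‖c t - γ t‖ ≤ 0 := by
    have h3 : Tendsto (fun δ => C * δ) (𝓝[>] 0) (𝓝 (C * 0)) :=
      ((continuous_const.mul continuous_id).tendsto 0).mono_left nhdsWithin_le_nhds
    rw [mul_zero] at h3
    refine ge_of_tendsto h3 ?_
    filter_upwards [Ioo_mem_nhdsGT hr] with δ hδ using h1 δ hδ.1 hδ.2
  exact sub_eq_zero.mp (norm_le_zero_iff.mp h2)

/-- The linearized field, for the derivative of solutions with respect to the parameter. -/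
def linearizedField (F : E × ℝ × G → G) (S : Set (E × ℝ × G)) (z : E × ℝ × G)
    (A : E →L[ℝ] G) : E →L[ℝ] G :=
  (fderivWithin ℝ F S z).comp ((ContinuousLinearMap.id ℝ E).prod ((0 : E →L[ℝ] ℝ).prod A))

/-- Differentiability of solutions with respect to the parameter, uniformly in time. -/
theorem exists_uniform_deriv {F : E × ℝ × G → G} (hO : IsOpen O)
    (hF : ContDiffOn ℝ ∞ F (P ×ˢ Icc 0 T ×ˢ O)) (hS : UniqueDiffOn ℝ (P ×ˢ Icc 0 T ×ˢ O))
    {u : E × ℝ → G} (huO : ∀ y ∈ P, ∀ t ∈ Icc 0 T, u (y, t) ∈ O)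
    (hu : ∀ y ∈ P, ∀ t ∈ Icc 0 T,
      HasDerivWithinAt (fun s => u (y, s)) (F (y, t, u (y, t))) (Icc 0 T) t)
    {y₀ : E} (hy₀ : y₀ ∈ P) (hloc : ∃ r > 0, Convex ℝ (P ∩ ball y₀ r))
    {v : ℝ → E →L[ℝ] G} (hu0 : HasFDerivWithinAt (fun y => u (y, 0)) (v 0) P y₀)
    (hv : ∀ t ∈ Icc 0 T, HasDerivWithinAt v
      (linearizedField F (P ×ˢ Icc 0 T ×ˢ O) (y₀, t, u (y₀, t)) (v t)) (Icc 0 T) t)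
    {η : ℝ} (hη : 0 < η) :
    ∀ᶠ y in 𝓝[P] y₀, ∀ t ∈ Icc 0 T,
      ‖u (y, t) - u (y₀, t) - v t (y - y₀)‖ ≤ η * ‖y - y₀‖ := by
  set γ : ℝ → G := fun t => u (y₀, t) with hγdef
  have hγ := hu y₀ hy₀
  have hγO := huO y₀ hy₀
  have hγc : ContinuousOn γ (Icc 0 T) := fun t ht => (hγ t ht).continuousWithinAt
  obtain ⟨r, hr, C, hC, hstab⟩ := exists_stability hO hF hS hγO hγ hy₀ hloc
  set S := P ×ˢ Icc 0 T ×ˢ O with hSdef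
  have hDc : ContinuousOn (fun t => fderivWithin ℝ F S (y₀, t, γ t)) (Icc 0 T) :=
    (hF.continuousOn_fderivWithin hS (by simp)).comp
      (continuousOn_const.prodMk (continuousOn_id.prodMk hγc)) fun t ht => ⟨hy₀, ht, hγO t ht⟩
  obtain ⟨L, hL⟩ := isCompact_Icc.exists_bound_of_continuousOn hDc
  set c : ℝ := ‖v 0‖ + 1 with hc
  have hc1 : 1 ≤ c := by rw [hc]; linarith [norm_nonneg (v 0)]
  set K : ℝ := max L 0 + (1 + C * c) with hK
  have hK0 : 0 ≤ K := by positivity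
  set η' : ℝ := η / Real.exp ((2 * K + 1) * T) with hη'
  have hη'0 : 0 < η' := by positivity
  obtain ⟨r₂, hr₂, happ⟩ := exists_approx_along_curve hO hF hS hγc hγO hy₀ hloc hη'0
  have hlip : ∀ᶠ y in 𝓝[P] y₀, ‖u (y, 0) - u (y₀, 0)‖ ≤ c * ‖y - y₀‖ := by
    filter_upwards [hu0.isLittleO.def one_pos] with y hy
    have h1 := norm_add_le (u (y, 0) - u (y₀, 0) - v 0 (y - y₀)) (v 0 (y - y₀))
    rw [sub_add_cancel] at h1
    have h2 := (v 0).le_opNorm (y - y₀)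
    rw [hc, add_mul]
    linarith
  have hsmall : ∀ᶠ y in 𝓝[P] y₀, c * ‖y - y₀‖ < min (min r r₂) (r₂ / C) := by
    have h1 : Tendsto (fun y => c * ‖y - y₀‖) (𝓝[P] y₀) (𝓝 (c * ‖y₀ - y₀‖)) :=
      (Continuous.tendsto (by fun_prop) y₀).mono_left nhdsWithin_le_nhds
    refine h1.eventually (gt_mem_nhds ?_)
    rw [sub_self, norm_zero, mul_zero]
    positivity
  filter_upwards [hlip, hsmall, hu0.isLittleO.def hη'0, self_mem_nhdsWithin]
    with y hylip hysmall hyinit hyP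
  rcases eq_or_ne y y₀ with rfl | hne
  · intro t ht
    simp
  have hh : 0 < ‖y - y₀‖ := norm_pos_iff.mpr (sub_ne_zero.mpr hne)
  have hle : ‖y - y₀‖ ≤ c * ‖y - y₀‖ := le_mul_of_one_le_left hh.le hc1
  have hdiff : ∀ t ∈ Icc 0 T, ‖u (y, t) - γ t‖ ≤ C * (c * ‖y - y₀‖) :=
    hstab y hyP (fun t => u (y, t)) (hu y hyP) (c * ‖y - y₀‖) (by positivity)
      (hysmall.trans_le ((min_le_left _ _).trans (min_le_left _ _))) hle hylip
  have hder : ∀ t ∈ Icc 0 T, HasDerivWithinAt (fun t => u (y, t) - γ t - v t (y - y₀))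
      (F (y, t, u (y, t)) - F (y₀, t, γ t) -
        linearizedField F S (y₀, t, γ t) (v t) (y - y₀)) (Icc 0 T) t := fun t ht =>
    ((hu y hyP t ht).sub (hγ t ht)).sub
      (((ContinuousLinearMap.apply ℝ G (y - y₀)).hasFDerivAt.comp_hasDerivWithinAt t (hv t ht)))
  intro t ht
  have hfin := norm_le_mul_exp_of_deriv_right (f := fun t => u (y, t) - γ t - v t (y - y₀)) hK0
    (mul_pos hη'0 hh) (fun t ht => (hder t ht).continuousWithinAt)
    (fun t ht => hasDerivWithinAt_Ici_of_Icc ht (hder t (Ico_subset_Icc_self ht))) hyinit ?_ t ht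
  · refine hfin.trans_eq ?_
    rw [hη']
    field_simp
  · intro t ht _
    have ht' := Ico_subset_Icc_self ht
    have h1 := happ t ht' y hyP
      (hle.trans_lt (hysmall.trans_le ((min_le_left _ _).trans (min_le_right _ _)))) (u (y, t)) (by
        refine (hdiff t ht').trans_lt ?_
        have := hysmall.trans_le (min_le_right _ _)
        rwa [lt_div_iff₀ hC, mul_comm] at this)
    set w := u (y, t) - γ t - v t (y - y₀) with hw
    have h2 : fderivWithin ℝ F S (y₀, t, γ t) (y - y₀, 0, u (y, t) - γ t) =
        linearizedField F S (y₀, t, γ t) (v t) (y - y₀) +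
          fderivWithin ℝ F S (y₀, t, γ t) (0, 0, w) := by
      rw [linearizedField, ContinuousLinearMap.comp_apply, ← map_add]
      congr 1
      simp [hw]
    have h3 : ‖fderivWithin ℝ F S (y₀, t, γ t) (0, 0, w)‖ ≤ max L 0 * ‖w‖ := by
      refine (ContinuousLinearMap.le_of_opNorm_le _ ((hL t ht').trans (le_max_left L 0)) _).trans ?_
      simp [Prod.norm_def]
    rw [h2, ← sub_sub] at h1
    have h4 := norm_add_le (F (y, t, u (y, t)) - F (y₀, t, γ t) -
      linearizedField F S (y₀, t, γ t) (v t) (y - y₀) - fderivWithin ℝ F S (y₀, t, γ t) (0, 0, w))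
      (fderivWithin ℝ F S (y₀, t, γ t) (0, 0, w))
    rw [sub_add_cancel] at h4
    have h5 : η' * (‖y - y₀‖ + ‖u (y, t) - γ t‖) ≤ η' * ((1 + C * c) * ‖y - y₀‖) := by
      gcongr
      linarith [hdiff t ht']
    calc _ ≤ η' * ((1 + C * c) * ‖y - y₀‖) + max L 0 * ‖w‖ := by linarith
      _ = (1 + C * c) * (η' * ‖y - y₀‖) + max L 0 * ‖w‖ := by ring
      _ ≤ K * (η' * ‖y - y₀‖) + K * ‖w‖ := by
        have h6 : 1 + C * c ≤ K := by rw [hK]; linarith [le_max_right L 0]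
        have h7 : max L 0 ≤ K := by rw [hK]; nlinarith
        gcongr
      _ = K * (‖w‖ + η' * ‖y - y₀‖) := by ring

/-- The solution map is differentiable in the parameter and time. -/
theorem hasFDerivWithinAt_solution {F : E × ℝ × G → G} (hO : IsOpen O)
    (hF : ContDiffOn ℝ ∞ F (P ×ˢ Icc 0 T ×ˢ O)) (hS : UniqueDiffOn ℝ (P ×ˢ Icc 0 T ×ˢ O))
    {u : E × ℝ → G} (huO : ∀ y ∈ P, ∀ t ∈ Icc 0 T, u (y, t) ∈ O)
    (hu : ∀ y ∈ P, ∀ t ∈ Icc 0 T,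
      HasDerivWithinAt (fun s => u (y, s)) (F (y, t, u (y, t))) (Icc 0 T) t)
    {y₀ : E} (hy₀ : y₀ ∈ P) (hloc : ∃ r > 0, Convex ℝ (P ∩ ball y₀ r))
    {v : ℝ → E →L[ℝ] G} (hu0 : HasFDerivWithinAt (fun y => u (y, 0)) (v 0) P y₀)
    (hv : ∀ t ∈ Icc 0 T, HasDerivWithinAt v
      (linearizedField F (P ×ˢ Icc 0 T ×ˢ O) (y₀, t, u (y₀, t)) (v t)) (Icc 0 T) t)
    {t₀ : ℝ} (ht₀ : t₀ ∈ Icc 0 T) :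
    HasFDerivWithinAt u ((v t₀).coprod
      (ContinuousLinearMap.toSpanSingleton ℝ (F (y₀, t₀, u (y₀, t₀))))) (P ×ˢ Icc 0 T)
      (y₀, t₀) := by
  rw [hasFDerivWithinAt_iff_isLittleO, Asymptotics.isLittleO_iff]
  intro η hη
  have hη3 : 0 < η / 3 := by positivity
  have h1 := exists_uniform_deriv hO hF hS huO hu hy₀ hloc hu0 hv hη3
  have h2 := (hasDerivWithinAt_iff_isLittleO.mp (hu y₀ hy₀ t₀ ht₀)).def hη3
  have h3 : ∀ᶠ t in 𝓝[Icc 0 T] t₀, ‖v t - v t₀‖ < η / 3 := by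
    have := (hv t₀ ht₀).continuousWithinAt
    have h4 : Tendsto (fun t => ‖v t - v t₀‖) (𝓝[Icc 0 T] t₀) (𝓝 ‖v t₀ - v t₀‖) :=
      (this.sub continuousWithinAt_const).norm
    refine h4.eventually (gt_mem_nhds ?_)
    simpa using hη
  rw [nhdsWithin_prod_eq]
  filter_upwards [h1.prod_mk ((h2.and h3).and self_mem_nhdsWithin)] with z hz
  obtain ⟨hz1, ⟨hz2, hz3⟩, hz4⟩ := hz
  have e : u z - u (y₀, t₀) - ((v t₀).coprod (ContinuousLinearMap.toSpanSingleton ℝ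
      (F (y₀, t₀, u (y₀, t₀))))) (z - (y₀, t₀)) =
      (u (z.1, z.2) - u (y₀, z.2) - v z.2 (z.1 - y₀)) + (v z.2 - v t₀) (z.1 - y₀) +
      (u (y₀, z.2) - u (y₀, t₀) - (z.2 - t₀) • F (y₀, t₀, u (y₀, t₀))) := by
    simp only [ContinuousLinearMap.coprod_apply, ContinuousLinearMap.toSpanSingleton_apply,
      Prod.fst_sub, Prod.snd_sub, sub_apply]
    abel
  rw [e]
  have n1 : ‖z.1 - y₀‖ ≤ ‖z - (y₀, t₀)‖ := norm_fst_le (z - (y₀, t₀))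
  have n2 : ‖z.2 - t₀‖ ≤ ‖z - (y₀, t₀)‖ := norm_snd_le (z - (y₀, t₀))
  have b1 := hz1 z.2 hz4
  have b2 := (v z.2 - v t₀).le_of_opNorm_le hz3.le (z.1 - y₀)
  refine (norm_add₃_le).trans ?_
  nlinarith

theorem exists_solution_deriv [CompleteSpace G] (hT : 0 < T) (hP : UniqueDiffOn ℝ P)
    (hloc : ∀ y ∈ P, ∃ r > 0, Convex ℝ (P ∩ ball y r)) {F : E × ℝ × G → G} (hO : IsOpen O)
    (hF : ContDiffOn ℝ ∞ F (P ×ˢ Icc 0 T ×ˢ O))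
    {u : E × ℝ → G} (huO : ∀ y ∈ P, ∀ t ∈ Icc 0 T, u (y, t) ∈ O)
    (hu : ∀ y ∈ P, ∀ t ∈ Icc 0 T,
      HasDerivWithinAt (fun s => u (y, s)) (F (y, t, u (y, t))) (Icc 0 T) t)
    (hu0 : ContDiffOn ℝ ∞ (fun y => u (y, 0)) P) :
    ∃ v : E → ℝ → E →L[ℝ] G, (∀ y ∈ P, v y 0 = fderivWithin ℝ (fun y => u (y, 0)) P y) ∧
      (∀ y ∈ P, ∀ t ∈ Icc 0 T, HasDerivWithinAt (v y)
        (linearizedField F (P ×ˢ Icc 0 T ×ˢ O) (y, t, u (y, t)) (v y t)) (Icc 0 T) t) ∧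
      ∀ z ∈ P ×ˢ Icc 0 T, HasFDerivWithinAt u ((v z.1 z.2).coprod
        (ContinuousLinearMap.toSpanSingleton ℝ (F (z.1, z.2, u z)))) (P ×ˢ Icc 0 T) z := by
  have hS : UniqueDiffOn ℝ (P ×ˢ Icc 0 T ×ˢ O) :=
    hP.prod ((uniqueDiffOn_Icc hT).prod hO.uniqueDiffOn)
  set S := P ×ˢ Icc 0 T ×ˢ O with hSdef
  have hex : ∀ y ∈ P, ∃ v : ℝ → E →L[ℝ] G, v 0 = fderivWithin ℝ (fun y => u (y, 0)) P y ∧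
      ∀ t ∈ Icc 0 T, HasDerivWithinAt v (linearizedField F S (y, t, u (y, t)) (v t))
        (Icc 0 T) t := fun y hy => by
    have hγc : ContinuousOn (fun t => u (y, t)) (Icc 0 T) :=
      fun t ht => (hu y hy t ht).continuousWithinAt
    have hDc : ContinuousOn (fun t => fderivWithin ℝ F S (y, t, u (y, t))) (Icc 0 T) :=
      (hF.continuousOn_fderivWithin hS (by simp)).comp
        (continuousOn_const.prodMk (continuousOn_id.prodMk hγc)) fun t ht => ⟨hy, ht, huO y hy t ht⟩
    let j₁ : E →L[ℝ] E × ℝ × G := ContinuousLinearMap.inl ℝ E (ℝ × G)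
    let j₂ : G →L[ℝ] E × ℝ × G :=
      (ContinuousLinearMap.inr ℝ E (ℝ × G)).comp (ContinuousLinearMap.inr ℝ ℝ G)
    obtain ⟨v, hv0, hv⟩ := exists_linear_ODE_solution hT.le
      (fun t => ContinuousLinearMap.compL ℝ E G G ((fderivWithin ℝ F S (y, t, u (y, t))).comp j₂))
      (fun t => (fderivWithin ℝ F S (y, t, u (y, t))).comp j₁)
      ((ContinuousLinearMap.continuous _).comp_continuousOn (hDc.clm_comp continuousOn_const))
      (hDc.clm_comp continuousOn_const) (fderivWithin ℝ (fun y => u (y, 0)) P y)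
    refine ⟨v, hv0, fun t ht => (hv t ht).congr_deriv ?_⟩
    ext h
    simp only [linearizedField, ContinuousLinearMap.compL_apply, add_apply,
      ContinuousLinearMap.comp_apply]
    rw [← map_add]
    congr 1
    simp [j₁, j₂]
  choose! v hv0 hv using hex
  refine ⟨v, hv0, hv, fun z hz => hasFDerivWithinAt_solution hO hF hS huO hu hz.1 (hloc _ hz.1)
    ?_ (hv _ hz.1) hz.2⟩
  rw [hv0 _ hz.1]
  exact ((hu0 _ hz.1).differentiableWithinAt (by simp)).hasFDerivWithinAt

end Param

universe w₁ w₂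

theorem contDiffOn_solution_nat {E : Type w₁} [NormedAddCommGroup E] [NormedSpace ℝ E]
    {P : Set E} {T : ℝ} (hT : 0 < T) (hP : UniqueDiffOn ℝ P)
    (hloc : ∀ y ∈ P, ∃ r > 0, Convex ℝ (P ∩ ball y r)) (n : ℕ) :
    ∀ {G : Type (max w₁ w₂)} [NormedAddCommGroup G] [NormedSpace ℝ G] [CompleteSpace G]
      {O : Set G} (_ : IsOpen O) {F : E × ℝ × G → G} (_ : ContDiffOn ℝ ∞ F (P ×ˢ Icc 0 T ×ˢ O))
      {u : E × ℝ → G} (_ : ∀ y ∈ P, ∀ t ∈ Icc 0 T, u (y, t) ∈ O)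
      (_ : ∀ y ∈ P, ∀ t ∈ Icc 0 T,
        HasDerivWithinAt (fun s => u (y, s)) (F (y, t, u (y, t))) (Icc 0 T) t)
      (_ : ContDiffOn ℝ ∞ (fun y => u (y, 0)) P), ContDiffOn ℝ n u (P ×ˢ Icc 0 T) := by
  induction n with
  | zero =>
    intro G _ _ _ O hO F hF u huO hu hu0
    obtain ⟨v, -, -, hud⟩ := exists_solution_deriv hT hP hloc hO hF huO hu hu0
    rw [Nat.cast_zero, contDiffOn_zero]
    exact fun z hz => (hud z hz).continuousWithinAt
  | succ n ih =>
    intro G _ _ _ O hO F hF u huO hu hu0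
    obtain ⟨v, hv0, hv, hud⟩ := exists_solution_deriv hT hP hloc hO hF huO hu hu0
    have hS : UniqueDiffOn ℝ (P ×ˢ Icc 0 T ×ˢ O) :=
      hP.prod ((uniqueDiffOn_Icc hT).prod hO.uniqueDiffOn)
    set S := P ×ˢ Icc 0 T ×ˢ O with hSdef
    have hpair : ContDiffOn ℝ n (fun z : E × ℝ => (u z, v z.1 z.2)) (P ×ˢ Icc 0 T) := by
      refine ih (O := O ×ˢ univ) (hO.prod isOpen_univ)
        (F := fun z => (F (z.1, z.2.1, z.2.2.1),
          linearizedField F S (z.1, z.2.1, z.2.2.1) z.2.2.2)) ?_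
        (fun y hy t ht => ⟨huO y hy t ht, mem_univ _⟩)
        (fun y hy t ht => (hu y hy t ht).prodMk (hv y hy t ht)) ?_
      · have hproj : ContDiffOn ℝ ∞
            (fun z : E × ℝ × G × (E →L[ℝ] G) => ((z.1, z.2.1, z.2.2.1) : E × ℝ × G))
            (P ×ˢ Icc 0 T ×ˢ O ×ˢ univ) := by fun_prop
        have hmaps : MapsTo
            (fun z : E × ℝ × G × (E →L[ℝ] G) => ((z.1, z.2.1, z.2.2.1) : E × ℝ × G))
            (P ×ˢ Icc 0 T ×ˢ O ×ˢ univ) S := fun z hz => ⟨hz.1, hz.2.1, hz.2.2.1⟩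
        refine (hF.comp hproj hmaps).prodMk ?_
        refine (((hF.fderivWithin hS (m := ∞) (by simp)).comp hproj hmaps).clm_comp ?_)
        have hlin : (fun z : E × ℝ × G × (E →L[ℝ] G) =>
            (ContinuousLinearMap.id ℝ E).prod ((0 : E →L[ℝ] ℝ).prod z.2.2.2)) =
            fun z => ContinuousLinearMap.inl ℝ E (ℝ × G) +
              ((ContinuousLinearMap.inr ℝ E (ℝ × G)).comp
                (ContinuousLinearMap.inr ℝ ℝ G)).comp z.2.2.2 := by
          funext z
          ext h <;> simp
        rw [hlin]
        exact (contDiff_const.add (contDiff_const.clm_comp (by fun_prop))).contDiffOn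
      · exact hu0.prodMk ((hu0.fderivWithin hP (m := ∞) (by simp)).congr hv0)
    push_cast
    rw [contDiffOn_succ_iff_hasFDerivWithinAt_of_uniqueDiffOn (hP.prod (uniqueDiffOn_Icc hT))]
    refine ⟨by simp, _, ?_, hud⟩
    have hFu : ContDiffOn ℝ n (fun z : E × ℝ => F (z.1, z.2, u z)) (P ×ˢ Icc 0 T) :=
      (hF.of_le (by exact_mod_cast le_top)).comp
        (contDiffOn_fst.prodMk (contDiffOn_snd.prodMk hpair.fst))
        fun z hz => ⟨hz.1, hz.2, huO _ hz.1 _ hz.2⟩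
    have hlin : (fun z : E × ℝ => (v z.1 z.2).coprod
        (ContinuousLinearMap.toSpanSingleton ℝ (F (z.1, z.2, u z)))) =
        fun z => (v z.1 z.2).comp (ContinuousLinearMap.fst ℝ E ℝ) +
          (ContinuousLinearMap.toSpanSingletonCLE (𝕜 := ℝ) (E := G) (F (z.1, z.2, u z))).comp
            (ContinuousLinearMap.snd ℝ E ℝ) := by
      funext z
      ext h <;> simp
    rw [hlin]
    exact (hpair.snd.clm_comp contDiffOn_const).add
      (((ContinuousLinearMap.toSpanSingletonCLE (𝕜 := ℝ) (E := G)).contDiff.comp_contDiffOn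
        hFu).clm_comp contDiffOn_const)

/-- Smooth dependence of solutions on parameters. The parameters range over a set that is locally
convex with unique derivatives, such as a relatively open subset of a convex set with nonempty
interior. -/
theorem contDiffOn_solution {E : Type w₁} [NormedAddCommGroup E] [NormedSpace ℝ E]
    {P : Set E} {T : ℝ} (hT : 0 < T) (hP : UniqueDiffOn ℝ P)
    (hloc : ∀ y ∈ P, ∃ r > 0, Convex ℝ (P ∩ ball y r))
    {G : Type (max w₁ w₂)} [NormedAddCommGroup G] [NormedSpace ℝ G] [CompleteSpace G]
    {O : Set G} (hO : IsOpen O) {F : E × ℝ × G → G} (hF : ContDiffOn ℝ ∞ F (P ×ˢ Icc 0 T ×ˢ O))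
    {u : E × ℝ → G} (huO : ∀ y ∈ P, ∀ t ∈ Icc 0 T, u (y, t) ∈ O)
    (hu : ∀ y ∈ P, ∀ t ∈ Icc 0 T,
      HasDerivWithinAt (fun s => u (y, s)) (F (y, t, u (y, t))) (Icc 0 T) t)
    (hu0 : ContDiffOn ℝ ∞ (fun y => u (y, 0)) P) : ContDiffOn ℝ ∞ u (P ×ˢ Icc 0 T) :=
  contDiffOn_infty.mpr fun n => contDiffOn_solution_nat.{w₁, w₂} hT hP hloc n hO hF huO hu hu0

end ODE

/-! ### Algebra of forms at a point -/

section LamAlgebra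

set_option linter.unusedSectionVars false

variable {V V' V'' : Type*} [AddCommGroup V] [Module ℝ V] [AddCommGroup V'] [Module ℝ V']
  [AddCommGroup V''] [Module ℝ V'']

/-- Left multiplication induction. -/
theorem lam_induction {M : Type*} [AddCommGroup M] [Module ℝ M] {P : ExteriorAlgebra ℝ M → Prop}
    (algebraMap : ∀ r : ℝ, P (algebraMap ℝ _ r)) (add : ∀ x y, P x → P y → P (x + y))
    (ι_mul : ∀ (θ : M) x, P x → P (ExteriorAlgebra.ι ℝ θ * x)) (x : ExteriorAlgebra ℝ M) : P x :=
  CliffordAlgebra.left_induction (Q := (0 : QuadraticForm ℝ M)) algebraMap add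
    (fun x θ hx => ι_mul θ x hx) x

@[simp] theorem pull_ι (L : V →ₗ[ℝ] V') (θ : Module.Dual ℝ V') :
    pull L (ExteriorAlgebra.ι ℝ θ) = ExteriorAlgebra.ι ℝ (θ ∘ₗ L) :=
  ExteriorAlgebra.map_apply_ι _ _

theorem pull_pull (L : V →ₗ[ℝ] V') (L' : V' →ₗ[ℝ] V'') (α : Lam V'') :
    pull L (pull L' α) = pull (L' ∘ₗ L) α := by
  induction α using lam_induction with
  | algebraMap r => simp
  | add x y hx hy => simp only [map_add, hx, hy]
  | ι_mul θ x hx => simp only [map_mul, hx, pull_ι, LinearMap.comp_assoc]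

@[simp] theorem pull_id (α : Lam V) : pull LinearMap.id α = α := by
  induction α using lam_induction with
  | algebraMap r => simp
  | add x y hx hy => simp only [map_add, hx, hy]
  | ι_mul θ x hx => simp only [map_mul, hx, pull_ι, LinearMap.comp_id]

theorem pull_mem (L : V →ₗ[ℝ] V') {n : ℕ} {x : Lam V'} (hx : x ∈ ⋀[ℝ]^n (Module.Dual ℝ V')) :
    pull L x ∈ ⋀[ℝ]^n (Module.Dual ℝ V) := by
  induction hx using Submodule.pow_induction_on_left' with
  | algebraMap r =>
    rw [AlgHom.commutes]
    exact SetLike.algebraMap_mem_graded (fun i : ℕ ↦ ⋀[ℝ]^i (Module.Dual ℝ V)) r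
  | add x y i hx hy ihx ihy => rw [map_add]; exact add_mem ihx ihy
  | mem_mul m hm i x hx ih =>
    obtain ⟨w, rfl⟩ := hm
    rw [map_mul, pull_ι]
    change _ ∈ LinearMap.range (ExteriorAlgebra.ι ℝ) ^ (i + 1)
    rw [pow_succ']
    exact Submodule.mul_mem_mul ⟨_, rfl⟩ ih

theorem pull_homogPart (L : V →ₗ[ℝ] V') {k : ℤ} {x : Lam V'} (hx : x ∈ homogPart V' k) :
    pull L x ∈ homogPart V k := by
  cases k with
  | ofNat n => exact pull_mem L hx
  | negSucc n =>
    have : x = 0 := hx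
    rw [this, map_zero]
    exact zero_mem _

theorem mem_homogPart_neg_one_add {n : ℕ} {x : Lam V} (hx : x ∈ homogPart V (-1 + (n + 1 : ℕ))) :
    x ∈ ⋀[ℝ]^n (Module.Dual ℝ V) := by
  have : (-1 + (n + 1 : ℕ) : ℤ) = n := by push_cast; ring
  rwa [this] at hx

theorem eq_zero_of_mem_homogPart_neg_one {x : Lam V} (hx : x ∈ homogPart V (-1 + (0 : ℕ))) :
    x = 0 := hx

theorem algebraMap_mem_lam (r : ℝ) : algebraMap ℝ (Lam V) r ∈ ⋀[ℝ]^0 (Module.Dual ℝ V) :=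
  SetLike.algebraMap_mem_graded (fun i : ℕ ↦ ⋀[ℝ]^i (Module.Dual ℝ V)) r

theorem mul_mem_lam {m n : ℕ} {x y : Lam V} (hx : x ∈ ⋀[ℝ]^m (Module.Dual ℝ V))
    (hy : y ∈ ⋀[ℝ]^n (Module.Dual ℝ V)) : x * y ∈ ⋀[ℝ]^(m + n) (Module.Dual ℝ V) :=
  SetLike.mul_mem_graded (A := fun i : ℕ ↦ ⋀[ℝ]^i (Module.Dual ℝ V)) hx hy

theorem ι_mem_lam (θ : Module.Dual ℝ V) :
    (ExteriorAlgebra.ι ℝ θ : Lam V) ∈ ⋀[ℝ]^1 (Module.Dual ℝ V) := by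
  change _ ∈ LinearMap.range (ExteriorAlgebra.ι ℝ) ^ 1
  rw [pow_one]
  exact ⟨θ, rfl⟩

@[simp] theorem scalar_ι (θ : Module.Dual ℝ V) : scalar (ExteriorAlgebra.ι ℝ θ : Lam V) = 0 := by
  rw [scalar, ExteriorAlgebra.algebraMapInv, ExteriorAlgebra.lift_ι_apply]
  rfl

@[simp] theorem scalar_algebraMap (r : ℝ) : scalar (algebraMap ℝ (Lam V) r) = r :=
  scalar.commutes r

@[simp] theorem scalar_pull (L : V →ₗ[ℝ] V') (α : Lam V') : scalar (pull L α) = scalar α := by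
  induction α using lam_induction with
  | algebraMap r => rw [AlgHom.commutes, scalar_algebraMap, scalar_algebraMap]
  | add x y hx hy => rw [map_add, map_add, map_add, hx, hy]
  | ι_mul θ x hx => rw [map_mul, map_mul, map_mul, pull_ι, scalar_ι, scalar_ι, zero_mul, zero_mul]

theorem eq_algebraMap_scalar {x : Lam V} (hx : x ∈ ⋀[ℝ]^0 (Module.Dual ℝ V)) :
    x = algebraMap ℝ _ (scalar x) := by
  change _ ∈ LinearMap.range (ExteriorAlgebra.ι ℝ) ^ 0 at hx
  rw [pow_zero] at hx
  obtain ⟨r, rfl⟩ := Submodule.mem_one.mp hx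
  rw [scalar_algebraMap]

theorem contract_ι_mul (v : V) (θ : Module.Dual ℝ V) (β : Lam V) :
    contract v (ExteriorAlgebra.ι ℝ θ * β) = θ v • β - ExteriorAlgebra.ι ℝ θ * contract v β :=
  CliffordAlgebra.contractLeft_ι_mul (Q := (0 : QuadraticForm ℝ (Module.Dual ℝ V))) _ _ _

@[simp] theorem contract_algebraMap (v : V) (r : ℝ) :
    contract v (algebraMap ℝ (Lam V) r) = 0 :=
  CliffordAlgebra.contractLeft_algebraMap (Q := (0 : QuadraticForm ℝ (Module.Dual ℝ V))) _ _

theorem contract_contract (v : V) (α : Lam V) : contract v (contract v α) = 0 :=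
  CliffordAlgebra.contractLeft_contractLeft (Q := (0 : QuadraticForm ℝ (Module.Dual ℝ V))) _ _

theorem contract_of_mem_zero (v : V) {x : Lam V} (hx : x ∈ ⋀[ℝ]^0 (Module.Dual ℝ V)) :
    contract v x = 0 := by
  rw [eq_algebraMap_scalar hx, contract_algebraMap]

theorem contract_mem_aux (v : V) {n : ℕ} {x : Lam V} (hx : x ∈ ⋀[ℝ]^n (Module.Dual ℝ V)) :
    contract v x ∈ ⋀[ℝ]^(n - 1) (Module.Dual ℝ V) ∧ (n = 0 → contract v x = 0) := by
  induction hx using Submodule.pow_induction_on_left' with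
  | algebraMap r => simp
  | add x y i hx hy ihx ihy =>
    rw [map_add]
    exact ⟨add_mem ihx.1 ihy.1, fun h => by rw [ihx.2 h, ihy.2 h, add_zero]⟩
  | mem_mul m hm i x hx ih =>
    obtain ⟨θ, rfl⟩ := hm
    refine ⟨?_, fun h => by simp at h⟩
    rw [contract_ι_mul, Nat.succ_sub_one]
    refine sub_mem (Submodule.smul_mem _ _ hx) ?_
    rcases Nat.eq_zero_or_pos i with h | h
    · rw [ih.2 h, mul_zero]
      exact zero_mem _
    · have := mul_mem_lam (ι_mem_lam θ) ih.1
      rwa [Nat.add_sub_cancel' h] at this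

theorem contract_mem (v : V) {n : ℕ} {x : Lam V} (hx : x ∈ ⋀[ℝ]^(n + 1) (Module.Dual ℝ V)) :
    contract v x ∈ ⋀[ℝ]^n (Module.Dual ℝ V) :=
  (contract_mem_aux v hx).1

/-- Interior products are odd derivations. -/
theorem contract_mul (v : V) {m : ℕ} {x : Lam V} (hx : x ∈ ⋀[ℝ]^m (Module.Dual ℝ V))
    (y : Lam V) :
    contract v (x * y) = contract v x * y + (-1 : ℝ) ^ m • (x * contract v y) := by
  induction hx using Submodule.pow_induction_on_left' with
  | algebraMap r =>
    rw [contract_algebraMap, zero_mul, zero_add, pow_zero, one_smul, ← Algebra.smul_def, map_smul,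
      Algebra.smul_def]
  | add x z i hx hz ihx ihz =>
    rw [add_mul, map_add, ihx, ihz, map_add, add_mul, add_mul, smul_add]
    abel
  | mem_mul w hw i x hx ih =>
    obtain ⟨θ, rfl⟩ := hw
    rw [mul_assoc, contract_ι_mul, ih, contract_ι_mul, mul_add, sub_mul, smul_mul_assoc, mul_assoc,
      mul_smul_comm, pow_succ', neg_one_mul, neg_smul, mul_assoc]
    abel

theorem contract_pull (L : V →ₗ[ℝ] V') (v : V) (α : Lam V') :
    contract v (pull L α) = pull L (contract (L v) α) := by
  induction α using lam_induction with
  | algebraMap r => rw [AlgHom.commutes, contract_algebraMap, contract_algebraMap, map_zero]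
  | add x y hx hy => simp only [map_add, hx, hy]
  | ι_mul θ x hx =>
    rw [map_mul, pull_ι, contract_ι_mul, hx, contract_ι_mul, map_sub, map_smul, map_mul, pull_ι]
    rfl

theorem contract_zero (α : Lam V) : contract (0 : V) α = 0 := by
  simp [contract]

theorem pull_smul_id (c : ℝ) {n : ℕ} {x : Lam V} (hx : x ∈ ⋀[ℝ]^n (Module.Dual ℝ V)) :
    pull (c • (LinearMap.id : V →ₗ[ℝ] V)) x = c ^ n • x := by
  induction hx using Submodule.pow_induction_on_left' with
  | algebraMap r => simp
  | add x y i hx hy ihx ihy => rw [map_add, ihx, ihy, smul_add]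
  | mem_mul m hm i x hx ih =>
    obtain ⟨w, rfl⟩ := hm
    rw [map_mul, pull_ι, ih, LinearMap.comp_smul, LinearMap.comp_id, map_smul, smul_mul_smul_comm,
      pow_succ']

/-- The projection to the homogeneous part of degree `n`. -/
def projDeg (n : ℕ) : Lam V →ₗ[ℝ] Lam V :=
  GradedAlgebra.proj (fun i : ℕ ↦ ⋀[ℝ]^i (Module.Dual ℝ V)) n

theorem projDeg_mem (n : ℕ) (x : Lam V) : projDeg n x ∈ ⋀[ℝ]^n (Module.Dual ℝ V) :=
  SetLike.coe_mem (DirectSum.decompose (fun i : ℕ ↦ ⋀[ℝ]^i (Module.Dual ℝ V)) x n)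

theorem projDeg_of_mem {n : ℕ} {x : Lam V} (hx : x ∈ ⋀[ℝ]^n (Module.Dual ℝ V)) :
    projDeg n x = x :=
  DirectSum.decompose_of_mem_same (fun i : ℕ ↦ ⋀[ℝ]^i (Module.Dual ℝ V)) hx

theorem projDeg_of_mem_ne {m n : ℕ} {x : Lam V} (hx : x ∈ ⋀[ℝ]^m (Module.Dual ℝ V))
    (hmn : m ≠ n) : projDeg n x = 0 :=
  DirectSum.decompose_of_mem_ne (fun i : ℕ ↦ ⋀[ℝ]^i (Module.Dual ℝ V)) hx hmn

theorem pull_projDeg (L : V →ₗ[ℝ] V') (n : ℕ) (x : Lam V') :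
    pull L (projDeg n x) = projDeg n (pull L x) := by
  induction x using DirectSum.Decomposition.inductionOn
    (fun i : ℕ ↦ ⋀[ℝ]^i (Module.Dual ℝ V')) with
  | zero => simp
  | @homogeneous i m =>
    by_cases h : i = n
    · subst h
      rw [projDeg_of_mem m.2, projDeg_of_mem (pull_mem L m.2)]
    · rw [projDeg_of_mem_ne m.2 h, projDeg_of_mem_ne (pull_mem L m.2) h, map_zero]
  | add x y hx hy => simp only [map_add, hx, hy]

end LamAlgebra

section Cylinder

set_option linter.unusedSectionVars false

variable {E : Type*} [NormedAddCommGroup E] [NormedSpace ℝ E] [FiniteDimensional ℝ E]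

theorem vert_ι_mul (θ : Module.Dual ℝ (E × ℝ)) (β : Lam (E × ℝ)) :
    vert (ExteriorAlgebra.ι ℝ θ * β) = θ (0, 1) • β - ExteriorAlgebra.ι ℝ θ * vert β :=
  contract_ι_mul _ _ _

theorem vert_dt_mul (β : Lam (E × ℝ)) : vert (dt * β) = β - dt * vert β := by
  rw [dt, vert_ι_mul, LinearMap.snd_apply, one_smul]

theorem dt_mul_dt_mul (β : Lam (E × ℝ)) : dt * (dt * β) = 0 := by
  rw [← mul_assoc, dt, ExteriorAlgebra.ι_sq_zero, zero_mul]

theorem vert_vert (α : Lam (E × ℝ)) : vert (vert α) = 0 := contract_contract _ _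

theorem vert_pull_fst (b : Lam E) : vert (pull (LinearMap.fst ℝ E ℝ) b) = 0 := by
  rw [vert, contract_pull, LinearMap.fst_apply, contract_zero, map_zero]

theorem horiz_eq_pull (α : Lam (E × ℝ)) :
    horiz α = pull (LinearMap.inl ℝ E ℝ ∘ₗ LinearMap.fst ℝ E ℝ) α := by
  induction α using lam_induction with
  | algebraMap r => simp [horiz, vert]
  | add x y hx hy =>
    rw [map_add, ← hx, ← hy]
    simp only [horiz, map_add, mul_add]
    abel
  | ι_mul θ x hx =>
    have h : θ ∘ₗ LinearMap.inl ℝ E ℝ ∘ₗ LinearMap.fst ℝ E ℝ =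
        θ - θ (0, 1) • LinearMap.snd ℝ E ℝ := by
      ext
      · simp
      · simp only [LinearMap.coe_comp, LinearMap.coe_inr, Function.comp_apply, LinearMap.fst_apply,
          LinearMap.coe_inl, LinearMap.sub_apply, LinearMap.smul_apply, LinearMap.snd_apply,
          smul_eq_mul, mul_one, sub_self]
        exact map_zero θ
    have hanti : dt * (ExteriorAlgebra.ι ℝ θ * vert x) =
        -(ExteriorAlgebra.ι ℝ θ * (dt * vert x)) := by
      rw [← mul_assoc, ← mul_assoc, ← neg_mul, dt,
        eq_neg_of_add_eq_zero_left (ExteriorAlgebra.ι_add_mul_swap _ _)]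
    rw [map_mul, pull_ι, h, ← hx, horiz, horiz, vert_ι_mul, mul_sub, hanti, map_sub, map_smul,
      sub_mul, mul_sub, mul_sub, mul_smul_comm, smul_mul_assoc, smul_mul_assoc]
    change _ = _ - (_ - _ • (dt * (dt * vert x)))
    rw [dt_mul_dt_mul, smul_zero, sub_zero, dt]
    abel

theorem eq_pull_of_vert_eq_zero {α : Lam (E × ℝ)} (h : vert α = 0) :
    α = pull (LinearMap.fst ℝ E ℝ) (pull (LinearMap.inl ℝ E ℝ) α) := by
  rw [pull_pull, ← horiz_eq_pull, horiz, h, mul_zero, sub_zero]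

theorem pull_inl_pull_fst (b : Lam E) :
    pull (LinearMap.inl ℝ E ℝ) (pull (LinearMap.fst ℝ E ℝ) b) = b := by
  rw [pull_pull, LinearMap.fst_comp_inl, pull_id]

theorem pull_inl_dt_mul (β : Lam (E × ℝ)) : pull (LinearMap.inl ℝ E ℝ) (dt * β) = 0 := by
  rw [map_mul, dt, pull_ι, LinearMap.snd_comp_inl, map_zero, zero_mul]

theorem pull_inl_horiz (α : Lam (E × ℝ)) :
    pull (LinearMap.inl ℝ E ℝ) (horiz α) = pull (LinearMap.inl ℝ E ℝ) α := by
  rw [horiz, map_sub, pull_inl_dt_mul, sub_zero]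

end Cylinder

/-! ### Substitution and derivations of the algebra of functions -/

section FnAlgebra

set_option linter.unusedSectionVars false

variable {ι : Type*} {deg : ι → ℕ} [Fintype ι] {U : Opens (Base deg)}

theorem mkFn_mul_mkFn (f f' : SmoothFn deg U) (p p' : MvPolynomial (EvenIdx deg) ℝ)
    (w w' : ExteriorAlgebra ℝ (OddIdx deg → ℝ)) :
    mkFn f p w * mkFn f' p' w' = mkFn (f * f') (p * p') (w * w') := by
  have h : ((f ⊗ₜ[ℝ] p : SmoothFn deg U ⊗[ℝ] MvPolynomial (EvenIdx deg) ℝ) : EvenAlg deg U) *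
      ((f' ⊗ₜ[ℝ] p' : SmoothFn deg U ⊗[ℝ] MvPolynomial (EvenIdx deg) ℝ) : EvenAlg deg U) =
      (((f * f') ⊗ₜ[ℝ] (p * p') : SmoothFn deg U ⊗[ℝ] MvPolynomial (EvenIdx deg) ℝ) :
        EvenAlg deg U) := Algebra.TensorProduct.tmul_mul_tmul _ _ _ _
  exact (Algebra.TensorProduct.tmul_mul_tmul (R := ℝ) (A := EvenAlg deg U) _ _ _ _).trans
    (congrArg (fun x : EvenAlg deg U => x ⊗ₜ[ℝ] (w * w')) h)

theorem mkFn_add_left (f f' : SmoothFn deg U) (p : MvPolynomial (EvenIdx deg) ℝ)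
    (w : ExteriorAlgebra ℝ (OddIdx deg → ℝ)) : mkFn (f + f') p w = mkFn f p w + mkFn f' p w := by
  unfold mkFn
  rw [TensorProduct.add_tmul]
  exact TensorProduct.add_tmul _ _ _

theorem mkFn_add_mid (f : SmoothFn deg U) (p p' : MvPolynomial (EvenIdx deg) ℝ)
    (w : ExteriorAlgebra ℝ (OddIdx deg → ℝ)) : mkFn f (p + p') w = mkFn f p w + mkFn f p' w := by
  unfold mkFn
  rw [TensorProduct.tmul_add]
  exact TensorProduct.add_tmul _ _ _

theorem mkFn_add_right (f : SmoothFn deg U) (p : MvPolynomial (EvenIdx deg) ℝ)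
    (w w' : ExteriorAlgebra ℝ (OddIdx deg → ℝ)) :
    mkFn f p (w + w') = mkFn f p w + mkFn f p w' :=
  TensorProduct.tmul_add _ _ _

theorem mkFn_smul_right (f : SmoothFn deg U) (p : MvPolynomial (EvenIdx deg) ℝ)
    (c : ℝ) (w : ExteriorAlgebra ℝ (OddIdx deg → ℝ)) :
    mkFn f p (c • w) = c • mkFn f p w :=
  TensorProduct.tmul_smul _ _ _

theorem mkFn_smul_mid (f : SmoothFn deg U) (p : MvPolynomial (EvenIdx deg) ℝ)
    (c : ℝ) (w : ExteriorAlgebra ℝ (OddIdx deg → ℝ)) :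
    mkFn f (c • p) w = c • mkFn f p w := by
  unfold mkFn
  rw [TensorProduct.tmul_smul]
  exact TensorProduct.smul_tmul' c _ _

theorem mkFn_smul_left (f : SmoothFn deg U) (p : MvPolynomial (EvenIdx deg) ℝ)
    (c : ℝ) (w : ExteriorAlgebra ℝ (OddIdx deg → ℝ)) :
    mkFn (c • f) p w = c • mkFn f p w := by
  unfold mkFn
  rw [← TensorProduct.smul_tmul']
  exact TensorProduct.smul_tmul' c _ _

theorem fnAlg_induction {P : FnAlg deg U → Prop} (add : ∀ x y, P x → P y → P (x + y))
    (mk : ∀ f p w, P (mkFn f p w)) (F : FnAlg deg U) : P F := by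
  have h0 : P 0 := by
    have h := mk 0 0 0
    have e : (mkFn 0 0 0 : FnAlg deg U) = 0 := TensorProduct.tmul_zero _ _
    rwa [e] at h
  induction F using TensorProduct.induction_on with
  | zero => exact h0
  | add x y hx hy => exact add x y hx hy
  | tmul x w =>
    induction x using TensorProduct.induction_on with
    | zero =>
      have e : ((0 : EvenAlg deg U) ⊗ₜ[ℝ] w : FnAlg deg U) = 0 := TensorProduct.zero_tmul _ _
      exact e ▸ h0
    | add x y hx hy =>
      have e : ((x + y : EvenAlg deg U) ⊗ₜ[ℝ] w : FnAlg deg U) =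
        ((x ⊗ₜ[ℝ] w : FnAlg deg U) + (y ⊗ₜ[ℝ] w : FnAlg deg U)) := TensorProduct.add_tmul _ _ _
      exact e ▸ add _ _ hx hy
    | tmul f p => exact mk f p w

variable [DecidableEq ι]

theorem gen_of_deg_eq_zero {i : ι} (h : deg i = 0) : gen U i = ofFn (coordFn U ⟨i, h⟩) := by
  rw [gen, dif_pos h]

theorem gen_of_even {i : ι} (h : deg i ≠ 0) (he : Even (deg i)) :
    gen U i = mkFn 1 (MvPolynomial.X ⟨i, h, he⟩) 1 := by
  rw [gen, dif_neg h, dif_pos he]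

theorem gen_of_odd {i : ι} (ho : Odd (deg i)) :
    gen U i = mkFn 1 1 (ExteriorAlgebra.ι ℝ (Pi.single ⟨i, ho⟩ 1)) := by
  have h : deg i ≠ 0 := fun h => by simp [h] at ho
  rw [gen, dif_neg h, dif_neg (Nat.not_even_iff_odd.mpr ho)]

/-- The algebra is generated by the functions and the generators of positive degree. -/
theorem fnAlg_gen_induction {P : FnAlg deg U → Prop} (add : ∀ x y, P x → P y → P (x + y))
    (smul : ∀ (c : ℝ) x, P x → P (c • x)) (ofFn : ∀ f, P (ofFn f))
    (gen_mul : ∀ j, deg j ≠ 0 → ∀ F, P F → P (gen U j * F)) (F : FnAlg deg U) : P F := by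
  refine fnAlg_induction add (fun f p w => ?_) F
  have h0 : P 0 := by
    have h := smul 0 _ (ofFn 0)
    rwa [zero_smul] at h
  induction w using lam_induction with
  | algebraMap r =>
    rw [Algebra.algebraMap_eq_smul_one, mkFn_smul_right]
    refine smul _ _ ?_
    induction p using MvPolynomial.induction_on with
    | C a =>
      rw [← MvPolynomial.algebraMap_eq, Algebra.algebraMap_eq_smul_one, mkFn_smul_mid]
      exact smul _ _ (ofFn f)
    | add p q hp hq => rw [mkFn_add_mid]; exact add _ _ hp hq
    | mul_X p j hp =>
      have e : mkFn f (p * MvPolynomial.X j) 1 = gen U j.1 * mkFn f p 1 := by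
        rw [gen_of_even j.2.1 j.2.2, mkFn_mul_mkFn, one_mul, one_mul, mul_comm]
      rw [e]
      exact gen_mul _ j.2.1 _ hp
  | add x y hx hy => rw [mkFn_add_right]; exact add _ _ hx hy
  | ι_mul θ x hx =>
    have hθ : θ = ∑ j, θ j • Pi.single j (1 : ℝ) := by
      simp only [← Pi.single_smul, smul_eq_mul, mul_one, Finset.univ_sum_single]
    have e : mkFn f p (ExteriorAlgebra.ι ℝ θ * x) =
        ∑ j : OddIdx deg, θ j • (gen U j.1 * mkFn f p x) := by
      conv_lhs => rw [hθ]
      rw [map_sum, Finset.sum_mul]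
      have hs : ∀ s : Finset (OddIdx deg), mkFn f p
          (∑ j ∈ s, ExteriorAlgebra.ι ℝ (θ j • Pi.single j (1 : ℝ)) * x) =
          ∑ j ∈ s, θ j • (gen U j.1 * mkFn f p x) := by
        intro s
        induction s using Finset.induction_on with
        | empty =>
          rw [Finset.sum_empty, Finset.sum_empty]
          exact TensorProduct.tmul_zero _ _
        | insert a s ha ih =>
          rw [Finset.sum_insert ha, Finset.sum_insert ha, mkFn_add_right, ih, map_smul,
            smul_mul_assoc, mkFn_smul_right, gen_of_odd a.2, mkFn_mul_mkFn, one_mul, one_mul]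
      exact hs _
    rw [e]
    have hs : ∀ s : Finset (OddIdx deg), P (∑ j ∈ s, θ j • (gen U j.1 * mkFn f p x)) := by
      intro s
      induction s using Finset.induction_on with
      | empty => simpa using h0
      | insert a s ha ih =>
        rw [Finset.sum_insert ha]
        exact add _ _ (smul _ _ (gen_mul _ (fun h => by simpa [h] using a.2) _ hx)) ih
    exact hs _

theorem mapFn_mkFn (L₀ : SmoothFn deg U →ₗ[ℝ] SmoothFn deg U)
    (L₁ : MvPolynomial (EvenIdx deg) ℝ →ₗ[ℝ] MvPolynomial (EvenIdx deg) ℝ)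
    (L₂ : ExteriorAlgebra ℝ (OddIdx deg → ℝ) →ₗ[ℝ] ExteriorAlgebra ℝ (OddIdx deg → ℝ))
    (f : SmoothFn deg U) (p : MvPolynomial (EvenIdx deg) ℝ)
    (w : ExteriorAlgebra ℝ (OddIdx deg → ℝ)) :
    mapFn L₀ L₁ L₂ (mkFn f p w) = mkFn (L₀ f) (L₁ p) (L₂ w) := rfl

theorem partialGen_of_zero {i : ι} (h : deg i = 0) :
    partialGen (U := U) i = mapFn (partialFn ⟨i, h⟩) LinearMap.id LinearMap.id := by
  rw [partialGen, dif_pos h]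

theorem partialGen_of_even {i : ι} (h : deg i ≠ 0) (he : Even (deg i)) :
    partialGen (U := U) i =
      mapFn LinearMap.id (MvPolynomial.pderiv ⟨i, h, he⟩).toLinearMap LinearMap.id := by
  rw [partialGen, dif_neg h, dif_pos he]

theorem partialGen_of_odd {i : ι} (ho : Odd (deg i)) :
    partialGen (U := U) i = mapFn LinearMap.id LinearMap.id
      (CliffordAlgebra.contractLeft (LinearMap.proj ⟨i, ho⟩)) := by
  have h : deg i ≠ 0 := fun h => by simp [h] at ho
  rw [partialGen, dif_neg h, dif_neg (Nat.not_even_iff_odd.mpr ho)]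

theorem mkFn_zero_mid (f : SmoothFn deg U) (w : ExteriorAlgebra ℝ (OddIdx deg → ℝ)) :
    mkFn f 0 w = 0 := by
  have h := mkFn_smul_mid f 0 0 w
  rwa [zero_smul, zero_smul] at h

theorem mkFn_zero_right (f : SmoothFn deg U) (p : MvPolynomial (EvenIdx deg) ℝ) :
    mkFn f p 0 = 0 := TensorProduct.tmul_zero _ _

theorem partialGen_ofFn {i : ι} (h : deg i ≠ 0) (f : SmoothFn deg U) :
    partialGen i (ofFn f) = 0 := by
  by_cases he : Even (deg i)
  · rw [partialGen_of_even h he, ofFn, mapFn_mkFn]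
    simp [mkFn_zero_mid]
  · have ho := Nat.not_even_iff_odd.mp he
    rw [partialGen_of_odd ho, ofFn, mapFn_mkFn, CliffordAlgebra.contractLeft_one, mkFn_zero_right]

theorem partialGen_ofFn_zero {i : ι} (h : deg i = 0) (f : SmoothFn deg U) :
    partialGen i (ofFn f) = ofFn (partialFn ⟨i, h⟩ f) := by
  rw [partialGen_of_zero h]
  rfl

/-- The Leibniz rule for a product with a generator. -/
theorem partialGen_gen_mul (i j : ι) (hj : deg j ≠ 0) (F : FnAlg deg U) :
    partialGen i (gen U j * F) = (if i = j then F else 0) +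
      (-1 : ℝ) ^ (deg i * deg j) • (gen U j * partialGen i F) := by
  refine fnAlg_induction (P := fun F => partialGen i (gen U j * F) = (if i = j then F else 0) +
      (-1 : ℝ) ^ (deg i * deg j) • (gen U j * partialGen i F)) ?_ (fun f p w => ?_) F
  · intro x y hx hy
    rw [mul_add, map_add, hx, hy, map_add, mul_add, smul_add]
    split_ifs <;> abel
  by_cases hje : Even (deg j)
  · rw [(hje.mul_left (deg i)).neg_one_pow, one_smul, gen_of_even hj hje, mkFn_mul_mkFn, one_mul,
      one_mul]
    by_cases hi : deg i = 0
    · have hij : i ≠ j := fun h => hj (h ▸ hi)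
      rw [partialGen_of_zero hi, mapFn_mkFn, mapFn_mkFn, mkFn_mul_mkFn, if_neg hij, zero_add,
        one_mul, LinearMap.id_apply, LinearMap.id_apply, one_mul, LinearMap.id_apply]
    by_cases hie : Even (deg i)
    · rw [partialGen_of_even hi hie, mapFn_mkFn, mapFn_mkFn, mkFn_mul_mkFn]
      simp only [LinearMap.id_apply, one_mul, Derivation.coeFn_coe, Derivation.leibniz, smul_eq_mul]
      rw [add_comm, mkFn_add_mid]
      congr 1
      by_cases hij : i = j
      · subst hij
        rw [if_pos rfl, MvPolynomial.pderiv_X_self, mul_one]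
      · rw [if_neg hij, MvPolynomial.pderiv_X_of_ne (fun h => hij (congrArg Subtype.val h).symm),
          mul_zero, mkFn_zero_mid]
    · have hio := Nat.not_even_iff_odd.mp hie
      have hij : i ≠ j := fun h => hie (h ▸ hje)
      rw [partialGen_of_odd hio, mapFn_mkFn, mapFn_mkFn, mkFn_mul_mkFn, if_neg hij, zero_add]
      simp only [LinearMap.id_apply, one_mul]
  · have hjo := Nat.not_even_iff_odd.mp hje
    rw [gen_of_odd hjo, mkFn_mul_mkFn, one_mul, one_mul]
    by_cases hie : Even (deg i)
    · have hij : i ≠ j := fun h => hje (h ▸ hie)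
      rw [(hie.mul_right (deg j)).neg_one_pow, one_smul, if_neg hij, zero_add]
      by_cases hi : deg i = 0
      · rw [partialGen_of_zero hi, mapFn_mkFn, mapFn_mkFn, mkFn_mul_mkFn]
        simp only [LinearMap.id_apply, one_mul]
      · rw [partialGen_of_even hi hie, mapFn_mkFn, mapFn_mkFn, mkFn_mul_mkFn]
        simp only [LinearMap.id_apply, one_mul]
    · have hio := Nat.not_even_iff_odd.mp hie
      rw [(hio.mul hjo).neg_one_pow, neg_one_smul, partialGen_of_odd hio, mapFn_mkFn, mapFn_mkFn,
        mkFn_mul_mkFn]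
      simp only [LinearMap.id_apply, one_mul]
      have hc : ∀ (d : Module.Dual ℝ (OddIdx deg → ℝ)) (a : OddIdx deg → ℝ)
          (w : ExteriorAlgebra ℝ (OddIdx deg → ℝ)),
          CliffordAlgebra.contractLeft d (ExteriorAlgebra.ι ℝ a * w) =
          d a • w + (-1 : ℝ) • (ExteriorAlgebra.ι ℝ a * CliffordAlgebra.contractLeft d w) := by
        intro d a w
        rw [neg_one_smul, ← sub_eq_add_neg]
        exact CliffordAlgebra.contractLeft_ι_mul (Q := (0 : QuadraticForm ℝ (OddIdx deg → ℝ))) _ _ _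
      rw [hc, mkFn_add_right, mkFn_smul_right, mkFn_smul_right, neg_one_smul]
      congr 1
      by_cases hij : i = j
      · subst hij
        simp
      · have : (⟨i, hio⟩ : OddIdx deg) ≠ ⟨j, hjo⟩ := fun h => hij (congrArg Subtype.val h)
        simp [hij, this]

section Subst

variable {V V' : Type*} [AddCommGroup V] [Module ℝ V] [AddCommGroup V'] [Module ℝ V']
  (a : FiberPt deg U V)

theorem subst_mkFn (f : SmoothFn deg U) (p : MvPolynomial (EvenIdx deg) ℝ)
    (w : ExteriorAlgebra ℝ (OddIdx deg → ℝ)) :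
    a.subst (mkFn f p w) = algebraMap ℝ (Lam V) (f.1 ⟨baseValue a.comp, a.mem⟩) *
      (a.substEven p : Lam V) * a.substOdd w := rfl

@[simp] theorem subst_ofFn (f : SmoothFn deg U) :
    a.subst (ofFn f) = algebraMap ℝ (Lam V) (f.1 ⟨baseValue a.comp, a.mem⟩) := by
  rw [ofFn, subst_mkFn, map_one, map_one, mul_one, OneMemClass.coe_one, mul_one]

@[simp] theorem subst_gen (i : ι) : a.subst (gen U i) = a.comp i := by
  by_cases h : deg i = 0
  · rw [gen_of_deg_eq_zero h, subst_ofFn]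
    have h1 := a.homog i
    rw [h] at h1
    exact (eq_algebraMap_scalar h1).symm
  by_cases he : Even (deg i)
  · rw [gen_of_even h he, subst_mkFn]
    have : (1 : SmoothFn deg U).1 ⟨baseValue a.comp, a.mem⟩ = 1 := rfl
    rw [this, map_one, map_one, mul_one, one_mul, FiberPt.substEven, MvPolynomial.aeval_X]
  · rw [gen_of_odd (Nat.not_even_iff_odd.mp he), subst_mkFn]
    have : (1 : SmoothFn deg U).1 ⟨baseValue a.comp, a.mem⟩ = 1 := rfl
    rw [this, map_one, map_one, OneMemClass.coe_one, mul_one, one_mul, FiberPt.substOdd,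
      ExteriorAlgebra.lift_ι_apply]
    simp [Pi.single_apply]

theorem subst_mem_of_degPart {k : ℕ} {F : FnAlg deg U} (hF : F ∈ degPart deg U k) :
    a.subst F ∈ ⋀[ℝ]^k (Module.Dual ℝ V) := by
  refine Submodule.span_induction (p := fun F _ => a.subst F ∈ ⋀[ℝ]^k (Module.Dual ℝ V))
    ?_ (by simp) (fun x y _ _ hx hy => by rw [map_add]; exact add_mem hx hy)
    (fun c x _ hx => by rw [map_smul]; exact Submodule.smul_mem _ _ hx) hF
  rintro x ⟨f, l, rfl, rfl⟩
  rw [map_mul, subst_ofFn, ← Algebra.smul_def]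
  refine Submodule.smul_mem _ _ ?_
  clear hF
  induction l with
  | nil => simp
  | cons i l ih =>
    simp only [List.map_cons, List.prod_cons, map_mul, subst_gen, List.sum_cons]
    exact mul_mem_lam (a.homog i) ih

/-- The pullback of a point along a linear map. -/
def FiberPt.pull (L : V →ₗ[ℝ] V') (a : FiberPt deg U V') : FiberPt deg U V where
  comp i := HtopyMC.pull L (a.comp i)
  homog i := pull_mem L (a.homog i)
  mem := by
    have : baseValue (deg := deg) (fun i => HtopyMC.pull L (a.comp i)) = baseValue a.comp :=
      funext fun i => scalar_pull L _
    rw [this]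
    exact a.mem

theorem pull_subst (L : V →ₗ[ℝ] V') (a : FiberPt deg U V') (F : FnAlg deg U) :
    HtopyMC.pull L (a.subst F) = (a.pull L).subst F := by
  refine fnAlg_gen_induction (P := fun F => HtopyMC.pull L (a.subst F) = (a.pull L).subst F)
    (fun x y hx hy => by rw [map_add, map_add, map_add, hx, hy])
    (fun c x hx => by rw [map_smul, map_smul, map_smul, hx]) (fun f => ?_) (fun j _ F hF => ?_) F
  · rw [subst_ofFn, subst_ofFn, AlgHom.commutes]
    exact congrArg (algebraMap ℝ (Lam V)) (congrArg f.1
      (Subtype.ext (funext fun i => (scalar_pull L _).symm)))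
  · rw [map_mul, map_mul, map_mul, hF, subst_gen, subst_gen]
    rfl

/-- A derivation along `F ↦ F(a)` is determined by its values on the generators. -/
theorem eq_sum_partialGen (δ : FnAlg deg U →ₗ[ℝ] Lam V) (e : ℕ) (n : ι → ℕ)
    (hn : ∀ i, Even (n i + (deg i + e))) (hδ : ∀ i, δ (gen U i) ∈ ⋀[ℝ]^(n i) (Module.Dual ℝ V))
    (hfn : ∀ f : SmoothFn deg U, δ (ofFn f) = ∑ i : {i : ι // deg i = 0},
      δ (gen U i.1) * algebraMap ℝ _ ((partialFn i f).1 ⟨baseValue a.comp, a.mem⟩))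
    (hleib : ∀ j, deg j ≠ 0 → ∀ F, δ (gen U j * F) = δ (gen U j) * a.subst F +
      (-1 : ℝ) ^ (e * deg j) • (a.comp j * δ F)) (F : FnAlg deg U) :
    δ F = ∑ i, δ (gen U i) * a.subst (partialGen i F) := by
  refine fnAlg_gen_induction (P := fun F => δ F = ∑ i, δ (gen U i) * a.subst (partialGen i F))
    (fun x y hx hy => ?_) (fun c x hx => ?_) (fun f => ?_) (fun j hj F hF => ?_) F
  · simp only [map_add, hx, hy, mul_add, Finset.sum_add_distrib]
  · simp only [map_smul, hx, mul_smul_comm, Finset.smul_sum]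
  · rw [hfn]
    have h1 : ∀ i ∈ (Finset.univ : Finset ι), δ (gen U i) * a.subst (partialGen i (ofFn f)) ≠ 0 →
        deg i = 0 := fun i _ hi => by
      by_contra h
      rw [partialGen_ofFn h, map_zero, mul_zero] at hi
      exact hi rfl
    rw [← Finset.sum_filter_of_ne h1,
      Finset.sum_subtype (Finset.univ.filter fun i => deg i = 0) (p := fun i => deg i = 0) (by simp)]
    refine Finset.sum_congr rfl fun i _ => ?_
    rw [partialGen_ofFn_zero i.2, subst_ofFn]
  · rw [hleib j hj, hF]
    simp only [partialGen_gen_mul _ j hj, map_add, mul_add, Finset.sum_add_distrib, map_smul,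
      map_mul, subst_gen, Finset.mul_sum, Finset.smul_sum]
    congr 1
    · rw [Finset.sum_eq_single j]
      · simp
      · intro b _ hb
        simp [hb]
      · simp
    · refine Finset.sum_congr rfl fun i _ => ?_
      rw [← mul_assoc, mul_comm_of_mem _ _ _ _ (a.homog j) (hδ i), mul_smul_comm, smul_mul_assoc,
        smul_smul, ← pow_add, mul_assoc]
      congr 1
      have h1 := hn i
      rw [neg_one_pow_congr]
      rw [← Nat.even_add]
      have h2 : e * deg j + deg j * n i + deg i * deg j = deg j * (n i + (deg i + e)) := by ring
      rw [h2]
      exact h1.mul_left _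

end Subst

end FnAlgebra

section Derivations

set_option linter.unusedSectionVars false

variable {ι : Type*} {deg : ι → ℕ} [Fintype ι] {U : Opens (Base deg)}

/-- A smooth function on `U` given by a function on `W⁰`. -/
def smoothFnOf (U : Opens (Base deg)) (g : Base deg → ℝ) (hg : ContDiffOn ℝ ∞ g U) :
    SmoothFn deg U :=
  ⟨fun x => g x.1, fun x => (contMDiffAt_subtype_iff (I := 𝓘(ℝ, Base deg)) (f := g)).mpr
    (contMDiffAt_iff_contDiffAt.mpr (hg.contDiffAt (U.isOpen.mem_nhds x.2)))⟩

theorem contDiffOn_extend (f : SmoothFn deg U) :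
    ContDiffOn ℝ ∞ (Function.extend Subtype.val f.1 0) U :=
  fun x hx => (smoothAt_extend f ⟨x, hx⟩).contDiffWithinAt

theorem extend_apply (f : SmoothFn deg U) (x : U) :
    Function.extend Subtype.val f.1 0 x.1 = f.1 x :=
  Subtype.val_injective.extend_apply _ _ _

/-- Hadamard's lemma. -/
theorem exists_hadamard {B : Type*} [NormedAddCommGroup B] [NormedSpace ℝ B]
    {f : B → ℝ} {x₀ : B} {r : ℝ} (hr : 0 < r) (hf : ContDiffOn ℝ ∞ f (Metric.ball x₀ r)) :
    ∃ g : B → B →L[ℝ] ℝ, ContDiffOn ℝ ∞ g (Metric.ball x₀ r) ∧ g x₀ = fderiv ℝ f x₀ ∧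
      ∀ x ∈ Metric.ball x₀ r, f x - f x₀ = g x (x - x₀) := by
  have hopen : IsOpen (Metric.ball x₀ r) := Metric.isOpen_ball
  have hmem : ∀ x ∈ Metric.ball x₀ r, ∀ t ∈ Icc (0 : ℝ) 1, x₀ + t • (x - x₀) ∈ Metric.ball x₀ r :=
    fun x hx t ht => (convex_ball x₀ r).add_smul_sub_mem (Metric.mem_ball_self hr) hx ht
  have hdf : ContDiffOn ℝ ∞ (fderiv ℝ f) (Metric.ball x₀ r) :=
    hf.fderiv_of_isOpen hopen (by simp)
  have hpath : ContDiff ℝ ∞ (fun z : B × ℝ => x₀ + z.2 • (z.1 - x₀)) := by fun_prop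
  have hh : ContDiffOn ℝ ∞ (fun z : B × ℝ => fderiv ℝ f (x₀ + z.2 • (z.1 - x₀)))
      (Metric.ball x₀ r ×ˢ Icc 0 1) :=
    hdf.comp hpath.contDiffOn fun z hz => hmem z.1 hz.1 z.2 hz.2
  have hex : ∀ x ∈ Metric.ball x₀ r, ∃ v : ℝ → B →L[ℝ] ℝ, v 0 = 0 ∧ ∀ t ∈ Icc (0 : ℝ) 1,
      HasDerivWithinAt v (fderiv ℝ f (x₀ + t • (x - x₀))) (Icc 0 1) t := fun x hx => by
    obtain ⟨v, hv0, hv⟩ := exists_linear_ODE_solution zero_le_one (fun _ => 0)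
      (fun t : ℝ => fderiv ℝ f (x₀ + t • (x - x₀))) continuousOn_const
      (hh.continuousOn.comp (continuousOn_const.prodMk continuousOn_id) fun t ht => ⟨hx, ht⟩)
      (0 : B →L[ℝ] ℝ)
    exact ⟨v, hv0, fun t ht => by simpa using hv t ht⟩
  choose! v hv0 hv using hex
  have hconst : ∀ c : ℝ → ℝ, (∀ t ∈ Icc (0 : ℝ) 1, HasDerivWithinAt c 0 (Icc 0 1) t) →
      c 1 = c 0 := fun c hc =>
    constant_of_has_deriv_right_zero (fun t ht => (hc t ht).continuousWithinAt)
      (fun t ht => hasDerivWithinAt_Ici_of_Icc ht (hc t (Ico_subset_Icc_self ht))) 1 (by simp)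
  have hsm : ContDiffOn ℝ ∞ (fun z : B × ℝ => v z.1 z.2) (Metric.ball x₀ r ×ˢ Icc 0 1) := by
    refine contDiffOn_solution one_pos hopen.uniqueDiffOn
      (fun y hy => ⟨1, one_pos, (convex_ball x₀ r).inter (convex_ball y 1)⟩) isOpen_univ
      (F := fun z => fderiv ℝ f (x₀ + z.2.1 • (z.1 - x₀))) ?_ (fun _ _ _ _ => mem_univ _) hv ?_
    · exact hh.comp (t := Metric.ball x₀ r ×ˢ Icc 0 1)
        (g := fun z : B × ℝ => fderiv ℝ f (x₀ + z.2 • (z.1 - x₀)))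
        (f := fun z : B × ℝ × (B →L[ℝ] ℝ) => (z.1, z.2.1))
        (by fun_prop) fun z hz => ⟨hz.1, hz.2.1⟩
    · exact contDiffOn_const.congr hv0
  refine ⟨fun x => v x 1, ?_, ?_, fun x hx => ?_⟩
  · exact hsm.comp (f := fun x : B => (x, (1 : ℝ))) (by fun_prop) fun x hx => ⟨hx, by simp⟩
  · have hx₀ := Metric.mem_ball_self hr (x := x₀)
    ext w
    have h := hconst (fun t => v x₀ t w - t * fderiv ℝ f x₀ w) fun t ht => by
      have h1 := (ContinuousLinearMap.apply ℝ ℝ w).hasFDerivAt.comp_hasDerivWithinAt t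
        (hv x₀ hx₀ t ht)
      have h2 := h1.sub ((hasDerivWithinAt_id t (Icc 0 1)).mul_const (fderiv ℝ f x₀ w))
      exact h2.congr_deriv (by simp)
    simp only [hv0 _ hx₀, one_mul, zero_mul, zero_apply, sub_zero] at h
    linarith
  · have h := hconst (fun t => v x t (x - x₀) - f (x₀ + t • (x - x₀))) fun t ht => by
      have h1 := (ContinuousLinearMap.apply ℝ ℝ (x - x₀)).hasFDerivAt.comp_hasDerivWithinAt t
        (hv x hx t ht)
      have h3 : HasFDerivAt f (fderiv ℝ f (x₀ + t • (x - x₀))) (x₀ + t • (x - x₀)) :=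
        ((hf.contDiffAt (hopen.mem_nhds (hmem x hx t ht))).differentiableAt (by simp)).hasFDerivAt
      have h4 : HasDerivAt (fun t : ℝ => x₀ + t • (x - x₀)) (x - x₀) t := by
        simpa using ((hasDerivAt_id t).smul_const (x - x₀)).const_add x₀
      have h2 := h1.sub (h3.comp_hasDerivAt t h4).hasDerivWithinAt
      exact h2.congr_deriv (by simp)
    simp only [hv0 _ hx, one_smul, zero_smul, zero_apply, add_zero, add_sub_cancel] at h
    linarith

/-- A point derivation of `C^∞(U)` is a combination of partial derivatives. -/
theorem pointDerivation_eq_sum [DecidableEq ι] {M : Type*} [AddCommGroup M] [Module ℝ M]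
    (D : SmoothFn deg U →ₗ[ℝ] M)
    (u : U) (hD : ∀ f g : SmoothFn deg U, D (f * g) = g.1 u • D f + f.1 u • D g)
    (f : SmoothFn deg U) :
    D f = ∑ i, (partialFn i f).1 u • D (coordFn U i) := by
  have hD1 : D 1 = 0 := by
    have h := hD 1 1
    rw [mul_one] at h
    change D 1 = (1 : ℝ) • D 1 + (1 : ℝ) • D 1 at h
    rw [one_smul] at h
    exact left_eq_add.mp h
  have hDc : ∀ c : ℝ, D (algebraMap ℝ _ c) = 0 := fun c => by
    rw [Algebra.algebraMap_eq_smul_one, map_smul, hD1, smul_zero]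
  obtain ⟨r, hr, hrU⟩ := Metric.isOpen_iff.mp U.isOpen u.1 u.2
  obtain ⟨g, hg, hg0, hgf⟩ := exists_hadamard hr ((contDiffOn_extend f).mono hrU)
  let χ : ContDiffBump u.1 := ⟨r / 4, r / 2, by positivity, by linarith⟩
  have hχ : ContDiff ℝ ∞ χ := χ.contDiff
  have hχu : χ u.1 = 1 := χ.one_of_mem_closedBall (Metric.mem_closedBall_self (by positivity))
  have hχ0 : ∀ x, x ∉ Metric.ball u.1 r → χ x = 0 := fun x hx =>
    χ.zero_of_le_dist (by
      rw [Metric.mem_ball, not_lt] at hx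
      change r / 2 ≤ _
      linarith)
  let χU : SmoothFn deg U := smoothFnOf U χ hχ.contDiffOn
  let G : {i : ι // deg i = 0} → SmoothFn deg U := fun i =>
    smoothFnOf U (fun x => χ x * g x (Pi.single i 1)) (by
      intro x hx
      by_cases hxr : x ∈ Metric.ball u.1 r
      · exact (hχ.contDiffAt.mul ((hg.contDiffAt (Metric.isOpen_ball.mem_nhds hxr)).clm_apply
          contDiffAt_const)).contDiffWithinAt
      · have hopen : IsOpen (Metric.closedBall u.1 (r / 2))ᶜ := Metric.isClosed_closedBall.isOpen_compl
        have hxo : x ∈ (Metric.closedBall u.1 (r / 2))ᶜ := fun h => hxr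
          (Metric.closedBall_subset_ball (by linarith) h)
        refine (contDiffAt_const (c := (0 : ℝ)).congr_of_eventuallyEq ?_).contDiffWithinAt
        filter_upwards [hopen.mem_nhds hxo] with y hy
        rw [mem_compl_iff, Metric.mem_closedBall, not_le] at hy
        have : χ y = 0 := χ.zero_of_le_dist hy.le
        rw [this, zero_mul])
  have hdecomp : f = algebraMap ℝ _ (f.1 u) + (1 - χU) * (f - algebraMap ℝ _ (f.1 u)) +
      ∑ i, (coordFn U i - algebraMap ℝ _ (u.1 i)) * G i := by
    ext x
    have hsum : (∑ i, (coordFn U i - algebraMap ℝ _ (u.1 i)) * G i : SmoothFn deg U).1 x =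
        ∑ i, (x.1 i - u.1 i) * (χ x.1 * g x.1 (Pi.single i 1)) := by
      have := map_sum ((Pi.evalRingHom (fun _ : U => ℝ) x).comp (smoothFn deg U).val.toRingHom)
        (fun i => (coordFn U i - algebraMap ℝ _ (u.1 i)) * G i) Finset.univ
      exact this
    change f.1 x = f.1 u + (1 - χ x.1) * (f.1 x - f.1 u) + _
    rw [hsum]
    have h2 : ∑ i, (x.1 i - u.1 i) * (χ x.1 * g x.1 (Pi.single i 1)) =
        χ x.1 * g x.1 (x.1 - u.1) := by
      conv_rhs => rw [← Finset.univ_sum_single (x.1 - u.1), map_sum, Finset.mul_sum]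
      refine Finset.sum_congr rfl fun i _ => ?_
      have h3 : Pi.single i ((x.1 - u.1) i) = (x.1 i - u.1 i) • Pi.single (M := fun _ => ℝ) i (1 : ℝ) := by
        rw [← Pi.single_smul, smul_eq_mul, mul_one]
        rfl
      rw [h3, map_smul, smul_eq_mul]
      ring
    rw [h2]
    by_cases hx : x.1 ∈ Metric.ball u.1 r
    · rw [← hgf x.1 hx, extend_apply, extend_apply]
      ring
    · rw [hχ0 _ hx]
      ring
  have e1 : D ((1 - χU) * (f - algebraMap ℝ _ (f.1 u))) = 0 := by
    rw [hD]
    change (f.1 u - f.1 u) • _ + (1 - χ u.1) • _ = _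
    rw [hχu, sub_self, sub_self, zero_smul, zero_smul, add_zero]
  have e2 : ∀ i, D ((coordFn U i - algebraMap ℝ _ (u.1 i)) * G i) =
      (partialFn i f).1 u • D (coordFn U i) := fun i => by
    rw [hD]
    change (χ u.1 * g u.1 (Pi.single i 1)) • _ + (u.1 i - u.1 i) • _ = _
    rw [hχu, hg0, sub_self, zero_smul, add_zero, one_mul, map_sub, hDc, sub_zero]
    rfl
  conv_lhs => rw [hdecomp]
  rw [map_add, map_add, hDc, e1, map_sum, zero_add, zero_add]
  exact Finset.sum_congr rfl fun i _ => e2 i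

variable [DecidableEq ι]

theorem ofFn_one : (ofFn 1 : FnAlg deg U) = 1 := rfl

theorem ofFn_mul (f g : SmoothFn deg U) : (ofFn (f * g) : FnAlg deg U) = ofFn f * ofFn g := by
  rw [ofFn, ofFn, ofFn, mkFn_mul_mkFn, mul_one, mul_one]

theorem ofFn_mem_degPart (f : SmoothFn deg U) : ofFn f ∈ degPart deg U 0 :=
  Submodule.subset_span ⟨f, [], rfl, by simp⟩

theorem gen_mem_degPart (i : ι) : gen U i ∈ degPart deg U (deg i) :=
  Submodule.subset_span ⟨1, [i], by simp, by simp [ofFn_one]⟩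

variable {V : Type*} [AddCommGroup V] [Module ℝ V] (a : FiberPt deg U V)

theorem contract_subst (v : V) (F : FnAlg deg U) :
    contract v (a.subst F) = ∑ i, contract v (a.comp i) * a.subst (partialGen i F) := by
  have h := eq_sum_partialGen a ((contract v).comp a.subst.toLinearMap) 1
    (fun i => if deg i = 0 then 1 else deg i - 1) ?_ ?_ ?_ ?_ F
  · simpa using h
  · intro i
    by_cases h : deg i = 0
    · simp [h]
    · rw [if_neg h]
      have : deg i - 1 + (deg i + 1) = 2 * deg i := by omega
      rw [this]
      exact even_two_mul _
  · intro i
    have hi := a.homog i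
    simp only [LinearMap.coe_comp, Function.comp_apply, AlgHom.toLinearMap_apply, subst_gen]
    by_cases h : deg i = 0
    · rw [h] at hi
      rw [contract_of_mem_zero v hi]
      exact zero_mem _
    · rw [if_neg h]
      exact (contract_mem_aux v hi).1
  · intro f
    simp only [LinearMap.coe_comp, Function.comp_apply, AlgHom.toLinearMap_apply, subst_gen,
      subst_ofFn, contract_algebraMap]
    refine (Finset.sum_eq_zero fun i _ => ?_).symm
    have hi := a.homog i.1
    rw [i.2] at hi
    rw [contract_of_mem_zero v hi, zero_mul]
  · intro j _ F
    simp only [LinearMap.coe_comp, Function.comp_apply, AlgHom.toLinearMap_apply, subst_gen,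
      map_mul, one_mul]
    exact contract_mul v (a.homog j) _

theorem subst_Q (Q : Differential deg U) (F : FnAlg deg U) :
    a.subst (Q.toLin F) = ∑ i, a.subst (Q.F i) * a.subst (partialGen i F) := by
  have h := eq_sum_partialGen a (a.subst.toLinearMap.comp Q.toLin) 1
    (fun i => deg i + 1) ?_ ?_ ?_ ?_ F
  · exact h
  · exact fun i => ⟨_, rfl⟩
  · exact fun i => subst_mem_of_degPart a (Q.degree _ _ (gen_mem_degPart i))
  · intro f
    let toFnAlg : SmoothFn deg U →ₗ[ℝ] FnAlg deg U :=
      { toFun := ofFn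
        map_add' := fun f g => mkFn_add_left f g 1 1
        map_smul' := fun c f => mkFn_smul_left f 1 c 1 }
    rw [show (a.subst.toLinearMap.comp Q.toLin) (ofFn f) =
      ((a.subst.toLinearMap.comp Q.toLin).comp toFnAlg) f from rfl,
      pointDerivation_eq_sum _ ⟨baseValue a.comp, a.mem⟩ _ f]
    · refine Finset.sum_congr rfl fun i _ => ?_
      rw [gen_of_deg_eq_zero i.2, ← Algebra.commutes, ← Algebra.smul_def]
      rfl
    · intro f g
      change a.subst (Q.toLin (ofFn (f * g))) =
        _ • a.subst (Q.toLin (ofFn f)) + _ • a.subst (Q.toLin (ofFn g))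
      rw [ofFn_mul, Q.leibniz 0 _ (ofFn_mem_degPart f), pow_zero, one_smul, map_add, map_mul,
        map_mul, subst_ofFn, subst_ofFn, ← Algebra.commutes, ← Algebra.smul_def, ← Algebra.smul_def]
  · intro j _ F
    change a.subst (Q.toLin (gen U j * F)) = a.subst (Q.toLin (gen U j)) * _ + _
    rw [Q.leibniz _ _ (gen_mem_degPart j), map_add, map_mul, map_smul, map_mul, subst_gen, one_mul]
    rfl

/-- `Q² ξ^i = 0`, after substitution. -/
theorem sum_subst_F_mul (Q : Differential deg U) (k : ι) :
    ∑ i, a.subst (Q.F i) * a.subst (partialGen i (Q.F k)) = 0 := by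
  rw [← subst_Q, Differential.F, Q.sq_zero, map_zero]

end Derivations

/-! ### Substitution as a smooth function -/

section LamCalculus

set_option linter.unusedSectionVars false

variable {V : Type*} [AddCommGroup V] [Module ℝ V] [FiniteDimensional ℝ V]
  {X : Type*} [NormedAddCommGroup X] [NormedSpace ℝ X]

variable (V) in
/-- The multiplication of `⋀ V*` as a continuous bilinear map. -/
def mulL : Lam V →L[ℝ] Lam V →L[ℝ] Lam V := (LinearMap.mul ℝ (Lam V)).toContinuousBilinearMap

@[simp] theorem mulL_apply (x y : Lam V) : mulL V x y = x * y := rfl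

theorem contDiffOn_lam_mul {f g : X → Lam V} {s : Set X} {n : WithTop ℕ∞}
    (hf : ContDiffOn ℝ n f s) (hg : ContDiffOn ℝ n g s) :
    ContDiffOn ℝ n (fun x => f x * g x) s :=
  ((mulL V).contDiff.comp_contDiffOn hf).clm_apply hg

theorem hasFDerivWithinAt_lam_mul {f g : X → Lam V} {f' g' : X →L[ℝ] Lam V} {s : Set X} {x : X}
    (hf : HasFDerivWithinAt f f' s x) (hg : HasFDerivWithinAt g g' s x) :
    HasFDerivWithinAt (fun x => f x * g x)
      ((mulL V (f x)).comp g' + ((mulL V).flip (g x)).comp f') s x := by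
  have h := (mulL V).hasFDerivWithinAt_of_bilinear hf hg
  refine h.congr_fderiv ?_
  ext w
  simp

theorem contDiffOn_linearMap_comp {Y Z : Type*} [NormedAddCommGroup Y] [NormedSpace ℝ Y]
    [FiniteDimensional ℝ Y] [NormedAddCommGroup Z] [NormedSpace ℝ Z] (L : Y →ₗ[ℝ] Z)
    {f : X → Y} {s : Set X} {n : WithTop ℕ∞} (hf : ContDiffOn ℝ n f s) :
    ContDiffOn ℝ n (fun x => L (f x)) s :=
  (LinearMap.toContinuousLinearMap L).contDiff.comp_contDiffOn hf

theorem hasFDerivWithinAt_linearMap_comp {Y Z : Type*} [NormedAddCommGroup Y] [NormedSpace ℝ Y]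
    [FiniteDimensional ℝ Y] [NormedAddCommGroup Z] [NormedSpace ℝ Z] (L : Y →ₗ[ℝ] Z)
    {f : X → Y} {f' : X →L[ℝ] Y} {s : Set X} {x : X} (hf : HasFDerivWithinAt f f' s x) :
    HasFDerivWithinAt (fun x => L (f x)) ((LinearMap.toContinuousLinearMap L).comp f') s x :=
  (LinearMap.toContinuousLinearMap L).hasFDerivAt.comp_hasFDerivWithinAt x hf

theorem hasDerivWithinAt_linearMap_comp {Y Z : Type*} [NormedAddCommGroup Y] [NormedSpace ℝ Y]
    [FiniteDimensional ℝ Y] [NormedAddCommGroup Z] [NormedSpace ℝ Z] (L : Y →ₗ[ℝ] Z)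
    {f : ℝ → Y} {f' : Y} {s : Set ℝ} {x : ℝ} (hf : HasDerivWithinAt f f' s x) :
    HasDerivWithinAt (fun x => L (f x)) (L f') s x :=
  (LinearMap.toContinuousLinearMap L).hasFDerivAt.comp_hasDerivWithinAt x hf

theorem continuous_lam_linear {Z : Type*} [NormedAddCommGroup Z] [NormedSpace ℝ Z]
    (L : Lam V →ₗ[ℝ] Z) : Continuous L := L.continuous_of_finiteDimensional

end LamCalculus

section SubstTotal

set_option linter.unusedSectionVars false

variable {ι : Type*} {deg : ι → ℕ} [Fintype ι] [DecidableEq ι] {U : Opens (Base deg)}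
  {V : Type*} [AddCommGroup V] [Module ℝ V]

variable (deg) in
/-- The projection to homogeneous tuples of degree 0. -/
def wProj : (ι → Lam V) →ₗ[ℝ] (ι → Lam V) :=
  LinearMap.pi fun i => projDeg (deg i) ∘ₗ LinearMap.proj i

/-- The `W⁰`-component, as a linear map. -/
def baseL : (ι → Lam V) →ₗ[ℝ] Base deg :=
  LinearMap.pi fun i => scalar.toLinearMap ∘ₗ LinearMap.proj i.1

theorem baseL_apply (a : ι → Lam V) : baseL a = baseValue (deg := deg) a := rfl

variable (U V) in
/-- The tuples of elements of `⋀ V*` with `W⁰`-component in `U`. -/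
def fiberDom : Set (ι → Lam V) := {a | baseL (wProj deg a) ∈ U}

/-- The homogeneous part of a tuple. -/
def toPt (a : ι → Lam V) (ha : a ∈ fiberDom U V) : FiberPt deg U V where
  comp := wProj deg a
  homog _ := projDeg_mem _ _
  mem := ha

open Classical in
/-- Substitution of the homogeneous part of an arbitrary tuple. -/
def substT (F : FnAlg deg U) (a : ι → Lam V) : Lam V :=
  if h : a ∈ fiberDom U V then (toPt a h).subst F else 0

theorem substT_of_mem {a : ι → Lam V} (h : a ∈ fiberDom U V) (F : FnAlg deg U) :
    substT F a = (toPt a h).subst F := dif_pos h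

theorem wProj_of_homog {a : ι → Lam V} (ha : ∀ i, a i ∈ ⋀[ℝ]^(deg i) (Module.Dual ℝ V)) :
    wProj deg a = a := funext fun i => projDeg_of_mem (ha i)

theorem FiberPt.comp_mem_fiberDom (a : FiberPt deg U V) : a.comp ∈ fiberDom U V := by
  rw [fiberDom, mem_ofPred_eq, wProj_of_homog a.homog]
  exact a.mem

theorem FiberPt.ext_comp {a b : FiberPt deg U V} (h : a.comp = b.comp) : a = b := by
  cases a
  cases b
  cases h
  rfl

theorem substT_comp (a : FiberPt deg U V) (F : FnAlg deg U) : substT F a.comp = a.subst F := by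
  have h : toPt a.comp a.comp_mem_fiberDom = a := FiberPt.ext_comp (wProj_of_homog a.homog)
  rw [substT_of_mem a.comp_mem_fiberDom, h]

theorem mem_fiberDom_of_homog {a : ι → Lam V} (ha : ∀ i, a i ∈ ⋀[ℝ]^(deg i) (Module.Dual ℝ V)) :
    a ∈ fiberDom U V ↔ baseValue (deg := deg) a ∈ U := by
  rw [fiberDom, mem_ofPred_eq, wProj_of_homog ha, baseL_apply]

theorem substT_add (F G : FnAlg deg U) : (substT (F + G) : (ι → Lam V) → Lam V) =
    fun a => substT F a + substT G a := by
  funext a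
  unfold substT
  split_ifs with h
  · exact map_add _ _ _
  · exact (add_zero 0).symm

theorem substT_smul (c : ℝ) (F : FnAlg deg U) : (substT (c • F) : (ι → Lam V) → Lam V) =
    fun a => c • substT F a := by
  funext a
  unfold substT
  split_ifs with h
  · exact map_smul _ _ _
  · exact (smul_zero c).symm

theorem substT_gen_mul (j : ι) (F : FnAlg deg U) {a : ι → Lam V} (ha : a ∈ fiberDom U V) :
    substT (gen U j * F) a = projDeg (deg j) (a j) * substT F a := by
  rw [substT_of_mem ha, substT_of_mem ha, map_mul, subst_gen]
  rfl

theorem substT_gen (j : ι) {a : ι → Lam V} (ha : a ∈ fiberDom U V) :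
    substT (gen U j) a = projDeg (deg j) (a j) := by
  rw [substT_of_mem ha, subst_gen]
  rfl

theorem substT_ofFn (f : SmoothFn deg U) {a : ι → Lam V} (ha : a ∈ fiberDom U V) :
    substT (ofFn f) a = Algebra.linearMap ℝ (Lam V)
      (Function.extend Subtype.val f.1 0 (baseL (wProj deg a))) := by
  rw [substT_of_mem ha, subst_ofFn, ← extend_apply]
  rfl

theorem pull_wProj {V' : Type*} [AddCommGroup V'] [Module ℝ V'] (L : V →ₗ[ℝ] V')
    (a : ι → Lam V') : wProj deg (fun i => pull L (a i)) = fun i => pull L (wProj deg a i) :=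
  funext fun _ => (pull_projDeg L _ _).symm

theorem pull_mem_fiberDom {V' : Type*} [AddCommGroup V'] [Module ℝ V'] (L : V →ₗ[ℝ] V')
    (a : ι → Lam V') : (fun i => pull L (a i)) ∈ fiberDom U V ↔ a ∈ fiberDom U V' := by
  simp only [fiberDom, mem_ofPred_eq, pull_wProj, baseL_apply]
  have : baseValue (deg := deg) (fun i => pull L (wProj deg a i)) = baseValue (wProj deg a) :=
    funext fun _ => scalar_pull L _
  rw [this]

theorem pull_substT {V' : Type*} [AddCommGroup V'] [Module ℝ V'] (L : V →ₗ[ℝ] V')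
    (F : FnAlg deg U) (a : ι → Lam V') :
    pull L (substT F a) = substT F (fun i => pull L (a i)) := by
  by_cases h : a ∈ fiberDom U V'
  · have e : (toPt a h).pull L = toPt _ ((pull_mem_fiberDom L a).mpr h) :=
      FiberPt.ext_comp (pull_wProj L a).symm
    rw [substT_of_mem h, substT_of_mem ((pull_mem_fiberDom L a).mpr h), pull_subst, e]
  · rw [substT, dif_neg h, substT, dif_neg fun h' => h ((pull_mem_fiberDom L a).mp h'), map_zero]

variable [FiniteDimensional ℝ V]

theorem isOpen_fiberDom : IsOpen (fiberDom U V) :=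
  U.isOpen.preimage (baseL ∘ₗ wProj deg : (ι → Lam V) →ₗ[ℝ] Base deg).continuous_of_finiteDimensional

theorem contDiffOn_substT (F : FnAlg deg U) :
    ContDiffOn ℝ ∞ (substT F : (ι → Lam V) → Lam V) (fiberDom U V) := by
  refine fnAlg_gen_induction
    (P := fun F => ContDiffOn ℝ ∞ (substT F : (ι → Lam V) → Lam V) (fiberDom U V))
    (fun x y hx hy => ?_) (fun c x hx => ?_) (fun f => ?_) (fun j _ F hF => ?_) F
  · rw [substT_add]
    exact hx.add hy
  · rw [substT_smul]
    exact hx.const_smul c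
  · refine ContDiffOn.congr ?_ fun a ha => substT_ofFn f ha
    refine contDiffOn_linearMap_comp (Algebra.linearMap ℝ (Lam V)) ?_
    exact (contDiffOn_extend f).comp (contDiffOn_linearMap_comp
      (baseL ∘ₗ wProj deg : (ι → Lam V) →ₗ[ℝ] Base deg) contDiffOn_id) fun a ha => ha
  · refine ContDiffOn.congr ?_ fun a ha => substT_gen_mul j F ha
    exact contDiffOn_lam_mul (contDiffOn_linearMap_comp
      (projDeg (deg j) ∘ₗ LinearMap.proj j : (ι → Lam V) →ₗ[ℝ] Lam V) contDiffOn_id) hF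

theorem differentiableAt_substT (F : FnAlg deg U) {a : ι → Lam V} (ha : a ∈ fiberDom U V) :
    DifferentiableAt ℝ (substT F : (ι → Lam V) → Lam V) a :=
  ((contDiffOn_substT F).contDiffAt (isOpen_fiberDom.mem_nhds ha)).differentiableAt (by simp)

/-- The chain rule for substitution. -/
theorem fderiv_substT (F : FnAlg deg U) {a : ι → Lam V} (ha : a ∈ fiberDom U V)
    (b : ι → Lam V) : fderiv ℝ (substT F : (ι → Lam V) → Lam V) a b =
      ∑ i, projDeg (deg i) (b i) * substT (partialGen i F) a := by
  let δ : FnAlg deg U →ₗ[ℝ] Lam V :=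
    { toFun := fun F => fderiv ℝ (substT F : (ι → Lam V) → Lam V) a b
      map_add' := fun F G => by
        rw [substT_add, fderiv_fun_add (differentiableAt_substT F ha) (differentiableAt_substT G ha)]
        rfl
      map_smul' := fun c F => by
        rw [substT_smul, fderiv_fun_const_smul (differentiableAt_substT F ha)]
        rfl }
  have hnhds := isOpen_fiberDom.mem_nhds ha
  have hgen : ∀ i, δ (gen U i) = projDeg (deg i) (b i) := fun i => by
    have h1 : (substT (gen U i) : (ι → Lam V) → Lam V) =ᶠ[nhds a]
        fun a => (projDeg (deg i) ∘ₗ LinearMap.proj i : (ι → Lam V) →ₗ[ℝ] Lam V) a :=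
      Filter.eventuallyEq_of_mem hnhds fun c hc => substT_gen i hc
    change fderiv ℝ _ a b = _
    rw [h1.fderiv_eq]
    exact congrArg (fun L => L b) ((LinearMap.toContinuousLinearMap
      (projDeg (deg i) ∘ₗ LinearMap.proj i : (ι → Lam V) →ₗ[ℝ] Lam V)).fderiv (x := a))
  have h := eq_sum_partialGen (toPt a ha) δ 0 deg (fun i => ⟨deg i, by ring⟩)
    (fun i => by rw [hgen]; exact projDeg_mem _ _) ?_ ?_ F
  · refine h.trans (Finset.sum_congr rfl fun i _ => ?_)
    rw [hgen, substT_of_mem ha]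
  · intro f
    let L : (ι → Lam V) →L[ℝ] Base deg :=
      LinearMap.toContinuousLinearMap (baseL ∘ₗ wProj deg : (ι → Lam V) →ₗ[ℝ] Base deg)
    let L' : ℝ →L[ℝ] Lam V := LinearMap.toContinuousLinearMap (Algebra.linearMap ℝ (Lam V))
    have h1 : (substT (ofFn f) : (ι → Lam V) → Lam V) =ᶠ[nhds a]
        fun a => L' (Function.extend Subtype.val f.1 0 (L a)) :=
      Filter.eventuallyEq_of_mem hnhds fun c hc => substT_ofFn f hc
    have h2 : HasFDerivAt (Function.extend Subtype.val f.1 0)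
        (fderiv ℝ (Function.extend Subtype.val f.1 0) (L a)) (L a) :=
      ((smoothAt_extend f ⟨L a, ha⟩).differentiableAt (by simp)).hasFDerivAt
    have h3 := (L'.hasFDerivAt.comp a (h2.comp a L.hasFDerivAt))
    change fderiv ℝ _ a b = _
    rw [h1.fderiv_eq]
    refine (congrArg (fun L => L b) h3.fderiv).trans ?_
    change L' (fderiv ℝ (Function.extend Subtype.val f.1 0) (L a) (L b)) = _
    rw [← Finset.univ_sum_single (L b), map_sum, map_sum]
    refine Finset.sum_congr rfl fun i _ => ?_
    have h4 : Pi.single i (L b i) = L b i • Pi.single (M := fun _ => ℝ) i (1 : ℝ) := by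
      rw [← Pi.single_smul, smul_eq_mul, mul_one]
    have h5 : projDeg (deg i.1) (b i.1) = algebraMap ℝ _ (L b i) := by
      have h6 : ∀ n, n = 0 → ∀ x : Lam V, x ∈ ⋀[ℝ]^n (Module.Dual ℝ V) →
          x = algebraMap ℝ _ (scalar x) := by
        rintro _ rfl x hx
        exact eq_algebraMap_scalar hx
      exact h6 _ i.2 _ (projDeg_mem _ _)
    rw [h4, map_smul, hgen, h5, ← map_mul]
    rfl
  · intro j _ F
    have h1 : (substT (gen U j * F) : (ι → Lam V) → Lam V) =ᶠ[nhds a]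
        fun a => (projDeg (deg j) ∘ₗ LinearMap.proj j : (ι → Lam V) →ₗ[ℝ] Lam V) a * substT F a :=
      Filter.eventuallyEq_of_mem hnhds fun c hc => substT_gen_mul j F hc
    have h2 := hasFDerivWithinAt_lam_mul
      (hasFDerivWithinAt_linearMap_comp (projDeg (deg j) ∘ₗ LinearMap.proj j)
        (hasFDerivWithinAt_id a univ)) (differentiableAt_substT F ha).hasFDerivAt.hasFDerivWithinAt
    rw [hasFDerivWithinAt_univ] at h2
    change fderiv ℝ _ a b = _
    rw [h1.fderiv_eq]
    refine (congrArg (fun L => L b) h2.fderiv).trans ?_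
    rw [hgen, ← substT_of_mem ha, zero_mul, pow_zero, one_smul, add_comm]
    rfl

theorem hasFDerivWithinAt_substT {X : Type*} [NormedAddCommGroup X] [NormedSpace ℝ X]
    (F : FnAlg deg U) {A : ι → X → Lam V} {A' : ι → X →L[ℝ] Lam V} {s : Set X} {x : X}
    (hA : ∀ i, HasFDerivWithinAt (A i) (A' i) s x) (hx : (fun i => A i x) ∈ fiberDom U V) :
    HasFDerivWithinAt (fun x => substT F fun i => A i x)
      ((fderiv ℝ (substT F) fun i => A i x).comp (ContinuousLinearMap.pi A')) s x :=
  HasFDerivAt.comp_hasFDerivWithinAt (g := substT F) (f := fun x i => A i x) x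
    (differentiableAt_substT F hx).hasFDerivAt (hasFDerivWithinAt_pi.mpr hA)

end SubstTotal

/-! ### The equation at one point -/

section Field

set_option linter.unusedSectionVars false

variable {ι : Type*} {deg : ι → ℕ} [Fintype ι] [DecidableEq ι] {U : Opens (Base deg)}
  {V : Type*} [AddCommGroup V] [Module ℝ V]

/-- The right hand side of the equation for the horizontal part. -/
def mcField (Q : Differential deg U) (h ρ a : ι → Lam V) : ι → Lam V := fun i =>
  ρ i + ∑ j, h j * substT (partialGen j (Q.F i)) a

theorem pull_mcField {V' : Type*} [AddCommGroup V'] [Module ℝ V'] (L : V →ₗ[ℝ] V')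
    (Q : Differential deg U) (h ρ a : ι → Lam V') (i : ι) :
    pull L (mcField Q h ρ a i) =
      mcField Q (fun i => pull L (h i)) (fun i => pull L (ρ i)) (fun i => pull L (a i)) i := by
  simp only [mcField, map_add, map_sum, map_mul, pull_substT]

theorem contDiffOn_mcField [FiniteDimensional ℝ V] {X : Type*} [NormedAddCommGroup X]
    [NormedSpace ℝ X] (Q : Differential deg U) {h ρ a : X → ι → Lam V} {s : Set X}
    (hh : ContDiffOn ℝ ∞ h s) (hρ : ContDiffOn ℝ ∞ ρ s) (ha : ContDiffOn ℝ ∞ a s)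
    (has : ∀ x ∈ s, a x ∈ fiberDom U V) :
    ContDiffOn ℝ ∞ (fun x => mcField Q (h x) (ρ x) (a x)) s := by
  rw [contDiffOn_pi] at hh hρ ⊢
  exact fun i => (hρ i).add (ContDiffOn.sum fun j _ =>
    contDiffOn_lam_mul (hh j) ((contDiffOn_substT _).comp ha has))

theorem vert_subst {E : Type*} [NormedAddCommGroup E] [NormedSpace ℝ E] [FiniteDimensional ℝ E]
    (c : FiberPt deg U (E × ℝ)) (F : FnAlg deg U) :
    vert (c.subst F) = ∑ i, vert (c.comp i) * c.subst (partialGen i F) :=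
  contract_subst c _ F

theorem mcField_mem {E : Type*} [NormedAddCommGroup E] [NormedSpace ℝ E] [FiniteDimensional ℝ E]
    (Q : Differential deg U) {h ρ a : ι → Lam E} (hh : ∀ i, h i ∈ homogPart E (-1 + deg i))
    (hρ : ∀ i, ρ i ∈ ⋀[ℝ]^(deg i) (Module.Dual ℝ E)) (ha : a ∈ fiberDom U E) (i : ι) :
    mcField Q h ρ a i ∈ ⋀[ℝ]^(deg i) (Module.Dual ℝ E) := by
  refine add_mem (hρ i) ?_
  let c : FiberPt deg U (E × ℝ) :=
    { comp := fun i => pull (LinearMap.fst ℝ E ℝ) (wProj deg a i) +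
        dt * pull (LinearMap.fst ℝ E ℝ) (h i)
      homog := fun i => by
        refine add_mem (pull_mem _ (projDeg_mem _ _)) ?_
        have hi := hh i
        obtain hd | ⟨n, hn⟩ : deg i = 0 ∨ ∃ n, deg i = n + 1 := by
          cases h : deg i with
          | zero => exact Or.inl rfl
          | succ n => exact Or.inr ⟨n, rfl⟩
        · rw [hd] at hi
          rw [eq_zero_of_mem_homogPart_neg_one hi, map_zero, mul_zero]
          exact zero_mem _
        · rw [hn] at hi ⊢
          rw [add_comm]
          exact mul_mem_lam (ι_mem_lam _) (pull_mem _ (mem_homogPart_neg_one_add hi))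
      mem := by
        have : baseValue (deg := deg) (fun i => pull (LinearMap.fst ℝ E ℝ) (wProj deg a i) +
            dt * pull (LinearMap.fst ℝ E ℝ) (h i)) = baseL (wProj deg a) := by
          funext j
          change scalar _ = scalar _
          rw [map_add, map_mul, dt, scalar_ι, zero_mul, add_zero, scalar_pull]
          rfl
        rw [this]
        exact ha }
  have h1 := subst_mem_of_degPart c (Q.degree _ _ (gen_mem_degPart i))
  have h2 := pull_mem (LinearMap.inl ℝ E ℝ) (contract_mem ((0 : E), (1 : ℝ)) h1)
  have hc : c.pull (LinearMap.inl ℝ E ℝ) = toPt a ha := FiberPt.ext_comp <| funext fun i => by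
    change pull _ (pull _ _ + dt * _) = _
    rw [map_add, pull_inl_dt_mul, add_zero, pull_inl_pull_fst]
    rfl
  convert h2 using 1
  rw [show contract ((0 : E), (1 : ℝ)) (c.subst (Q.toLin (gen U i))) =
    vert (c.subst (Q.F i)) from rfl, vert_subst, map_sum]
  refine Finset.sum_congr rfl fun j _ => ?_
  rw [map_mul, pull_subst, hc, substT_of_mem ha]
  congr 1
  change _ = pull _ (vert (pull _ _ + dt * _))
  rw [map_add, vert_pull_fst, zero_add, vert_dt_mul, vert_pull_fst, mul_zero, sub_zero,
    pull_inl_pull_fst]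

variable [FiniteDimensional ℝ V]

/-- Curves with homogeneous derivative stay homogeneous. -/
theorem homog_of_deriv_homog {T : ℝ} {a a' : ℝ → ι → Lam V}
    (ha : ∀ t ∈ Icc 0 T, HasDerivWithinAt a (a' t) (Icc 0 T) t)
    (ha' : ∀ t ∈ Icc 0 T, ∀ i, a' t i ∈ ⋀[ℝ]^(deg i) (Module.Dual ℝ V))
    (h0 : ∀ i, a 0 i ∈ ⋀[ℝ]^(deg i) (Module.Dual ℝ V)) :
    ∀ t ∈ Icc 0 T, ∀ i, a t i ∈ ⋀[ℝ]^(deg i) (Module.Dual ℝ V) := by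
  intro t ht i
  let L : (ι → Lam V) →ₗ[ℝ] (ι → Lam V) := LinearMap.id - wProj deg
  have hL : ∀ b : ι → Lam V, (∀ i, b i ∈ ⋀[ℝ]^(deg i) (Module.Dual ℝ V)) → L b = 0 := fun b hb => by
    change b - wProj deg b = 0
    rw [wProj_of_homog hb, sub_self]
  have hd : ∀ t ∈ Icc 0 T, HasDerivWithinAt (fun t => L (a t)) 0 (Icc 0 T) t := fun t ht => by
    have := hasDerivWithinAt_linearMap_comp L (ha t ht)
    rwa [hL _ (ha' t ht)] at this
  have h1 := constant_of_has_deriv_right_zero (fun t ht => (hd t ht).continuousWithinAt)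
    (fun t ht => hasDerivWithinAt_Ici_of_Icc ht (hd t (Ico_subset_Icc_self ht))) t ht
  rw [hL _ h0] at h1
  have h2 : a t = wProj deg (a t) := sub_eq_zero.mp h1
  rw [h2]
  exact projDeg_mem _ _

variable (V) in
/-- The inclusion of `W⁰`. -/
def bodyL : Base deg →ₗ[ℝ] (ι → Lam V) :=
  LinearMap.pi fun i => if h : deg i = 0 then
    Algebra.linearMap ℝ (Lam V) ∘ₗ LinearMap.proj ⟨i, h⟩ else 0

theorem bodyL_apply (u : Base deg) {i : ι} (h : deg i = 0) :
    bodyL V u i = algebraMap ℝ (Lam V) (u ⟨i, h⟩) := by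
  simp [bodyL, h]

theorem bodyL_apply_of_ne (u : Base deg) {i : ι} (h : deg i ≠ 0) : bodyL V u i = 0 := by
  simp [bodyL, h]

theorem bodyL_homog (u : Base deg) (i : ι) : bodyL V u i ∈ ⋀[ℝ]^(deg i) (Module.Dual ℝ V) := by
  by_cases h : deg i = 0
  · rw [bodyL_apply u h, h]
    exact algebraMap_mem_lam _
  · rw [bodyL_apply_of_ne u h]
    exact zero_mem _

theorem baseValue_bodyL (u : Base deg) : baseValue (deg := deg) (bodyL V u) = u := by
  funext i
  rw [baseValue, bodyL_apply u i.2, scalar_algebraMap]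

theorem norm_lam_mul_le (x y : Lam V) : ‖x * y‖ ≤ ‖mulL V‖ * ‖x‖ * ‖y‖ := by
  have := (mulL V).le_opNorm₂ x y
  rwa [mulL_apply] at this

/-- Bounds for the field on a neighbourhood of a compact subset of `U`. -/
theorem exists_mcField_bounds (Q : Differential deg U) {K : Set (Base deg)} (hK : IsCompact K)
    (hKU : K ⊆ U) : ∃ R > 0, ∃ M ≥ 0, ∀ u ∈ K,
      Metric.closedBall (bodyL V u) R ⊆ fiberDom U V ∧
      ∀ (h ρ : ι → Lam V) (κ κ' : ℝ), 0 ≤ κ' → (∀ j, ‖h j‖ ≤ κ) → (∀ i, ‖ρ i‖ ≤ κ') →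
        (∀ a ∈ Metric.closedBall (bodyL V u) R, ‖mcField Q h ρ a‖ ≤ κ' + κ * M) ∧
        ∀ a ∈ Metric.closedBall (bodyL V u) R, ∀ b ∈ Metric.closedBall (bodyL V u) R,
          ‖mcField Q h ρ a - mcField Q h ρ b‖ ≤ κ * M * ‖a - b‖ := by
  have : ProperSpace (ι → Lam V) := FiniteDimensional.proper_real _
  have hZ : IsCompact (bodyL V '' K) :=
    hK.image (bodyL V : Base deg →ₗ[ℝ] (ι → Lam V)).continuous_of_finiteDimensional
  have hZU : bodyL V '' K ⊆ fiberDom U V := by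
    rintro _ ⟨u, hu, rfl⟩
    rw [mem_fiberDom_of_homog (bodyL_homog u), baseValue_bodyL]
    exact hKU hu
  obtain ⟨R, hR, hRU⟩ := hZ.exists_cthickening_subset_open isOpen_fiberDom hZU
  have hC : IsCompact (Metric.cthickening R (bodyL V '' K)) := hZ.cthickening
  have hS : ∀ i j, ContDiffOn ℝ ∞ (substT (partialGen j (Q.F i)) : (ι → Lam V) → Lam V)
      (fiberDom U V) := fun i j => contDiffOn_substT _
  obtain ⟨M₀, hM₀⟩ := hC.exists_bound_of_continuousOn
    (f := fun a i j => (substT (partialGen j (Q.F i)) : (ι → Lam V) → Lam V) a)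
    (continuousOn_pi.mpr fun i => continuousOn_pi.mpr fun j => (hS i j).continuousOn.mono hRU)
  obtain ⟨M₁, hM₁⟩ := hC.exists_bound_of_continuousOn
    (f := fun a i j => fderiv ℝ (substT (partialGen j (Q.F i)) : (ι → Lam V) → Lam V) a)
    (continuousOn_pi.mpr fun i => continuousOn_pi.mpr fun j =>
      ((hS i j).continuousOn_fderiv_of_isOpen isOpen_fiberDom (by simp)).mono hRU)
  set M := max (max M₀ M₁) 0 with hM
  have hM0 : 0 ≤ M := le_max_right _ _
  have hb₀ : ∀ a ∈ Metric.cthickening R (bodyL V '' K), ∀ i j,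
      ‖(substT (partialGen j (Q.F i)) : (ι → Lam V) → Lam V) a‖ ≤ M := fun a ha i j =>
    ((norm_le_pi_norm _ j).trans ((norm_le_pi_norm _ i).trans (hM₀ a ha))).trans
      ((le_max_left _ _).trans (le_max_left _ _))
  have hb₁ : ∀ a ∈ Metric.cthickening R (bodyL V '' K), ∀ i j,
      ‖fderiv ℝ (substT (partialGen j (Q.F i)) : (ι → Lam V) → Lam V) a‖ ≤ M := fun a ha i j =>
    ((norm_le_pi_norm (fun j => fderiv ℝ (substT (partialGen j (Q.F i)) :
      (ι → Lam V) → Lam V) a) j).trans ((norm_le_pi_norm (fun i j => fderiv ℝ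
        (substT (partialGen j (Q.F i)) : (ι → Lam V) → Lam V) a) i).trans (hM₁ a ha))).trans
      ((le_max_right _ _).trans (le_max_left _ _))
  refine ⟨R, hR, Fintype.card ι * (‖mulL V‖ * M), by positivity, fun u hu => ?_⟩
  have hball : Metric.closedBall (bodyL V u) R ⊆ Metric.cthickening R (bodyL V '' K) :=
    Metric.closedBall_subset_cthickening (mem_image_of_mem _ hu) R
  refine ⟨hball.trans hRU, fun h ρ κ κ' hκ' hh hρ => ?_⟩
  have hsum : ∀ (T : ι → Lam V) (c : ℝ), 0 ≤ c → (∀ j, ‖T j‖ ≤ c) → (∀ j : ι, 0 ≤ κ) →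
      ‖∑ j, h j * T j‖ ≤ Fintype.card ι * (‖mulL V‖ * κ * c) := fun T c hc hT hκ => by
    refine (norm_sum_le _ _).trans ?_
    have : ∀ j ∈ Finset.univ, ‖h j * T j‖ ≤ ‖mulL V‖ * κ * c := fun j _ => by
      have := hκ j
      refine (norm_lam_mul_le _ _).trans ?_
      gcongr
      · exact hh j
      · exact hT j
    simpa using Finset.sum_le_card_nsmul _ _ _ this
  have hκ : ∀ j : ι, 0 ≤ κ := fun j => (norm_nonneg _).trans (hh j)
  constructor
  · intro a ha
    by_cases hι : Nonempty ι
    · have hκ0 := hκ hι.some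
      refine (pi_norm_le_iff_of_nonneg (by positivity)).mpr fun i => ?_
      refine (norm_add_le _ _).trans (add_le_add (hρ i) ?_)
      refine (hsum _ M hM0 (fun j => hb₀ a (hball ha) i j) hκ).trans_eq ?_
      ring
    · rw [not_nonempty_iff] at hι
      have e : mcField Q h ρ a = 0 := Subsingleton.elim _ _
      rw [e, norm_zero, Fintype.card_eq_zero]
      simpa using hκ'
  · intro a ha b hb
    by_cases hι : Nonempty ι
    · have hκ0 := hκ hι.some
      refine (pi_norm_le_iff_of_nonneg (by positivity)).mpr fun i => ?_
      have e : (mcField Q h ρ a - mcField Q h ρ b) i = ∑ j, h j *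
          (substT (partialGen j (Q.F i)) a - substT (partialGen j (Q.F i)) b) := by
        simp only [mcField, Pi.sub_apply, mul_sub, Finset.sum_sub_distrib]
        abel
      rw [e]
      refine (hsum _ (M * ‖a - b‖) (by positivity) (fun j => ?_) hκ).trans_eq (by ring)
      exact (convex_closedBall (bodyL V u) R).norm_image_sub_le_of_norm_fderiv_le
        (fun x hx => differentiableAt_substT _ (hRU (hball hx)))
        (fun x hx => hb₁ x (hball hx) i j) hb ha
    · rw [not_nonempty_iff] at hι
      have e : mcField Q h ρ a - mcField Q h ρ b = 0 := Subsingleton.elim _ _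
      rw [e, norm_zero, Fintype.card_eq_zero]
      simp

theorem exists_solution_mem_closedBall {G : Type*} [NormedAddCommGroup G] [NormedSpace ℝ G]
    [CompleteSpace G] {f : ℝ → G → G} {tmin tmax : ℝ} {t₀ : Icc tmin tmax} {x₀ x : G}
    {a r L K : NNReal} (hf : IsPicardLindelof f t₀ x₀ a r L K) (hx : x ∈ Metric.closedBall x₀ r) :
    ∃ α : ℝ → G, α t₀ = x ∧ ∀ t ∈ Icc tmin tmax,
      α t ∈ Metric.closedBall x₀ a ∧ HasDerivWithinAt α (f t (α t)) (Icc tmin tmax) t := by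
  obtain ⟨α, hα⟩ := ODE.FunSpace.exists_isFixedPt_next hf hx
  refine ⟨α.compProj, by rw [ODE.FunSpace.compProj_val, ← hα, ODE.FunSpace.next_apply₀],
    fun t ht ↦ ⟨α.compProj_mem_closedBall hf.mul_max_le, ?_⟩⟩
  apply ODE.hasDerivWithinAt_picard_Icc t₀.2 hf.continuousOn_uncurry
    α.continuous_compProj.continuousOn (fun _ ht' ↦ α.compProj_mem_closedBall hf.mul_max_le)
    x ht |>.congr_of_mem _ ht
  intro t' ht'
  nth_rw 1 [← hα]
  rw [ODE.FunSpace.compProj_of_mem ht', ODE.FunSpace.next_apply]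

/-- Existence on an interval whose length is controlled by the scalar part of `h` only: the
other parts become small after rescaling the tangent space. -/
theorem exists_fiber_solution {E : Type*} [NormedAddCommGroup E] [NormedSpace ℝ E]
    [FiniteDimensional ℝ E] (Q : Differential deg U) {K : Set (Base deg)} (hK : IsCompact K)
    (hKU : K ⊆ U) : ∃ μ > 0, ∀ ε δ : ℝ, 0 < ε → 0 ≤ δ → ε * δ ≤ μ → ∀ (a₀ : ι → Lam E),
      (∀ i, a₀ i ∈ ⋀[ℝ]^(deg i) (Module.Dual ℝ E)) → baseValue a₀ ∈ K →
      ∀ h ρ : ℝ → ι → Lam E, ContinuousOn h (Icc 0 ε) → ContinuousOn ρ (Icc 0 ε) →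
      (∀ t ∈ Icc 0 ε, ∀ i, h t i ∈ homogPart E (-1 + deg i)) →
      (∀ t ∈ Icc 0 ε, ∀ i, ρ t i ∈ ⋀[ℝ]^(deg i) (Module.Dual ℝ E)) →
      (∀ t ∈ Icc 0 ε, ∀ i, deg i = 0 → ρ t i = 0) →
      (∀ t ∈ Icc 0 ε, ∀ i, deg i = 1 → |scalar (h t i)| ≤ δ) →
      ∃ a : ℝ → ι → Lam E, a 0 = a₀ ∧ ∀ t ∈ Icc 0 ε, a t ∈ fiberDom U E ∧
        (∀ i, a t i ∈ ⋀[ℝ]^(deg i) (Module.Dual ℝ E)) ∧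
        HasDerivWithinAt a (mcField Q (h t) (ρ t) (a t)) (Icc 0 ε) t := by
  obtain ⟨R, hR, M, hM, hbounds⟩ := exists_mcField_bounds (V := E) Q hK hKU
  set c₁ := ‖(1 : Lam E)‖ with hc₁
  have hc₁0 : 0 ≤ c₁ := norm_nonneg _
  refine ⟨R / (4 * (c₁ * M + 1)), by positivity, fun ε δ hε hδ hεδ a₀ ha₀ haK h ρ hh hρ hhom hρhom
    hρ0 hsc => ?_⟩
  obtain ⟨B₁, hB₁⟩ := isCompact_Icc.exists_bound_of_continuousOn hh
  obtain ⟨B₂, hB₂⟩ := isCompact_Icc.exists_bound_of_continuousOn hρ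
  set B := max (max B₁ B₂) ‖a₀‖ with hB
  have hB0 : 0 ≤ B := (norm_nonneg a₀).trans (le_max_right _ _)
  have hBh : ∀ t ∈ Icc 0 ε, ∀ j, ‖h t j‖ ≤ B := fun t ht j =>
    ((norm_le_pi_norm _ j).trans (hB₁ t ht)).trans ((le_max_left _ _).trans (le_max_left _ _))
  have hBρ : ∀ t ∈ Icc 0 ε, ∀ j, ‖ρ t j‖ ≤ B := fun t ht j =>
    ((norm_le_pi_norm _ j).trans (hB₂ t ht)).trans ((le_max_right _ _).trans (le_max_left _ _))
  have hBa : ∀ j, ‖a₀ j‖ ≤ B := fun j => (norm_le_pi_norm _ j).trans (le_max_right _ _)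
  obtain ⟨l, hl0, hl1, hlR, hlε⟩ : ∃ l : ℝ, 0 < l ∧ l ≤ 1 ∧ l * B ≤ R / 2 ∧
      ε * (l * B + l * B * M) ≤ R / 4 := by
    refine ⟨min 1 (min (R / (2 * (B + 1))) (R / (4 * ε * (B + B * M + 1)))), by positivity,
      min_le_left _ _, ?_, ?_⟩
    · have h1 : min 1 (min (R / (2 * (B + 1))) (R / (4 * ε * (B + B * M + 1)))) ≤
        R / (2 * (B + 1)) := (min_le_right _ _).trans (min_le_left _ _)
      rw [le_div_iff₀ (by positivity)] at h1
      have h2 : 0 < min 1 (min (R / (2 * (B + 1))) (R / (4 * ε * (B + B * M + 1)))) := by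
        positivity
      nlinarith
    · have h1 : min 1 (min (R / (2 * (B + 1))) (R / (4 * ε * (B + B * M + 1)))) ≤
        R / (4 * ε * (B + B * M + 1)) := (min_le_right _ _).trans (min_le_right _ _)
      have h2 : 0 < min 1 (min (R / (2 * (B + 1))) (R / (4 * ε * (B + B * M + 1)))) := by
        positivity
      set l := min 1 (min (R / (2 * (B + 1))) (R / (4 * ε * (B + B * M + 1))))
      rw [le_div_iff₀ (by positivity)] at h1
      have h3 : 0 < l * ε := mul_pos h2 hε
      nlinarith
  let S : Lam E →ₗ[ℝ] Lam E := (pull (l • (LinearMap.id : E →ₗ[ℝ] E))).toLinearMap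
  have hS : ∀ {n : ℕ} {x : Lam E}, x ∈ ⋀[ℝ]^n (Module.Dual ℝ E) → S x = l ^ n • x :=
    fun hx => pull_smul_id l hx
  have hpow : ∀ n : ℕ, n ≠ 0 → l ^ n ≤ l := fun n hn => pow_le_of_le_one hl0.le hl1 hn
  have hSn : ∀ {n : ℕ} {x : Lam E}, n ≠ 0 → x ∈ ⋀[ℝ]^n (Module.Dual ℝ E) → ‖x‖ ≤ B →
      ‖S x‖ ≤ l * B := fun {n x} hn hx hxB => by
    rw [hS hx, norm_smul, Real.norm_of_nonneg (by positivity)]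
    exact mul_le_mul (hpow n hn) hxB (norm_nonneg _) hl0.le
  set u := baseValue (deg := deg) a₀ with hu
  have hinit : (fun i => S (a₀ i)) ∈ Metric.closedBall (bodyL E u) (R / 2) := by
    rw [mem_closedBall_iff_norm]
    refine (pi_norm_le_iff_of_nonneg (by positivity)).mpr fun i => ?_
    by_cases hi : deg i = 0
    · have h1 := ha₀ i
      rw [hi] at h1
      rw [Pi.sub_apply, hS h1, pow_zero, one_smul, bodyL_apply u hi]
      have h2 : algebraMap ℝ (Lam E) (u ⟨i, hi⟩) = a₀ i := (eq_algebraMap_scalar h1).symm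
      rw [h2, sub_self, norm_zero]
      positivity
    · rw [Pi.sub_apply, bodyL_apply_of_ne u hi, sub_zero]
      exact (hSn hi (ha₀ i) (hBa i)).trans hlR
  have hbh : ∀ t ∈ Icc 0 ε, ∀ j, ‖S (h t j)‖ ≤ δ * c₁ + l * B := fun t ht j => by
    have h1 := hhom t ht j
    obtain hd | ⟨n, hn⟩ : deg j = 0 ∨ ∃ n, deg j = n + 1 := by
      cases h : deg j with
      | zero => exact Or.inl rfl
      | succ n => exact Or.inr ⟨n, rfl⟩
    · rw [hd] at h1
      rw [eq_zero_of_mem_homogPart_neg_one h1, map_zero, norm_zero]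
      positivity
    · rw [hn] at h1
      have h2 := mem_homogPart_neg_one_add h1
      rcases Nat.eq_zero_or_pos n with rfl | hn0
      · have h3 := hsc t ht j hn
        rw [hS h2, pow_zero, one_smul, eq_algebraMap_scalar h2, Algebra.algebraMap_eq_smul_one,
          norm_smul, Real.norm_eq_abs]
        have : |scalar (h t j)| * c₁ ≤ δ * c₁ := by gcongr
        have : 0 ≤ l * B := by positivity
        linarith
      · have := hSn hn0.ne' h2 (hBh t ht j)
        have : 0 ≤ δ * c₁ := by positivity
        linarith
  have hbρ : ∀ t ∈ Icc 0 ε, ∀ i, ‖S (ρ t i)‖ ≤ l * B := fun t ht i => by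
    by_cases hi : deg i = 0
    · rw [hρ0 t ht i hi, map_zero, norm_zero]
      positivity
    · exact hSn hi (hρhom t ht i) (hBρ t ht i)
  have hSc : Continuous S := S.continuous_of_finiteDimensional
  have hlB : 0 ≤ l * B := by positivity
  let L : NNReal := ⟨l * B + (δ * c₁ + l * B) * M, by positivity⟩
  let Kl : NNReal := ⟨(δ * c₁ + l * B) * M, by positivity⟩
  have hfb := hbounds u haK
  have hPL : IsPicardLindelof (fun t a => mcField Q (fun i => S (h t i)) (fun i => S (ρ t i)) a)
      (⟨0, le_rfl, hε.le⟩ : Icc 0 ε) (bodyL E u) ⟨R, hR.le⟩ ⟨R / 2, by positivity⟩ L Kl := by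
    refine ⟨fun t ht => ?_, fun a ha => ?_, fun t ht a ha => ?_, ?_⟩
    · refine LipschitzOnWith.of_dist_le_mul fun a ha b hb => ?_
      rw [dist_eq_norm, dist_eq_norm]
      exact (hfb.2 _ _ _ _ hlB (hbh t ht) (hbρ t ht)).2 a ha b hb
    · refine continuousOn_pi.mpr fun i => ?_
      refine (hSc.comp_continuousOn (continuousOn_pi.mp hρ i)).add
        (continuousOn_finsetSum _ fun j _ => ?_)
      exact ((mulL E).continuous.comp_continuousOn
        (hSc.comp_continuousOn (continuousOn_pi.mp hh j))).clm_apply continuousOn_const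
    · exact (hfb.2 _ _ _ _ hlB (hbh t ht) (hbρ t ht)).1 a ha
    · change (l * B + (δ * c₁ + l * B) * M) * max (ε - 0) (0 - 0) ≤ R - R / 2
      rw [sub_zero, sub_zero, max_eq_left hε.le]
      have h1 : ε * δ * (c₁ * M) ≤ R / 4 := by
        rw [le_div_iff₀ (by positivity)] at hεδ
        nlinarith [mul_nonneg hε.le hδ, mul_nonneg hc₁0 hM]
      nlinarith
  obtain ⟨α, hα0, hα⟩ := exists_solution_mem_closedBall hPL hinit
  let S' : Lam E →ₗ[ℝ] Lam E := (pull (l⁻¹ • (LinearMap.id : E →ₗ[ℝ] E))).toLinearMap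
  have hS' : ∀ x, S' (S x) = x := fun x => by
    change pull _ (pull _ x) = x
    have : (l • (LinearMap.id : E →ₗ[ℝ] E)) ∘ₗ (l⁻¹ • (LinearMap.id : E →ₗ[ℝ] E)) =
        LinearMap.id := by
      ext v
      simp [hl0.ne']
    rw [pull_pull, this, pull_id]
  have hmem : ∀ t ∈ Icc 0 ε, (fun i => S' (α t i)) ∈ fiberDom U E := fun t ht =>
    (pull_mem_fiberDom _ _).mpr (hfb.1 (hα t ht).1)
  have hder : ∀ t ∈ Icc 0 ε, HasDerivWithinAt (fun t i => S' (α t i))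
      (mcField Q (h t) (ρ t) (fun i => S' (α t i))) (Icc 0 ε) t := fun t ht => by
    rw [hasDerivWithinAt_pi]
    intro i
    have h1 := hasDerivWithinAt_linearMap_comp S' (hasDerivWithinAt_pi.mp (hα t ht).2 i)
    refine h1.congr_deriv ?_
    refine (pull_mcField _ _ _ _ _ _).trans ?_
    congr 1
    · exact funext fun j => hS' _
    · exact funext fun j => hS' _
  have hz : (fun i => S' (α 0 i)) = a₀ := by
    change α 0 = _ at hα0
    rw [hα0]
    exact funext fun i => hS' _
  refine ⟨fun t i => S' (α t i), hz, fun t ht => ⟨hmem t ht, ?_, hder t ht⟩⟩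
  exact homog_of_deriv_homog hder
    (fun t ht => mcField_mem Q (hhom t ht) (hρhom t ht) (hmem t ht)) 
    (fun i => (congrFun hz i : S' (α 0 i) = a₀ i).symm ▸ ha₀ i) t ht

end Field

/-! ### The exterior derivative on a vector space -/

section AltSum

set_option linter.unusedSectionVars false

variable {V V' : Type*} [AddCommGroup V] [Module ℝ V] [FiniteDimensional ℝ V]
  [AddCommGroup V'] [Module ℝ V'] [FiniteDimensional ℝ V']

/-- The antisymmetrization `∑ₖ eᵏ ∧ T(eₖ)` of a linear map `T : V → ⋀ V*`. -/
def altSum (T : V → Lam V) : Lam V :=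
  ∑ k, ExteriorAlgebra.ι ℝ ((Module.finBasis ℝ V).coord k) * T (Module.finBasis ℝ V k)

theorem ι_comp_eq_sum (θ : Module.Dual ℝ V) :
    (ExteriorAlgebra.ι ℝ θ : Lam V) = ∑ k, θ (Module.finBasis ℝ V k) •
      ExteriorAlgebra.ι ℝ ((Module.finBasis ℝ V).coord k) := by
  have h : θ = ∑ k, θ (Module.finBasis ℝ V k) • (Module.finBasis ℝ V).coord k := by
    refine (Module.finBasis ℝ V).ext fun j => ?_
    simp
  conv_lhs => rw [h]
  rw [map_sum]
  simp only [map_smul]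

theorem apply_eq_sum {Y : Type*} [AddCommGroup Y] [Module ℝ Y] (T : V →ₗ[ℝ] Y) (v : V) :
    T v = ∑ k, (Module.finBasis ℝ V).coord k v • T (Module.finBasis ℝ V k) := by
  conv_lhs => rw [← (Module.finBasis ℝ V).sum_repr v, map_sum]
  simp only [map_smul]
  rfl

theorem pull_altSum (L : V →ₗ[ℝ] V') (T : V' →ₗ[ℝ] Lam V') :
    pull L (altSum T) = altSum fun v => pull L (T (L v)) := by
  have h : ∀ k, pull L (T (L (Module.finBasis ℝ V k))) = ∑ l,
      (Module.finBasis ℝ V').coord l (L (Module.finBasis ℝ V k)) •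
        pull L (T (Module.finBasis ℝ V' l)) := fun k => by
    rw [apply_eq_sum T, map_sum]
    simp only [map_smul]
  rw [altSum, altSum, map_sum]
  simp only [h, map_mul, pull_ι, Finset.mul_sum]
  rw [Finset.sum_comm]
  refine Finset.sum_congr rfl fun l _ => ?_
  rw [ι_comp_eq_sum, Finset.sum_mul]
  refine Finset.sum_congr rfl fun k _ => ?_
  rw [smul_mul_assoc, mul_smul_comm]
  rfl

theorem contract_altSum (v : V) (T : V →ₗ[ℝ] Lam V) :
    contract v (altSum T) = T v - altSum fun w => contract v (T w) := by
  rw [altSum, altSum, map_sum, apply_eq_sum T v, ← Finset.sum_sub_distrib]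
  exact Finset.sum_congr rfl fun k _ => contract_ι_mul _ _ _

theorem altSum_add (T T' : V → Lam V) : altSum (fun v => T v + T' v) = altSum T + altSum T' := by
  simp only [altSum, mul_add, Finset.sum_add_distrib]

theorem altSum_sub (T T' : V → Lam V) : altSum (fun v => T v - T' v) = altSum T - altSum T' := by
  simp only [altSum, mul_sub, Finset.sum_sub_distrib]

theorem altSum_zero : altSum (fun _ : V => 0) = 0 := by
  simp [altSum]

theorem altSum_sum_mul {J : Type*} (s : Finset J) (T : J → V → Lam V) (c : J → Lam V) :
    altSum (fun v => ∑ j ∈ s, T j v * c j) = ∑ j ∈ s, altSum (T j) * c j := by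
  simp only [altSum, Finset.mul_sum, Finset.sum_mul, mul_assoc]
  rw [Finset.sum_comm]

theorem altSum_mul (T : V → Lam V) (c : Lam V) : altSum (fun v => T v * c) = altSum T * c := by
  simp only [altSum, Finset.sum_mul, mul_assoc]

theorem altSum_ι_mul (θ : Module.Dual ℝ V) (T : V → Lam V) :
    altSum (fun v => ExteriorAlgebra.ι ℝ θ * T v) = -(ExteriorAlgebra.ι ℝ θ * altSum T) := by
  simp only [altSum, Finset.mul_sum, ← Finset.sum_neg_distrib]
  refine Finset.sum_congr rfl fun k _ => ?_
  rw [← mul_assoc, ← mul_assoc, ← neg_mul,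
    eq_neg_of_add_eq_zero_left (ExteriorAlgebra.ι_add_mul_swap _ _)]

theorem altSum_mem {n : ℕ} {T : V → Lam V} (hT : ∀ v, T v ∈ ⋀[ℝ]^n (Module.Dual ℝ V)) :
    altSum T ∈ ⋀[ℝ]^(n + 1) (Module.Dual ℝ V) := by
  refine sum_mem fun k _ => ?_
  rw [add_comm]
  exact mul_mem_lam (ι_mem_lam _) (hT _)

/-- Antisymmetrization of a symmetric bilinear map is zero. -/
theorem altSum_altSum_of_symm (B : V → V → Lam V) (hB : ∀ v w, B v w = B w v) :
    altSum (fun v => altSum (B v)) = 0 := by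
  have h : altSum (fun v => altSum (B v)) + altSum (fun v => altSum (B v)) = 0 := by
    simp only [altSum, Finset.mul_sum]
    conv_lhs => arg 2; rw [Finset.sum_comm]
    rw [← Finset.sum_add_distrib]
    refine Finset.sum_eq_zero fun i _ => ?_
    rw [← Finset.sum_add_distrib]
    refine Finset.sum_eq_zero fun j _ => ?_
    rw [hB (Module.finBasis ℝ V j), ← mul_assoc, ← mul_assoc, ← add_mul,
      ExteriorAlgebra.ι_add_mul_swap, zero_mul]
  rw [← two_smul ℝ] at h
  exact (smul_eq_zero.mp h).resolve_left two_ne_zero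

theorem altSum_ι_of_symm (B : V → Module.Dual ℝ V) (hB : ∀ v w, B v w = B w v) :
    altSum (fun v => ExteriorAlgebra.ι ℝ (B v)) = 0 := by
  have h := altSum_altSum_of_symm (fun v w => algebraMap ℝ (Lam V) (B v w))
    (fun v w => by rw [hB])
  rw [← h]
  congr 1
  funext v
  rw [ι_comp_eq_sum, altSum]
  refine Finset.sum_congr rfl fun k _ => ?_
  rw [Algebra.smul_def, Algebra.commutes]

end AltSum

section Flat

set_option linter.unusedSectionVars false

variable {E E' : Type*} [NormedAddCommGroup E] [NormedSpace ℝ E] [FiniteDimensional ℝ E]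
  [NormedAddCommGroup E'] [NormedSpace ℝ E'] [FiniteDimensional ℝ E']

/-- The exterior derivative of a form on a subset of a vector space. -/
def flatD (S : Set E) (α : E → Lam E) (z : E) : Lam E := altSum (fderivWithin ℝ α S z)

theorem contDiff_pull_apply (a : Lam E') :
    ContDiff ℝ ∞ (fun L : E →L[ℝ] E' => pull L.toLinearMap a) := by
  induction a using lam_induction with
  | algebraMap r => simp only [AlgHom.commutes]; exact contDiff_const
  | add x y hx hy => simp only [map_add]; exact hx.add hy
  | ι_mul θ x hx =>
    simp only [map_mul, pull_ι]
    rw [← contDiffOn_univ] at hx ⊢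
    refine contDiffOn_lam_mul ?_ hx
    let Λ : (E →L[ℝ] E') →ₗ[ℝ] Lam E :=
      { toFun := fun L => ExteriorAlgebra.ι ℝ (θ ∘ₗ L.toLinearMap)
        map_add' := fun L L' => by
          rw [ContinuousLinearMap.toLinearMap_add, LinearMap.comp_add, map_add]
        map_smul' := fun c L => by
          rw [ContinuousLinearMap.toLinearMap_smul, LinearMap.comp_smul, map_smul]
          rfl }
    exact contDiffOn_linearMap_comp Λ contDiffOn_id

theorem pull_eq_sum (L : E →ₗ[ℝ] E') (a : Lam E') :
    pull L a = ∑ k, (Module.finBasis ℝ (Lam E')).coord k a •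
      pull L (Module.finBasis ℝ (Lam E') k) :=
  apply_eq_sum (pull L).toLinearMap a

/-- The derivative of the pullback of a constant along a symmetric family has vanishing
antisymmetrization. -/
theorem altSum_deriv_pull {S : Set E} {z : E} (hS : UniqueDiffWithinAt ℝ S z)
    {J : E → E →L[ℝ] E'} {J' : E →L[ℝ] E →L[ℝ] E'} (hJ : HasFDerivWithinAt J J' S z)
    (hsymm : ∀ v w, J' v w = J' w v) (a : Lam E') :
    altSum (fderivWithin ℝ (fun y => pull (J y).toLinearMap a) S z) = 0 := by
  have hdiff : ∀ a : Lam E', DifferentiableWithinAt ℝ (fun y => pull (J y).toLinearMap a) S z :=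
    fun a => ((contDiff_pull_apply a).differentiable (by simp) (J z)).comp_differentiableWithinAt z
      hJ.differentiableWithinAt
  induction a using lam_induction with
  | algebraMap r =>
    simp only [AlgHom.commutes, fderivWithin_fun_const]
    exact altSum_zero
  | add x y hx hy =>
    simp only [map_add]
    rw [fderivWithin_fun_add hS (hdiff x) (hdiff y)]
    have := altSum_add (fderivWithin ℝ (fun y => pull (J y).toLinearMap x) S z)
      (fderivWithin ℝ (fun w => pull (J w).toLinearMap y) S z)
    rw [hx, hy, add_zero] at this
    exact this
  | ι_mul θ x hx =>
    let Λ : (E →L[ℝ] E') →ₗ[ℝ] Lam E :=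
      { toFun := fun L => ExteriorAlgebra.ι ℝ (θ ∘ₗ L.toLinearMap)
        map_add' := fun L L' => by
          rw [ContinuousLinearMap.toLinearMap_add, LinearMap.comp_add, map_add]
        map_smul' := fun c L => by
          rw [ContinuousLinearMap.toLinearMap_smul, LinearMap.comp_smul, map_smul]
          rfl }
    have h1 := hasFDerivWithinAt_lam_mul (hasFDerivWithinAt_linearMap_comp Λ hJ)
      (hdiff x).hasFDerivWithinAt
    have h2 : (fun y => pull (J y).toLinearMap (ExteriorAlgebra.ι ℝ θ * x)) =
        fun y => Λ (J y) * pull (J y).toLinearMap x := by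
      funext y
      rw [map_mul, pull_ι]
      rfl
    rw [h2, h1.fderivWithin hS]
    have h4 : altSum (fun v => Λ (J z) * fderivWithin ℝ (fun y => pull (J y).toLinearMap x) S z v +
        Λ (J' v) * pull (J z).toLinearMap x) = 0 := by
      rw [altSum_add, altSum_mul]
      have h5 : altSum (fun v => Λ (J' v)) = 0 :=
        altSum_ι_of_symm (fun v => θ ∘ₗ (J' v).toLinearMap) fun v w => by
          change θ (J' v w) = θ (J' w v)
          rw [hsymm]
      have h6 : altSum (fun v => Λ (J z) *
          fderivWithin ℝ (fun y => pull (J y).toLinearMap x) S z v) = 0 := by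
        refine (altSum_ι_mul _ _).trans ?_
        rw [hx, mul_zero, neg_zero]
      rw [h5, h6, zero_mul, add_zero]
    exact h4

/-- The exterior derivative commutes with pullback. -/
theorem flatD_pull {S : Set E} {S' : Set E'} {z : E} (hS : UniqueDiffWithinAt ℝ S z)
    {φ : E → E'} (hmaps : MapsTo φ S S')
    {J : E → E →L[ℝ] E'} {J' : E →L[ℝ] E →L[ℝ] E'} (hφ : HasFDerivWithinAt φ (J z) S z)
    (hJ : HasFDerivWithinAt J J' S z) (hsymm : ∀ v w, J' v w = J' w v) {α : E' → Lam E'}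
    (hα : DifferentiableWithinAt ℝ α S' (φ z)) :
    flatD S (fun y => pull (J y).toLinearMap (α (φ y))) z =
      pull (J z).toLinearMap (flatD S' α (φ z)) := by
  have hdiff : ∀ a : Lam E', DifferentiableWithinAt ℝ (fun y => pull (J y).toLinearMap a) S z :=
    fun a => ((contDiff_pull_apply a).differentiable (by simp) (J z)).comp_differentiableWithinAt z
      hJ.differentiableWithinAt
  have hcomp : HasFDerivWithinAt (fun y => α (φ y)) ((fderivWithin ℝ α S' (φ z)).comp (J z)) S z :=
    hα.hasFDerivWithinAt.comp z hφ hmaps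
  set b := Module.finBasis ℝ (Lam E')
  have hder : ∀ v, fderivWithin ℝ (fun y => pull (J y).toLinearMap (α (φ y))) S z v =
      pull (J z).toLinearMap (fderivWithin ℝ α S' (φ z) (J z v)) +
        fderivWithin ℝ (fun y => pull (J y).toLinearMap (α (φ z))) S z v := by
    intro v
    have e1 : (fun y => pull (J y).toLinearMap (α (φ y))) = fun y => ∑ k,
        b.coord k (α (φ y)) • pull (J y).toLinearMap (b k) := funext fun x => pull_eq_sum _ _
    have e2 : (fun y => pull (J y).toLinearMap (α (φ z))) = fun y => ∑ k,
        b.coord k (α (φ z)) • pull (J y).toLinearMap (b k) := funext fun x => pull_eq_sum _ _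
    have d1 := HasFDerivWithinAt.fun_sum (u := Finset.univ) fun k _ =>
      (hasFDerivWithinAt_linearMap_comp (b.coord k) hcomp).fun_smul (hdiff (b k)).hasFDerivWithinAt
    have d2 := HasFDerivWithinAt.fun_sum (u := Finset.univ) fun k _ =>
      (hdiff (b k)).hasFDerivWithinAt.fun_const_smul (b.coord k (α (φ z)))
    rw [e1, e2, d1.fderivWithin hS, d2.fderivWithin hS, pull_eq_sum (J z).toLinearMap]
    simp only [sum_apply, add_apply, smul_apply,
      ContinuousLinearMap.smulRight_apply, ContinuousLinearMap.comp_apply,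
      LinearMap.coe_toContinuousLinearMap', Finset.sum_add_distrib]
    rw [add_comm]
  have h1 : flatD S (fun y => pull (J y).toLinearMap (α (φ y))) z = altSum fun v =>
      pull (J z).toLinearMap (fderivWithin ℝ α S' (φ z) (J z v)) +
        fderivWithin ℝ (fun y => pull (J y).toLinearMap (α (φ z))) S z v := by
    rw [flatD]
    congr 1
    exact funext hder
  rw [h1, altSum_add, altSum_deriv_pull hS hJ hsymm, add_zero, flatD]
  exact (pull_altSum (J z).toLinearMap (fderivWithin ℝ α S' (φ z)).toLinearMap).symm

theorem contDiffOn_flatD {S : Set E} (hS : UniqueDiffOn ℝ S) {α : E → Lam E}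
    (hα : ContDiffOn ℝ ∞ α S) : ContDiffOn ℝ ∞ (flatD S α) S :=
by
  unfold flatD altSum
  exact ContDiffOn.sum fun _ _ => contDiffOn_lam_mul contDiffOn_const
    ((hα.fderivWithin (m := ∞) hS (by simp)).clm_apply contDiffOn_const)

theorem flatD_flatD {S : Set E} (hS : UniqueDiffOn ℝ S) {α : E → Lam E}
    (hα : ContDiffOn ℝ ∞ α S) {z : E} (hz : z ∈ S) (hzi : z ∈ closure (interior S)) :
    flatD S (flatD S α) z = 0 := by
  have hd : ContDiffOn ℝ ∞ (fderivWithin ℝ α S) S := hα.fderivWithin hS (by simp)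
  have hdz : HasFDerivWithinAt (fderivWithin ℝ α S)
      (fderivWithin ℝ (fderivWithin ℝ α S) S z) S z :=
    ((hd z hz).differentiableWithinAt (by simp)).hasFDerivWithinAt
  have hsymm : IsSymmSndFDerivWithinAt ℝ α S z :=
    (hα z hz).isSymmSndFDerivWithinAt (by simpa using (WithTop.coe_le_coe.mpr le_top : ((2 : ℕ∞) : WithTop ℕ∞) ≤ ∞)) hS hzi hz
  have h1 : ∀ v, fderivWithin ℝ (flatD S α) S z v =
      altSum fun w => fderivWithin ℝ (fderivWithin ℝ α S) S z v w := by
    intro v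
    have h2 : HasFDerivWithinAt (flatD S α) (∑ k, (mulL E (ExteriorAlgebra.ι ℝ
        ((Module.finBasis ℝ E).coord k))).comp ((ContinuousLinearMap.apply ℝ (Lam E)
          (Module.finBasis ℝ E k)).comp (fderivWithin ℝ (fderivWithin ℝ α S) S z))) S z := by
      unfold flatD altSum
      exact HasFDerivWithinAt.fun_sum fun k _ => (mulL E (ExteriorAlgebra.ι ℝ
        ((Module.finBasis ℝ E).coord k))).hasFDerivAt.comp_hasFDerivWithinAt z
          ((ContinuousLinearMap.apply ℝ (Lam E)
            (Module.finBasis ℝ E k)).hasFDerivAt.comp_hasFDerivWithinAt z hdz)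
    rw [h2.fderivWithin (hS z hz)]
    simp [altSum]
  rw [flatD]
  have h3 : (fderivWithin ℝ (flatD S α) S z : E → Lam E) = fun v =>
      altSum fun w => fderivWithin ℝ (fderivWithin ℝ α S) S z v w := funext h1
  rw [h3]
  exact altSum_altSum_of_symm _ fun v w => hsymm.eq v w

end Flat

/-! ### Forms in charts -/

section Charts

set_option linter.unusedSectionVars false

variable {E : Type*} [NormedAddCommGroup E] [NormedSpace ℝ E] [FiniteDimensional ℝ E]
  {H : Type*} [TopologicalSpace H] (I : ModelWithCorners ℝ E H)
  {M : Type*} [TopologicalSpace M] [ChartedSpace H M]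

/-- The image of `s` in the preferred chart at `p₀`. -/
def chartSet (p₀ : M) (s : Set M) : Set E :=
  (extChartAt I p₀).target ∩ (extChartAt I p₀).symm ⁻¹' s

theorem extD_eq_flatD (s : Set M) (α : M → Lam E) (p : M) :
    extD I s α p = flatD (chartSet I p s) (inChart I p α) (extChartAt I p p) := by
  have h : fderivWithin ℝ (inChart I p α) (range I ∩ (extChartAt I p).symm ⁻¹' s)
      (extChartAt I p p) = fderivWithin ℝ (inChart I p α) (chartSet I p s) (extChartAt I p p) :=
    fderivWithin_congr_set ((extChartAt_target_eventuallyEq (I := I) (x := p)).symm.inter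
      Filter.EventuallyEq.rfl)
  rw [extD, h]
  rfl

variable [IsManifold I ∞ M]

theorem inChart_apply {p₀ q : M} (hq : q ∈ (extChartAt I p₀).source) (α : M → Lam E) :
    inChart I p₀ α (extChartAt I p₀ q) = pull (tangentCoordChange I p₀ q q).toLinearMap (α q) := by
  rw [inChart, (extChartAt I p₀).left_inv hq]
  rfl

theorem inChart_apply_symm {p₀ : M} {y : E} (hy : y ∈ (extChartAt I p₀).target) (α : M → Lam E) :
    inChart I p₀ α y = pull (tangentCoordChange I p₀ ((extChartAt I p₀).symm y)
      ((extChartAt I p₀).symm y)).toLinearMap (α ((extChartAt I p₀).symm y)) := by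
  conv_lhs => rw [← (extChartAt I p₀).right_inv hy]
  exact inChart_apply I ((extChartAt I p₀).map_target hy) α

theorem tangentCoordChange_self_eq_id (p : M) : tangentCoordChange I p p p = .id ℝ E :=
  ContinuousLinearMap.ext fun _ => tangentCoordChange_self (mem_extChartAt_source p)

theorem inChart_eq_pull_inChart {p₀ p q : M} (hq : q ∈ (extChartAt I p₀).source)
    (hq' : q ∈ (extChartAt I p).source) (α : M → Lam E) :
    inChart I p₀ α (extChartAt I p₀ q) =
      pull (tangentCoordChange I p₀ p q).toLinearMap (inChart I p α (extChartAt I p q)) := by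
  rw [inChart_apply I hq, inChart_apply I hq', pull_pull]
  congr 2
  ext v
  exact (tangentCoordChange_comp ⟨⟨hq, hq'⟩, mem_extChartAt_source q⟩).symm

/-- The exterior derivative can be computed in any chart. -/
theorem inChart_extD {s : Set M} {α : M → Lam E} (hα : SmoothFormOn I s α) {p₀ : M}
    (hs : UniqueDiffOn ℝ (chartSet I p₀ s)) {y : E} (hy : y ∈ chartSet I p₀ s) :
    inChart I p₀ (extD I s α) y = flatD (chartSet I p₀ s) (inChart I p₀ α) y := by
  obtain ⟨q, hq, hqs, rfl⟩ : ∃ q ∈ (extChartAt I p₀).source, q ∈ s ∧ extChartAt I p₀ q = y :=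
    ⟨_, (extChartAt I p₀).map_target hy.1, hy.2, (extChartAt I p₀).right_inv hy.1⟩
  rw [inChart_apply I hq, extD_eq_flatD]
  set z := extChartAt I p₀ q with hz
  set τ : E → E := extChartAt I q ∘ (extChartAt I p₀).symm with hτ
  set S : Set E := chartSet I p₀ s ∩ (extChartAt I p₀).symm ⁻¹' (extChartAt I q).source with hS
  have hψ : (extChartAt I p₀).symm z = q := (extChartAt I p₀).left_inv hq
  have hτz : τ z = extChartAt I q q := by rw [hτ, Function.comp_apply, hψ]
  have hsrc : (extChartAt I p₀).symm ⁻¹' (extChartAt I q).source ∈ nhds z :=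
    extChartAt_preimage_mem_nhds' hq (extChartAt_source_mem_nhds q)
  have hSz : S =ᶠ[nhds z] chartSet I p₀ s :=
    Filter.eventuallyEq_set.mpr <| Filter.mem_of_superset hsrc fun w hw =>
      ⟨fun h => h.1, fun h => ⟨h, hw⟩⟩
  have hSr : S ⊆ range I := fun w hw => extChartAt_target_subset_range p₀ hw.1.1
  have hzS : z ∈ S := ⟨hy, by rw [mem_preimage, hψ]; exact mem_extChartAt_source q⟩
  have hSU : UniqueDiffWithinAt ℝ S z := by
    rw [uniqueDiffWithinAt_congr (nhdsWithin_eq_iff_eventuallyEq.mpr hSz)]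
    exact hs z hy
  have hτC : ContDiffWithinAt ℝ ∞ τ (range I) z := by
    refine contDiffWithinAt_ext_coord_change q p₀ ?_
    rw [PartialEquiv.trans_source'', PartialEquiv.symm_symm, PartialEquiv.symm_target]
    exact mem_image_of_mem _ ⟨hq, mem_extChartAt_source q⟩
  have hJ : HasFDerivWithinAt (fderivWithin ℝ τ (range I))
      (fderivWithin ℝ (fderivWithin ℝ τ (range I)) (range I) z) (range I) z :=
    ((hτC.fderivWithin_right (m := ∞) I.uniqueDiffOn (by simp) (hSr hzS)).differentiableWithinAt
      (by simp)).hasFDerivWithinAt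
  have hsymm : IsSymmSndFDerivWithinAt ℝ τ (range I) z :=
    hτC.isSymmSndFDerivWithinAt
      (by simpa using (WithTop.coe_le_coe.mpr le_top : ((2 : ℕ∞) : WithTop ℕ∞) ≤ ∞))
      I.uniqueDiffOn (I.range_subset_closure_interior (hSr hzS)) (hSr hzS)
  have hmaps : MapsTo τ S (chartSet I q s) := fun w hw =>
    ⟨(extChartAt I q).map_source hw.2, by
      rw [mem_preimage, hτ, Function.comp_apply, (extChartAt I q).left_inv hw.2]
      exact hw.1.2⟩
  have hαq : DifferentiableWithinAt ℝ (inChart I q α) (chartSet I q s) (τ z) :=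
    (hα q (τ z) (hmaps hzS)).differentiableWithinAt (by simp)
  have key := flatD_pull hSU hmaps
    (((hτC.differentiableWithinAt (by simp)).hasFDerivWithinAt).mono hSr) (hJ.mono hSr)
    (fun v w => hsymm.eq v w) hαq
  have hcongr : ∀ w ∈ S, inChart I p₀ α w =
      pull (fderivWithin ℝ τ (range I) w).toLinearMap (inChart I q α (τ w)) := fun w hw => by
    have h := inChart_eq_pull_inChart I ((extChartAt I p₀).map_target hw.1.1) hw.2 α
    rw [tangentCoordChange_def, (extChartAt I p₀).right_inv hw.1.1] at h
    exact h
  have hlast : flatD (chartSet I p₀ s) (inChart I p₀ α) z = flatD S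
      (fun w => pull (fderivWithin ℝ τ (range I) w).toLinearMap (inChart I q α (τ w))) z := by
    rw [flatD, flatD, ← fderivWithin_congr_set hSz, fderivWithin_congr hcongr (hcongr z hzS)]
  rw [hlast, key, hτz]
  rfl

/-- The derivative of a homogeneous form is homogeneous. -/
theorem fderivWithin_homog {X : Type*} [NormedAddCommGroup X] [NormedSpace ℝ X] {S : Set X} {n : ℕ}
    {α : X → Lam E} {z : X} (hS : UniqueDiffWithinAt ℝ S z) (hz : z ∈ S)
    (hα : ∀ w ∈ S, α w ∈ ⋀[ℝ]^n (Module.Dual ℝ E)) (v : X) :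
    fderivWithin ℝ α S z v ∈ ⋀[ℝ]^n (Module.Dual ℝ E) := by
  by_cases hd : DifferentiableWithinAt ℝ α S z
  · have h1 := hasFDerivWithinAt_linearMap_comp (projDeg n) hd.hasFDerivWithinAt
    have h2 : fderivWithin ℝ (fun w => projDeg n (α w)) S z = fderivWithin ℝ α S z :=
      fderivWithin_congr (fun w hw => projDeg_of_mem (hα w hw)) (projDeg_of_mem (hα z hz))
    rw [← h2, h1.fderivWithin hS]
    exact projDeg_mem _ _
  · rw [fderivWithin_zero_of_not_differentiableWithinAt hd]
    exact zero_mem _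

theorem flatD_homog {S : Set E} {n : ℕ} {α : E → Lam E} {z : E} (hS : UniqueDiffWithinAt ℝ S z)
    (hz : z ∈ S) (hα : ∀ w ∈ S, α w ∈ ⋀[ℝ]^n (Module.Dual ℝ E)) :
    flatD S α z ∈ ⋀[ℝ]^(n + 1) (Module.Dual ℝ E) :=
  altSum_mem (fderivWithin_homog hS hz hα)

theorem extChartAt_mem_chartSet {p : M} {s : Set M} (hp : p ∈ s) :
    extChartAt I p p ∈ chartSet I p s :=
  ⟨mem_extChartAt_target p, by rwa [mem_preimage, extChartAt_to_inv]⟩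

theorem chartSet_univ (p : M) : chartSet I p univ = (extChartAt I p).target := by
  rw [chartSet, preimage_univ, inter_univ]

theorem locallyConvex_extChartAt_target (x : M) (y : E) (hy : y ∈ (extChartAt I x).target) :
    ∃ r > 0, Convex ℝ ((extChartAt I x).target ∩ Metric.ball y r) := by
  have h : I.symm ⁻¹' (chartAt H x).target ∈ nhds y :=
    ((chartAt H x).open_target.preimage I.continuous_symm).mem_nhds
      (by rw [extChartAt_target] at hy; exact hy.1)
  obtain ⟨r, hr, hball⟩ := Metric.mem_nhds_iff.mp h
  refine ⟨r, hr, ?_⟩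
  have e : (extChartAt I x).target ∩ Metric.ball y r = range I ∩ Metric.ball y r := by
    rw [extChartAt_target]
    ext w
    exact ⟨fun h => ⟨h.1.2, h.2⟩, fun h => ⟨⟨hball h.2, h.1⟩, h.2⟩⟩
  rw [e]
  exact I.convex_range.inter (convex_ball y r)

end Charts

/-! ### The Maurer-Cartan equation on `P × [0,ε]`, `P` a subset of a vector space -/

section FlatCylinder

set_option linter.unusedSectionVars false

variable {E : Type*} [NormedAddCommGroup E] [NormedSpace ℝ E] [FiniteDimensional ℝ E]
  {ι : Type*} {deg : ι → ℕ} [Fintype ι] [DecidableEq ι] {U : Opens (Base deg)}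
  {P : Set E} {ε : ℝ}

local notation "inlE" => LinearMap.inl ℝ E ℝ

theorem fderivWithin_linear {X Y Z : Type*} [NormedAddCommGroup X] [NormedSpace ℝ X]
    [NormedAddCommGroup Y] [NormedSpace ℝ Y] [FiniteDimensional ℝ Y] [NormedAddCommGroup Z]
    [NormedSpace ℝ Z] (L : Y →ₗ[ℝ] Z) {S : Set X} {z : X} (hS : UniqueDiffWithinAt ℝ S z)
    {α : X → Y} (hα : DifferentiableWithinAt ℝ α S z) (v : X) :
    fderivWithin ℝ (fun w => L (α w)) S z v = L (fderivWithin ℝ α S z v) := by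
  rw [(hasFDerivWithinAt_linearMap_comp L hα.hasFDerivWithinAt).fderivWithin hS]
  rfl

/-- Cartan's formula for `i_{∂_t} d`. -/
theorem vert_flatD {S : Set (E × ℝ)} {z : E × ℝ} (hS : UniqueDiffWithinAt ℝ S z)
    {α : E × ℝ → Lam (E × ℝ)} (hα : DifferentiableWithinAt ℝ α S z) :
    vert (flatD S α z) = fderivWithin ℝ α S z (0, 1) - flatD S (fun w => vert (α w)) z := by
  refine (contract_altSum _ (fderivWithin ℝ α S z).toLinearMap).trans ?_
  rw [flatD, show (fderivWithin ℝ (fun w => vert (α w)) S z : E × ℝ → Lam (E × ℝ)) =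
    fun v => vert (fderivWithin ℝ α S z v) from funext fun v => fderivWithin_linear vert hS hα v]
  rfl

theorem hasDerivWithinAt_time {X : Type*} [NormedAddCommGroup X] [NormedSpace ℝ X]
    {α : E × ℝ → X} {y : E} {t : ℝ} (hy : y ∈ P)
    (hα : DifferentiableWithinAt ℝ α (P ×ˢ Icc 0 ε) (y, t)) :
    HasDerivWithinAt (fun s => α (y, s)) (fderivWithin ℝ α (P ×ˢ Icc 0 ε) (y, t) (0, 1))
      (Icc 0 ε) t := by
  have h : HasDerivWithinAt (fun s : ℝ => (y, s)) ((0 : E), (1 : ℝ)) (Icc 0 ε) t :=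
    (hasDerivWithinAt_const t _ y).prodMk (hasDerivWithinAt_id t _)
  exact hα.hasFDerivWithinAt.comp_hasDerivWithinAt t h fun s hs => ⟨hy, hs⟩

theorem pull_inl_flatD (hP : UniqueDiffOn ℝ P) {α : E × ℝ → Lam (E × ℝ)} {y : E} {t : ℝ}
    (hy : y ∈ P) (ht : t ∈ Icc 0 ε)
    (hα : DifferentiableWithinAt ℝ α (P ×ˢ Icc 0 ε) (y, t)) :
    pull inlE (flatD (P ×ˢ Icc 0 ε) α (y, t)) = flatD P (fun w => pull inlE (α (w, t))) y :=
  (flatD_pull (φ := fun w => (w, t)) (J := fun _ => ContinuousLinearMap.inl ℝ E ℝ) (J' := 0)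
    (S' := P ×ˢ Icc 0 ε) (hP y hy) (fun _ hw => ⟨hw, ht⟩)
    ((hasFDerivWithinAt_id y P).prodMk (hasFDerivWithinAt_const t y P))
    (hasFDerivWithinAt_const _ y P) (fun _ _ => rfl) hα).symm

/-- The curvature `dA - F_Q(A)`. -/
def curv (Q : Differential deg U) (S : Set E) (A : ι → E → Lam E) (i : ι) (z : E) : Lam E :=
  flatD S (A i) z - substT (Q.F i) (fun j => A j z)

theorem vert_substT {a : ι → Lam (E × ℝ)} (ha : ∀ i, a i ∈ ⋀[ℝ]^(deg i) (Module.Dual ℝ (E × ℝ)))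
    (haU : a ∈ fiberDom U (E × ℝ)) (F : FnAlg deg U) :
    vert (substT F a) = ∑ i, vert (a i) * substT (partialGen i F) a := by
  let c : FiberPt deg U (E × ℝ) := ⟨a, ha, (mem_fiberDom_of_homog ha).mp haU⟩
  have h := vert_subst c F
  simp only [← substT_comp] at h
  exact h

theorem pull_inl_vert_curv (Q : Differential deg U) {S : Set (E × ℝ)} {z : E × ℝ}
    (hS : UniqueDiffWithinAt ℝ S z) {A : ι → E × ℝ → Lam (E × ℝ)}
    (hA : ∀ i, DifferentiableWithinAt ℝ (A i) S z)
    (hh : ∀ i, A i z ∈ ⋀[ℝ]^(deg i) (Module.Dual ℝ (E × ℝ)))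
    (hU : (fun i => A i z) ∈ fiberDom U (E × ℝ)) (i : ι) :
    pull inlE (vert (curv Q S A i z)) = pull inlE (fderivWithin ℝ (A i) S z (0, 1)) -
      mcField Q (fun j => pull inlE (vert (A j z)))
        (fun j => pull inlE (flatD S (fun w => vert (A j w)) z)) (fun j => pull inlE (A j z)) i := by
  rw [curv, map_sub, vert_flatD hS (hA i), vert_substT hh hU, mcField]
  simp only [map_sub, map_sum, map_mul, pull_substT]
  rw [sub_sub]

theorem vert_vert_curv (Q : Differential deg U) (S : Set (E × ℝ)) (A : ι → E × ℝ → Lam (E × ℝ))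
    (i : ι) (z : E × ℝ) (h : pull inlE (vert (curv Q S A i z)) = 0) :
    vert (curv Q S A i z) = 0 := by
  refine (eq_pull_of_vert_eq_zero (vert_vert (E := E) (curv Q S A i z))).trans ?_
  rw [h, map_zero]

/-- The Bianchi identity `dZ^i = - ∑ Z^j ∂_j F_Q^i (A)` for the curvature `Z` of `A`. -/
theorem flatD_curv (Q : Differential deg U) {S : Set E} (hS : UniqueDiffOn ℝ S)
    {A : ι → E → Lam E} (hA : ∀ i, ContDiffOn ℝ ∞ (A i) S)
    (hh : ∀ z ∈ S, ∀ i, A i z ∈ ⋀[ℝ]^(deg i) (Module.Dual ℝ E))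
    (hU : ∀ z ∈ S, (fun i => A i z) ∈ fiberDom U E) {z : E} (hz : z ∈ S)
    (hzi : z ∈ closure (interior S)) (i : ι) :
    flatD S (curv Q S A i) z =
      -∑ j, curv Q S A j z * substT (partialGen j (Q.F i)) (fun k => A k z) := by
  have hd1 := (((contDiffOn_flatD hS (hA i)) z hz).differentiableWithinAt
    (by simp)).hasFDerivWithinAt
  have hA' : ∀ j, HasFDerivWithinAt (A j) (fderivWithin ℝ (A j) S z) S z := fun j =>
    ((hA j z hz).differentiableWithinAt (by simp)).hasFDerivWithinAt
  have hd := hd1.sub (hasFDerivWithinAt_substT (Q.F i) hA' (hU z hz))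
  have e1 : (fderivWithin ℝ (curv Q S A i) S z : E → Lam E) = fun v =>
      fderivWithin ℝ (flatD S (A i)) S z v - ∑ j, fderivWithin ℝ (A j) S z v *
        substT (partialGen j (Q.F i)) (fun k => A k z) := by
    funext v
    have e2 := hd.fderivWithin (hS z hz)
    have e3 : fderiv ℝ (substT (Q.F i)) (fun k => A k z) (fun j => fderivWithin ℝ (A j) S z v) =
        ∑ j, fderivWithin ℝ (A j) S z v * substT (partialGen j (Q.F i)) (fun k => A k z) := by
      rw [fderiv_substT _ (hU z hz)]
      refine Finset.sum_congr rfl fun j _ => ?_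
      rw [projDeg_of_mem (fderivWithin_homog (hS z hz) hz (fun w hw => hh w hw j) v)]
    rw [← e3]
    exact congrArg (fun L => L v) e2
  rw [flatD, e1, altSum_sub, altSum_sum_mul]
  have e4 : altSum (fun v => fderivWithin ℝ (flatD S (A i)) S z v) = 0 :=
    flatD_flatD hS (hA i) hz hzi
  rw [e4, zero_sub, neg_inj]
  let c : FiberPt deg U E := ⟨fun k => A k z, hh z hz, (mem_fiberDom_of_homog (hh z hz)).mp (hU z hz)⟩
  have e5 := sum_subst_F_mul c Q i
  simp only [← substT_comp] at e5
  simp only [curv, sub_mul, Finset.sum_sub_distrib]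
  refine (sub_eq_self.mpr ?_).symm
  exact e5

theorem curv_eq_zero (Q : Differential deg U) (hε : 0 < ε) (hP : UniqueDiffOn ℝ P)
    (hPi : P ⊆ closure (interior P)) {A : ι → E × ℝ → Lam (E × ℝ)}
    (hA : ∀ i, ContDiffOn ℝ ∞ (A i) (P ×ˢ Icc 0 ε))
    (hh : ∀ z ∈ P ×ˢ Icc 0 ε, ∀ i, A i z ∈ ⋀[ℝ]^(deg i) (Module.Dual ℝ (E × ℝ)))
    (hU : ∀ z ∈ P ×ˢ Icc 0 ε, (fun i => A i z) ∈ fiberDom U (E × ℝ))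
    (hv : ∀ z ∈ P ×ˢ Icc 0 ε, ∀ i, vert (curv Q (P ×ˢ Icc 0 ε) A i z) = 0)
    (h0 : ∀ y ∈ P, ∀ i, curv Q (P ×ˢ Icc 0 ε) A i (y, 0) = 0) :
    ∀ z ∈ P ×ˢ Icc 0 ε, ∀ i, curv Q (P ×ˢ Icc 0 ε) A i z = 0 := by
  rintro ⟨y, t⟩ ⟨hy, ht⟩ i
  set S : Set (E × ℝ) := P ×ˢ Icc 0 ε with hSdef
  have hS : UniqueDiffOn ℝ S := hP.prod (uniqueDiffOn_Icc hε)
  have hSi : S ⊆ closure (interior S) := by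
    rw [hSdef, interior_prod_eq, closure_prod_eq, interior_Icc, closure_Ioo hε.ne]
    exact prod_mono hPi le_rfl
  have hAS : ContDiffOn ℝ ∞ (fun z k => A k z) S := contDiffOn_pi.mpr hA
  have hsub : ∀ F : FnAlg deg U, ContDiffOn ℝ ∞ (fun z => substT F (fun k => A k z)) S :=
    fun F => (contDiffOn_substT F).comp hAS hU
  have hZ : ∀ i, ContDiffOn ℝ ∞ (curv Q S A i) S := fun i =>
    (contDiffOn_flatD hS (hA i)).sub (hsub _)
  have hder : ∀ s ∈ Icc 0 ε, ∀ i, HasDerivWithinAt (fun s => curv Q S A i (y, s))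
      (-vert (∑ j, curv Q S A j (y, s) * substT (partialGen j (Q.F i)) (fun k => A k (y, s))))
      (Icc 0 ε) s := fun s hs i => by
    have hz : (y, s) ∈ S := ⟨hy, hs⟩
    have hdz := (hZ i (y, s) hz).differentiableWithinAt (by simp)
    have h1 := hasDerivWithinAt_time hy hdz
    have h2 := vert_flatD (hS _ hz) hdz
    have h3 : flatD S (fun w => vert (E := E) (curv Q S A i w)) (y, s) = 0 := by
      have : fderivWithin ℝ (fun w => vert (E := E) (curv Q S A i w)) S (y, s) = 0 := by
        rw [fderivWithin_congr (f := fun _ => 0) (fun w hw => hv w hw i) (hv _ hz i),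
          fderivWithin_fun_const]
        rfl
      rw [flatD, this]
      exact altSum_zero
    rw [h3, sub_zero, flatD_curv Q hS hA hh hU hz (hSi hz) i, map_neg] at h2
    rw [h2]
    exact h1
  let Φ : ℝ × (ι → Lam (E × ℝ)) → ι → Lam (E × ℝ) := fun p i =>
    -vert (∑ j, p.2 j * substT (partialGen j (Q.F i)) (fun k => A k (y, p.1)))
  have hΦ : ContDiffOn ℝ ∞ Φ (Icc 0 ε ×ˢ univ) := by
    refine contDiffOn_pi.mpr fun i => ContDiffOn.neg ?_
    refine contDiffOn_linearMap_comp (vert (E := E)) ?_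
    refine ContDiffOn.sum fun j _ => contDiffOn_lam_mul ?_ ?_
    · exact ((contDiff_apply ℝ (Lam (E × ℝ)) j).comp contDiff_snd).contDiffOn
    · exact (hsub _).comp (contDiffOn_const.prodMk contDiff_fst.contDiffOn) fun p hp => ⟨hy, hp.1⟩
  have := ODE_unique isOpen_univ hε hΦ (γ := fun _ => 0) (c := fun s i => curv Q S A i (y, s))
    (fun _ _ => mem_univ _)
    (fun s _ => by
      have : Φ (s, 0) = 0 := by
        funext i
        simp [Φ]
      rw [this]
      exact hasDerivWithinAt_const _ _ _)
    (fun s hs => hasDerivWithinAt_pi.mpr fun i => hder s hs i)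
    (funext fun i => h0 y hy i) t ht
  exact congrFun this i

end FlatCylinder

/-! ### Charts of `N × ℝ` -/

section CylinderCharts

set_option linter.unusedSectionVars false

variable {E : Type*} [NormedAddCommGroup E] [NormedSpace ℝ E] [FiniteDimensional ℝ E]
  {H : Type*} [TopologicalSpace H] (I : ModelWithCorners ℝ E H)
  {N : Type*} [TopologicalSpace N] [ChartedSpace H N]

local notation "inlE" => LinearMap.inl ℝ E ℝ
local notation "fstE" => LinearMap.fst ℝ E ℝ

theorem extChartAt_cyl (p : N × ℝ) : extChartAt (I.prod 𝓘(ℝ, ℝ)) p =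
    (extChartAt I p.1).prod (PartialEquiv.refl ℝ) := by
  rw [extChartAt_prod, extChartAt_model_space_eq_id]

theorem extChartAt_cyl_apply (p q : N × ℝ) :
    extChartAt (I.prod 𝓘(ℝ, ℝ)) p q = (extChartAt I p.1 q.1, q.2) := by
  rw [extChartAt_cyl]
  rfl

theorem extChartAt_cyl_symm (p : N × ℝ) (z : E × ℝ) :
    (extChartAt (I.prod 𝓘(ℝ, ℝ)) p).symm z = ((extChartAt I p.1).symm z.1, z.2) := by
  rw [extChartAt_cyl]
  rfl

theorem mem_extChartAt_cyl_target (p : N × ℝ) (z : E × ℝ) :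
    z ∈ (extChartAt (I.prod 𝓘(ℝ, ℝ)) p).target ↔ z.1 ∈ (extChartAt I p.1).target := by
  rw [extChartAt_cyl]
  exact and_iff_left (mem_univ _)

theorem chartSet_cyl (p : N × ℝ) (ε : ℝ) : chartSet (I.prod 𝓘(ℝ, ℝ)) p (cyl N ε) =
    (extChartAt I p.1).target ×ˢ Icc 0 ε := by
  ext z
  rw [chartSet, mem_inter_iff, mem_extChartAt_cyl_target, mem_preimage, extChartAt_cyl_symm]
  exact and_congr_right fun _ => ⟨fun h => h.2, fun h => ⟨mem_univ _, h⟩⟩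

variable [IsManifold I ∞ N]

/-- The derivative at `y` of the inverse of the chart at `x₀`. -/
def jac (x₀ : N) (y : E) : E →ₗ[ℝ] E :=
  (tangentCoordChange I x₀ ((extChartAt I x₀).symm y) ((extChartAt I x₀).symm y)).toLinearMap

/-- The derivative at `(y, t)` of the inverse of the chart of `N × ℝ` given by the chart at `x₀`. -/
def cylJac (x₀ : N) (y : E) : E × ℝ →ₗ[ℝ] E × ℝ := (jac I x₀ y).prodMap LinearMap.id

theorem tangentCoordChange_cyl {p q : N × ℝ} (hq : q.1 ∈ (extChartAt I p.1).source) :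
    tangentCoordChange (I.prod 𝓘(ℝ, ℝ)) p q q =
      (tangentCoordChange I p.1 q.1 q.1).prodMap (.id ℝ ℝ) := by
  have hq' : q ∈ (extChartAt (I.prod 𝓘(ℝ, ℝ)) p).source := by
    rw [extChartAt_cyl]
    exact ⟨hq, mem_univ _⟩
  have h1 := hasFDerivWithinAt_tangentCoordChange (I := I.prod 𝓘(ℝ, ℝ)) (x := p) (y := q) (z := q)
    ⟨hq', mem_extChartAt_source q⟩
  have h2 := hasFDerivWithinAt_tangentCoordChange (I := I) (x := p.1) (y := q.1) (z := q.1)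
    ⟨hq, mem_extChartAt_source q.1⟩
  have hr : range (I.prod 𝓘(ℝ, ℝ)) = range I ×ˢ univ := by
    rw [ModelWithCorners.range_prod]
    simp
  have hu : UniqueDiffWithinAt ℝ (range (I.prod 𝓘(ℝ, ℝ)))
      (extChartAt (I.prod 𝓘(ℝ, ℝ)) p q) := by
    refine (I.prod 𝓘(ℝ, ℝ)).uniqueDiffOn _ ?_
    exact extChartAt_target_subset_range p ((extChartAt (I.prod 𝓘(ℝ, ℝ)) p).map_source hq')
  refine hu.eq h1 ?_
  rw [hr, extChartAt_cyl_apply]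
  have h3 : HasFDerivWithinAt (Prod.map (extChartAt I q.1 ∘ (extChartAt I p.1).symm) (id : ℝ → ℝ))
      ((tangentCoordChange I p.1 q.1 q.1).prodMap (.id ℝ ℝ)) (range I ×ˢ univ)
      (extChartAt I p.1 q.1, q.2) :=
    HasFDerivWithinAt.prodMap (extChartAt I p.1 q.1, q.2)
      (h2.mono (by rintro _ ⟨z, hz, rfl⟩; exact hz.1)) (hasFDerivWithinAt_id q.2 _)
  refine h3.congr_of_eventuallyEq (Filter.Eventually.of_forall fun z => ?_) ?_
  all_goals
    rw [Function.comp_apply, extChartAt_cyl_symm, extChartAt_cyl_apply]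
    rfl

theorem inChart_cyl (p : N × ℝ) {y : E} (hy : y ∈ (extChartAt I p.1).target) (t : ℝ)
    (α : N × ℝ → Lam (E × ℝ)) : inChart (I.prod 𝓘(ℝ, ℝ)) p α (y, t) =
      pull (cylJac I p.1 y) (α ((extChartAt I p.1).symm y, t)) := by
  have hz : (y, t) ∈ (extChartAt (I.prod 𝓘(ℝ, ℝ)) p).target :=
    (mem_extChartAt_cyl_target I p (y, t)).mpr hy
  rw [inChart_apply_symm _ hz, extChartAt_cyl_symm,
    tangentCoordChange_cyl I (q := ((extChartAt I p.1).symm y, t))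
      ((extChartAt I p.1).map_target hy)]
  rfl

theorem pull_inl_cylJac (x₀ : N) (y : E) (β : Lam (E × ℝ)) :
    pull inlE (pull (cylJac I x₀ y) β) = pull (jac I x₀ y) (pull inlE β) := by
  rw [pull_pull, pull_pull]
  congr 2

theorem cylJac_pull_fst (x₀ : N) (y : E) (b : Lam E) :
    pull (cylJac I x₀ y) (pull fstE b) = pull fstE (pull (jac I x₀ y) b) := by
  rw [pull_pull, pull_pull]
  congr 2

theorem vert_cylJac (x₀ : N) (y : E) (β : Lam (E × ℝ)) :
    vert (pull (cylJac I x₀ y) β) = pull (cylJac I x₀ y) (vert β) := by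
  rw [vert, contract_pull]
  congr 2
  simp [cylJac]

theorem cylJac_dt_mul (x₀ : N) (y : E) (β : Lam (E × ℝ)) :
    pull (cylJac I x₀ y) (dt * β) = dt * pull (cylJac I x₀ y) β := by
  rw [map_mul, dt, pull_ι]
  congr 2

theorem jac_self (x : N) : jac I x (extChartAt I x x) = LinearMap.id := by
  rw [jac, extChartAt_to_inv, tangentCoordChange_self_eq_id]
  rfl

theorem inChart_eq_jac {x₀ : N} {y : E} (hy : y ∈ (extChartAt I x₀).target) (α : N → Lam E) :
    inChart I x₀ α y = pull (jac I x₀ y) (α ((extChartAt I x₀).symm y)) :=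
  inChart_apply_symm I hy α

theorem uniqueDiffOn_cylinderChart (x : N) {ε : ℝ} (hε : 0 < ε) :
    UniqueDiffOn ℝ ((extChartAt I x).target ×ˢ Icc 0 ε) :=
  (uniqueDiffOn_extChartAt_target x).prod (uniqueDiffOn_Icc hε)

theorem SmoothFormOn.contDiffOn_cyl {ε : ℝ} {α : N × ℝ → Lam (E × ℝ)}
    (hα : SmoothFormOn (I.prod 𝓘(ℝ, ℝ)) (cyl N ε) α) (p : N × ℝ) :
    ContDiffOn ℝ ∞ (inChart (I.prod 𝓘(ℝ, ℝ)) p α) ((extChartAt I p.1).target ×ˢ Icc 0 ε) := by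
  have h := hα p
  change ContDiffOn ℝ ∞ _ (chartSet (I.prod 𝓘(ℝ, ℝ)) p (cyl N ε)) at h
  rwa [chartSet_cyl] at h

theorem smoothFormOn_cyl_iff {ε : ℝ} {α : N × ℝ → Lam (E × ℝ)} :
    SmoothFormOn (I.prod 𝓘(ℝ, ℝ)) (cyl N ε) α ↔ ∀ x₀ : N, ContDiffOn ℝ ∞
      (fun z : E × ℝ => pull (cylJac I x₀ z.1) (α ((extChartAt I x₀).symm z.1, z.2)))
      ((extChartAt I x₀).target ×ˢ Icc 0 ε) := by
  refine ⟨fun h x₀ => (h.contDiffOn_cyl I (x₀, 0)).congr fun z hz =>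
    (inChart_cyl I (x₀, 0) hz.1 z.2 α).symm, fun h p => ?_⟩
  change ContDiffOn ℝ ∞ _ (chartSet (I.prod 𝓘(ℝ, ℝ)) p (cyl N ε))
  rw [chartSet_cyl]
  exact (h p.1).congr fun z hz => inChart_cyl I p hz.1 z.2 α

theorem inChart_extD_cyl {ε : ℝ} (hε : 0 < ε) {α : N × ℝ → Lam (E × ℝ)}
    (hα : SmoothFormOn (I.prod 𝓘(ℝ, ℝ)) (cyl N ε) α) (p : N × ℝ) {z : E × ℝ}
    (hz : z ∈ (extChartAt I p.1).target ×ˢ Icc 0 ε) :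
    inChart (I.prod 𝓘(ℝ, ℝ)) p (extD (I.prod 𝓘(ℝ, ℝ)) (cyl N ε) α) z =
      flatD ((extChartAt I p.1).target ×ˢ Icc 0 ε) (inChart (I.prod 𝓘(ℝ, ℝ)) p α) z := by
  rw [← chartSet_cyl] at hz ⊢
  refine inChart_extD _ hα ?_ hz
  rw [chartSet_cyl]
  exact uniqueDiffOn_cylinderChart I p.1 hε

theorem flatD_mono {S S' : Set E} {z : E} (h : S ⊆ S') (hS : UniqueDiffWithinAt ℝ S z)
    {α : E → Lam E} (hα : DifferentiableWithinAt ℝ α S' z) : flatD S α z = flatD S' α z := by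
  rw [flatD, flatD, fderivWithin_subset h hS hα]

theorem flatD_congr {S : Set E} {z : E} (hz : z ∈ S) {α β : E → Lam E} (h : EqOn α β S) :
    flatD S α z = flatD S β z := by
  rw [flatD, flatD, fderivWithin_congr h (h hz)]

theorem flatD_zero (S : Set E) (z : E) : flatD S (fun _ => (0 : Lam E)) z = 0 := by
  rw [flatD, fderivWithin_fun_const]
  exact altSum_zero

theorem mem_cyl {x : N} {t ε : ℝ} : (x, t) ∈ cyl N ε ↔ t ∈ Icc 0 ε :=
  ⟨fun h => h.2, fun h => ⟨mem_univ _, h⟩⟩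

end CylinderCharts

/-! ### The solution along the fibres of `N × [0,ε] → N` -/

section FiberSolution

universe u v

set_option linter.unusedSectionVars false

variable {E : Type u} [NormedAddCommGroup E] [NormedSpace ℝ E] [FiniteDimensional ℝ E]
  {H : Type*} [TopologicalSpace H] {I : ModelWithCorners ℝ E H}
  {N : Type*} [TopologicalSpace N] [ChartedSpace H N] [IsManifold I ∞ N]
  {ι : Type v} {deg : ι → ℕ} [Fintype ι] [DecidableEq ι] {U : Opens (Base deg)}
  {η : ι → N × ℝ → Lam (E × ℝ)}

local notation "inlE" => LinearMap.inl ℝ E ℝ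
local notation "fstE" => LinearMap.fst ℝ E ℝ

/-- The restriction of `η` to the slices `N × {t}`. -/
def sliceForm (η : ι → N × ℝ → Lam (E × ℝ)) (x : N) (t : ℝ) (i : ι) : Lam E :=
  pull inlE (η i (x, t))

variable (I) in
/-- The restriction of `dη` to the slices `N × {t}`. -/
def sliceD (η : ι → N × ℝ → Lam (E × ℝ)) (x : N) (t : ℝ) (i : ι) : Lam E :=
  pull inlE (extD (I.prod 𝓘(ℝ, ℝ)) (cyl N 1) (η i) (x, t))

theorem contDiffOn_sliceForm (hη : IsHorizontalNegOne I deg η) (x₀ : N) :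
    ContDiffOn ℝ ∞ (fun (z : E × ℝ) i => pull (jac I x₀ z.1)
      (sliceForm η ((extChartAt I x₀).symm z.1) z.2 i)) ((extChartAt I x₀).target ×ˢ Icc 0 1) := by
  refine contDiffOn_pi.mpr fun i => ?_
  refine (contDiffOn_linearMap_comp (pull inlE).toLinearMap
    ((smoothFormOn_cyl_iff I).mp (hη.isWForm.smooth i) x₀)).congr fun z hz => ?_
  exact (pull_inl_cylJac I x₀ z.1 _).symm

theorem contDiffOn_sliceD (hη : IsHorizontalNegOne I deg η) (x₀ : N) :
    ContDiffOn ℝ ∞ (fun (z : E × ℝ) i => pull (jac I x₀ z.1)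
      (sliceD I η ((extChartAt I x₀).symm z.1) z.2 i)) ((extChartAt I x₀).target ×ˢ Icc 0 1) := by
  refine contDiffOn_pi.mpr fun i => ?_
  refine (contDiffOn_linearMap_comp (pull inlE).toLinearMap
    (contDiffOn_flatD (uniqueDiffOn_cylinderChart I x₀ one_pos)
      ((hη.isWForm.smooth i).contDiffOn_cyl I (x₀, 0)))).congr fun z hz => ?_
  have h := inChart_extD_cyl I one_pos (hη.isWForm.smooth i) (x₀, 0) hz
  rw [AlgHom.toLinearMap_apply, ← h, inChart_cyl I (x₀, 0) hz.1 z.2]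
  exact (pull_inl_cylJac I x₀ z.1 _).symm

theorem contDiffOn_time {G : N → ℝ → ι → Lam E} {ε : ℝ} (x : N)
    (hG : ContDiffOn ℝ ∞ (fun (z : E × ℝ) i => pull (jac I x z.1)
      (G ((extChartAt I x).symm z.1) z.2 i)) ((extChartAt I x).target ×ˢ Icc 0 ε)) :
    ContDiffOn ℝ ∞ (G x) (Icc 0 ε) := by
  have h := hG.comp (f := fun t : ℝ => (extChartAt I x x, t)) (s := Icc 0 ε)
    (contDiff_const.prodMk contDiff_id).contDiffOn
    (fun t ht => ⟨mem_extChartAt_target x, ht⟩)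
  refine h.congr fun t _ => funext fun i => ?_
  simp only [Function.comp_apply]
  rw [jac_self, pull_id, extChartAt_to_inv]

theorem sliceForm_mem (hη : IsHorizontalNegOne I deg η) {x : N} {t : ℝ} (ht : t ∈ Icc (0 : ℝ) 1)
    (i : ι) : sliceForm η x t i ∈ homogPart E (-1 + deg i) :=
  pull_homogPart _ (hη.isWForm.homog i (x, t) (mem_cyl.mpr ht))

theorem extD_cyl_eq {ε : ℝ} (α : N × ℝ → Lam (E × ℝ)) (x : N) (t : ℝ) :
    extD (I.prod 𝓘(ℝ, ℝ)) (cyl N ε) α (x, t) =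
      flatD ((extChartAt I x).target ×ˢ Icc 0 ε) (inChart (I.prod 𝓘(ℝ, ℝ)) (x, t) α)
        (extChartAt I x x, t) := by
  rw [extD_eq_flatD, chartSet_cyl, extChartAt_cyl_apply]

theorem inChart_eq_zero {ε : ℝ} {α : N × ℝ → Lam (E × ℝ)} (hα : ∀ p ∈ cyl N ε, α p = 0)
    (p : N × ℝ) {z : E × ℝ} (hz : z ∈ (extChartAt I p.1).target ×ˢ Icc 0 ε) :
    inChart (I.prod 𝓘(ℝ, ℝ)) p α z = 0 := by
  rw [inChart_cyl I p hz.1 z.2, hα _ (mem_cyl.mpr hz.2), map_zero]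

theorem sliceD_eq_zero (hη : IsHorizontalNegOne I deg η) {x : N} {t : ℝ} (ht : t ∈ Icc (0 : ℝ) 1)
    {i : ι} (hi : deg i = 0) : sliceD I η x t i = 0 := by
  have h0 : ∀ p ∈ cyl N 1, η i p = 0 := fun p hp => by
    have h := hη.isWForm.homog i p hp
    rw [hi] at h
    exact eq_zero_of_mem_homogPart_neg_one h
  have hz : (extChartAt I x x, t) ∈ (extChartAt I x).target ×ˢ Icc (0 : ℝ) 1 :=
    ⟨mem_extChartAt_target x, ht⟩
  rw [sliceD, extD_cyl_eq, flatD_congr (β := fun _ => 0) hz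
    (fun z hz => inChart_eq_zero h0 (x, t) hz), flatD_zero, map_zero]

theorem sliceD_mem (hη : IsHorizontalNegOne I deg η) {x : N} {t : ℝ} (ht : t ∈ Icc (0 : ℝ) 1)
    (i : ι) : sliceD I η x t i ∈ ⋀[ℝ]^(deg i) (Module.Dual ℝ E) := by
  rcases Nat.eq_zero_or_eq_succ_pred (deg i) with hi | hi
  · rw [sliceD_eq_zero hη ht hi]
    exact zero_mem _
  · rw [hi, sliceD, extD_cyl_eq]
    refine pull_mem _ (flatD_homog (uniqueDiffOn_cylinderChart I x one_pos _
      ⟨mem_extChartAt_target x, ht⟩) ⟨mem_extChartAt_target x, ht⟩ fun z hz => ?_)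
    rw [inChart_cyl I (x, t) hz.1 z.2]
    have h := hη.isWForm.homog i ((extChartAt I x).symm z.1, z.2) (mem_cyl.mpr hz.2)
    rw [hi] at h
    exact pull_mem _ (mem_homogPart_neg_one_add h)

/-- A family of solutions of the equation for the horizontal part, one for each point of `N`. -/
structure IsFiberSolution (Q : Differential deg U) (A₀ : WUForm I deg U (univ : Set N))
    (η : ι → N × ℝ → Lam (E × ℝ)) (ε : ℝ) (a : N → ℝ → ι → Lam E) : Prop where
  initial : ∀ x i, a x 0 i = A₀.toFun i x
  mem : ∀ x, ∀ t ∈ Icc 0 ε, a x t ∈ fiberDom U E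
  homog : ∀ x, ∀ t ∈ Icc 0 ε, ∀ i, a x t i ∈ ⋀[ℝ]^(deg i) (Module.Dual ℝ E)
  deriv : ∀ x, ∀ t ∈ Icc 0 ε, HasDerivWithinAt (a x)
    (mcField Q (sliceForm η x t) (sliceD I η x t) (a x t)) (Icc 0 ε) t

variable {Q : Differential deg U} {A₀ : WUForm I deg U (univ : Set N)} {ε : ℝ}
  {a : N → ℝ → ι → Lam E}

theorem IsFiberSolution.contDiffOn (ha : IsFiberSolution Q A₀ η ε a)
    (hη : IsHorizontalNegOne I deg η) (hε : 0 < ε) (hε1 : ε ≤ 1) (x₀ : N) :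
    ContDiffOn ℝ ∞ (fun (z : E × ℝ) i => pull (jac I x₀ z.1)
      (a ((extChartAt I x₀).symm z.1) z.2 i)) ((extChartAt I x₀).target ×ˢ Icc 0 ε) := by
  set ψ := (extChartAt I x₀).symm
  have hsub : (extChartAt I x₀).target ×ˢ Icc 0 ε ⊆ (extChartAt I x₀).target ×ˢ Icc (0 : ℝ) 1 :=
    prod_mono le_rfl (Icc_subset_Icc_right hε1)
  let Φ : E × ℝ × (ι → Lam E) → ι → Lam E := fun w =>
    mcField Q (fun i => pull (jac I x₀ w.1) (sliceForm η (ψ w.1) w.2.1 i))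
      (fun i => pull (jac I x₀ w.1) (sliceD I η (ψ w.1) w.2.1 i)) w.2.2
  have hproj : ContDiffOn ℝ ∞ (fun w : E × ℝ × (ι → Lam E) => (w.1, w.2.1))
      ((extChartAt I x₀).target ×ˢ Icc 0 ε ×ˢ fiberDom U E) :=
    (contDiff_fst.prodMk (contDiff_fst.comp contDiff_snd)).contDiffOn
  have hmaps : MapsTo (fun w : E × ℝ × (ι → Lam E) => (w.1, w.2.1))
      ((extChartAt I x₀).target ×ˢ Icc 0 ε ×ˢ fiberDom U E)
      ((extChartAt I x₀).target ×ˢ Icc 0 ε) := fun w hw => ⟨hw.1, hw.2.1⟩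
  have h1 := ((contDiffOn_sliceForm hη x₀).mono hsub).comp hproj hmaps
  have h2 := ((contDiffOn_sliceD hη x₀).mono hsub).comp hproj hmaps
  have h3 : ContDiffOn ℝ ∞ (fun w : E × ℝ × (ι → Lam E) => w.2.2)
      ((extChartAt I x₀).target ×ˢ Icc 0 ε ×ˢ fiberDom U E) :=
    (contDiff_snd.comp contDiff_snd).contDiffOn
  have hΦ : ContDiffOn ℝ ∞ Φ ((extChartAt I x₀).target ×ˢ Icc 0 ε ×ˢ fiberDom U E) :=
    contDiffOn_mcField Q h1 h2 h3 fun w hw => hw.2.2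
  refine contDiffOn_solution.{u, v} hε (uniqueDiffOn_extChartAt_target x₀)
    (locallyConvex_extChartAt_target I x₀) isOpen_fiberDom hΦ (fun y _ t ht => ?_)
    (fun y _ t ht => ?_) ?_
  · exact (pull_mem_fiberDom _ _).mpr (ha.mem _ t ht)
  · have h := hasDerivWithinAt_pi.mp (ha.deriv (ψ y) t ht)
    refine hasDerivWithinAt_pi.mpr fun i => ?_
    have h1 := hasDerivWithinAt_linearMap_comp (pull (jac I x₀ y)).toLinearMap (h i)
    rw [AlgHom.toLinearMap_apply, pull_mcField] at h1
    exact h1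
  · refine contDiffOn_pi.mpr fun i => ?_
    have h := A₀.isWForm.smooth i x₀
    rw [preimage_univ, inter_univ] at h
    refine h.congr fun y hy => ?_
    rw [inChart_eq_jac I hy, ha.initial]

theorem IsFiberSolution.unique (ha : IsFiberSolution Q A₀ η ε a)
    (hη : IsHorizontalNegOne I deg η) (hε : 0 < ε) (hε1 : ε ≤ 1) (x : N) {c : ℝ → ι → Lam E}
    (h0 : ∀ i, c 0 i = A₀.toFun i x)
    (hc : ∀ t ∈ Icc 0 ε, HasDerivWithinAt c
      (mcField Q (sliceForm η x t) (sliceD I η x t) (c t)) (Icc 0 ε) t) :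
    ∀ t ∈ Icc 0 ε, c t = a x t := by
  have hsub : Icc 0 ε ⊆ Icc (0 : ℝ) 1 := Icc_subset_Icc_right hε1
  refine ODE_unique (F := fun w => mcField Q (sliceForm η x w.1) (sliceD I η x w.1) w.2)
    isOpen_fiberDom hε ?_ (ha.mem x) (ha.deriv x) hc
    (funext fun i => (h0 i).trans (ha.initial x i).symm)
  exact contDiffOn_mcField Q
    (((contDiffOn_time x (contDiffOn_sliceForm hη x)).mono hsub).comp contDiff_fst.contDiffOn
      fun w hw => hw.1)
    (((contDiffOn_time x (contDiffOn_sliceD hη x)).mono hsub).comp contDiff_fst.contDiffOn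
      fun w hw => hw.1)
    contDiff_snd.contDiffOn fun w hw => hw.2

end FiberSolution

/-! ### Homotopies from solutions along the fibres -/

section Homotopy

universe u v

set_option linter.unusedSectionVars false

variable {E : Type u} [NormedAddCommGroup E] [NormedSpace ℝ E] [FiniteDimensional ℝ E]
  {H : Type*} [TopologicalSpace H] {I : ModelWithCorners ℝ E H}
  {N : Type*} [TopologicalSpace N] [ChartedSpace H N] [IsManifold I ∞ N]
  {ι : Type v} {deg : ι → ℕ} [Fintype ι] [DecidableEq ι] {U : Opens (Base deg)}
  {η : ι → N × ℝ → Lam (E × ℝ)}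

local notation "inlE" => LinearMap.inl ℝ E ℝ
local notation "fstE" => LinearMap.fst ℝ E ℝ

theorem inChart_self_cyl (x : N) (t s : ℝ) (α : N × ℝ → Lam (E × ℝ)) :
    inChart (I.prod 𝓘(ℝ, ℝ)) (x, t) α (extChartAt I x x, s) = α (x, s) := by
  rw [inChart_cyl I (x, t) (mem_extChartAt_target x), cylJac, jac_self, LinearMap.prodMap_id,
    pull_id, extChartAt_to_inv]

theorem IsHorizontalNegOne.eq_pull (hη : IsHorizontalNegOne I deg η) {x : N} {t : ℝ}
    (ht : t ∈ Icc (0 : ℝ) 1) (i : ι) : pull fstE (sliceForm η x t i) = η i (x, t) :=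
  (eq_pull_of_vert_eq_zero (hη.horizontal i (x, t) (mem_cyl.mpr ht))).symm

variable {Q : Differential deg U} {A₀ : WUForm I deg U (univ : Set N)} {ε : ℝ}
  {a : N → ℝ → ι → Lam E}

theorem WUForm.homog {M : Type*} [TopologicalSpace M] [ChartedSpace H M] {s : Set M}
    (A : WUForm I deg U s) {p : M} (hp : p ∈ s) (i : ι) :
    A.toFun i p ∈ ⋀[ℝ]^(deg i) (Module.Dual ℝ E) := (A.pt p hp).homog i

theorem WUForm.subst_eq {M : Type*} [TopologicalSpace M] [ChartedSpace H M] {s : Set M}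
    (A : WUForm I deg U s) {p : M} (hp : p ∈ s) (F : FnAlg deg U) :
    (A.pt p hp).subst F = substT F (fun i => A.toFun i p) := (substT_comp (A.pt p hp) F).symm

theorem WUForm.mem_fiberDom {M : Type*} [TopologicalSpace M] [ChartedSpace H M] {s : Set M}
    (A : WUForm I deg U s) {p : M} (hp : p ∈ s) : (fun i => A.toFun i p) ∈ fiberDom U E :=
  (A.pt p hp).comp_mem_fiberDom

/-- The horizontal form on `N × [0,ε]` given by a solution along the fibres. -/
def IsFiberSolution.horizForm (ha : IsFiberSolution Q A₀ η ε a) (hη : IsHorizontalNegOne I deg η)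
    (hε : 0 < ε) (hε1 : ε ≤ 1) : WUForm (I.prod 𝓘(ℝ, ℝ)) deg U (cyl N ε) where
  toFun i p := pull fstE (a p.1 p.2 i)
  isWForm :=
    { smooth := fun i => (smoothFormOn_cyl_iff I).mpr fun x₀ =>
        (contDiffOn_linearMap_comp (pull fstE).toLinearMap
          (contDiffOn_pi.mp (ha.contDiffOn hη hε hε1 x₀) i)).congr fun z _ =>
            cylJac_pull_fst I x₀ z.1 _
      homog := fun i p hp => by
        rw [zero_add]
        exact pull_mem _ (ha.homog p.1 p.2 hp.2 i) }
  mem p hp := (mem_fiberDom_of_homog fun i => pull_mem _ (ha.homog p.1 p.2 hp.2 i)).mp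
    ((pull_mem_fiberDom _ _).mpr (ha.mem p.1 p.2 hp.2))

theorem dt_mul_mem (hη : IsHorizontalNegOne I deg η) {p : N × ℝ} (hp : p ∈ cyl N 1) (i : ι) :
    dt * η i p ∈ ⋀[ℝ]^(deg i) (Module.Dual ℝ (E × ℝ)) := by
  have h := hη.isWForm.homog i p hp
  rcases Nat.eq_zero_or_eq_succ_pred (deg i) with hi | hi
  · rw [hi] at h
    rw [eq_zero_of_mem_homogPart_neg_one h, mul_zero]
    exact zero_mem _
  · rw [hi] at h
    rw [hi, Nat.succ_eq_add_one, add_comm]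
    exact mul_mem_lam (ι_mem_lam _) (mem_homogPart_neg_one_add h)

theorem cyl_mono (hε1 : ε ≤ 1) : cyl N ε ⊆ cyl N 1 :=
  prod_mono le_rfl (Icc_subset_Icc_right hε1)

/-- The form `A_h + dt η` on `N × [0,ε]` given by a solution along the fibres. -/
def IsFiberSolution.fullForm (ha : IsFiberSolution Q A₀ η ε a) (hη : IsHorizontalNegOne I deg η)
    (hε : 0 < ε) (hε1 : ε ≤ 1) : WUForm (I.prod 𝓘(ℝ, ℝ)) deg U (cyl N ε) where
  toFun i p := (ha.horizForm hη hε hε1).toFun i p + dt * η i p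
  isWForm :=
    { smooth := fun i => (smoothFormOn_cyl_iff I).mpr fun x₀ => by
        have h1 := (smoothFormOn_cyl_iff I).mp ((ha.horizForm hη hε hε1).isWForm.smooth i) x₀
        have h2 := ((smoothFormOn_cyl_iff I).mp (hη.isWForm.smooth i) x₀).mono
          (prod_mono le_rfl (Icc_subset_Icc_right hε1))
        refine (h1.add (contDiffOn_lam_mul (contDiffOn_const (c := dt)) h2)).congr fun z _ => ?_
        rw [map_add, cylJac_dt_mul]
      homog := fun i p hp => by
        rw [zero_add]
        exact add_mem ((ha.horizForm hη hε hε1).homog hp i) (dt_mul_mem hη (cyl_mono hε1 hp) i) }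
  mem p hp := by
    have h : baseValue (deg := deg) (fun i => (ha.horizForm hη hε hε1).toFun i p + dt * η i p) =
        baseValue (fun i => (ha.horizForm hη hε hε1).toFun i p) := funext fun i => by
      rw [baseValue, baseValue, map_add, map_mul, dt, scalar_ι, zero_mul, add_zero]
    rw [h]
    exact (ha.horizForm hη hε hε1).mem p hp

theorem IsFiberSolution.isODESolution (ha : IsFiberSolution Q A₀ η ε a)
    (hη : IsHorizontalNegOne I deg η) (hε : 0 < ε) (hε1 : ε ≤ 1) :
    IsODESolution Q A₀ η ε (ha.horizForm hη hε hε1) where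
  horizontal i p _ := vert_pull_fst _
  initial i x := (pull_inl_pull_fst _).trans (ha.initial x i)
  ode x t ht i := by
    have h := hasDerivWithinAt_linearMap_comp (pull fstE).toLinearMap
      (hasDerivWithinAt_pi.mp (ha.deriv x t ht.2) i)
    rw [AlgHom.toLinearMap_apply, pull_mcField] at h
    refine h.congr_deriv ?_
    rw [mcField]
    congr 1
    · rw [horiz_eq_pull, ← pull_pull]
      rfl
    · refine Finset.sum_congr rfl fun j _ => ?_
      rw [hη.eq_pull (cyl_mono hε1 ht).2, WUForm.subst_eq]
      rfl

theorem IsFiberSolution.eq_of_isODESolution (ha : IsFiberSolution Q A₀ η ε a)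
    (hη : IsHorizontalNegOne I deg η) (hε : 0 < ε) (hε1 : ε ≤ 1)
    {B : WUForm (I.prod 𝓘(ℝ, ℝ)) deg U (cyl N ε)} (hB : IsODESolution Q A₀ η ε B) (i : ι) :
    EqOn (B.toFun i) ((ha.horizForm hη hε hε1).toFun i) (cyl N ε) := by
  rintro ⟨x, t⟩ hp
  have h := ha.unique hη hε hε1 x (c := fun s i => pull inlE (B.toFun i (x, s)))
    (fun i => hB.initial i x) (fun s hs => hasDerivWithinAt_pi.mpr fun i => by
      have hs' : (x, s) ∈ cyl N ε := mem_cyl.mpr hs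
      refine (hasDerivWithinAt_linearMap_comp (pull inlE).toLinearMap
        (hB.ode x s hs' i)).congr_deriv ?_
      rw [AlgHom.toLinearMap_apply, map_add, pull_inl_horiz, map_sum, mcField]
      congr 1
      refine Finset.sum_congr rfl fun j _ => ?_
      rw [map_mul, WUForm.subst_eq, pull_substT]
      rfl) t hp.2
  refine (eq_pull_of_vert_eq_zero (hB.horizontal i (x, t) hp)).trans ?_
  exact congrArg (pull fstE) (congrFun h i)

/-- The equation obtained by contracting the curvature with `∂_t`, in a chart. -/
theorem pull_inl_vert_curv_inChart (hη : IsHorizontalNegOne I deg η) (hε : 0 < ε) (hε1 : ε ≤ 1)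
    (A : WUForm (I.prod 𝓘(ℝ, ℝ)) deg U (cyl N ε))
    (hA : ∀ i, ∀ p ∈ cyl N ε, vert (A.toFun i p) = η i p) (p : N × ℝ) {z : E × ℝ}
    (hz : z ∈ (extChartAt I p.1).target ×ˢ Icc 0 ε) (i : ι) :
    pull inlE (vert (E := E) (curv Q ((extChartAt I p.1).target ×ˢ Icc 0 ε)
      (fun j => inChart (I.prod 𝓘(ℝ, ℝ)) p (A.toFun j)) i z)) =
    pull inlE (fderivWithin ℝ (inChart (I.prod 𝓘(ℝ, ℝ)) p (A.toFun i))
      ((extChartAt I p.1).target ×ˢ Icc 0 ε) z (0, 1)) -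
    pull (jac I p.1 z.1) (mcField Q (sliceForm η ((extChartAt I p.1).symm z.1) z.2)
      (sliceD I η ((extChartAt I p.1).symm z.1) z.2)
      (fun j => pull inlE (A.toFun j ((extChartAt I p.1).symm z.1, z.2))) i) := by
  set S := (extChartAt I p.1).target ×ˢ Icc 0 ε with hS
  have hSu : UniqueDiffOn ℝ S := uniqueDiffOn_cylinderChart I p.1 hε
  have hSsub : S ⊆ (extChartAt I p.1).target ×ˢ Icc (0 : ℝ) 1 :=
    prod_mono le_rfl (Icc_subset_Icc_right hε1)
  have hz' : ((extChartAt I p.1).symm z.1, z.2) ∈ cyl N ε := mem_cyl.mpr hz.2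
  have hin : ∀ j, inChart (I.prod 𝓘(ℝ, ℝ)) p (A.toFun j) z =
      pull (cylJac I p.1 z.1) (A.toFun j ((extChartAt I p.1).symm z.1, z.2)) := fun j =>
    inChart_cyl I p hz.1 z.2 _
  have hvert : ∀ j, ∀ w ∈ S, vert (inChart (I.prod 𝓘(ℝ, ℝ)) p (A.toFun j) w) =
      inChart (I.prod 𝓘(ℝ, ℝ)) p (η j) w := fun j w hw => by
    have h1 := inChart_cyl I p hw.1 w.2 (A.toFun j)
    have h2 := inChart_cyl I p hw.1 w.2 (η j)
    rw [h1, h2, vert_cylJac, hA j _ (mem_cyl.mpr hw.2)]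
  rw [pull_inl_vert_curv Q (hSu z hz)
    (fun j => (((A.isWForm.smooth j).contDiffOn_cyl I p) z hz).differentiableWithinAt (by simp))
    (fun j => by rw [hin]; exact pull_mem _ (A.homog hz' j))
    (by simp only [hin]; exact (pull_mem_fiberDom _ _).mpr (A.mem_fiberDom hz')), pull_mcField]
  congr 2
  · funext j
    rw [hvert j z hz, inChart_cyl I p hz.1 z.2 (η j)]
    exact pull_inl_cylJac I p.1 z.1 _
  · funext j
    rw [flatD_congr hz (hvert j), flatD_mono hSsub (hSu z hz)
      (((hη.isWForm.smooth j).contDiffOn_cyl I p z (hSsub hz)).differentiableWithinAt (by simp)),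
      ← inChart_extD_cyl I one_pos (hη.isWForm.smooth j) p (hSsub hz), inChart_cyl I p hz.1 z.2]
    exact pull_inl_cylJac I p.1 z.1 _
  · funext j
    rw [hin]
    exact pull_inl_cylJac I p.1 z.1 _

theorem IsFiberSolution.eq_of_isMCHomotopy (ha : IsFiberSolution Q A₀ η ε a)
    (hη : IsHorizontalNegOne I deg η) (hε : 0 < ε) (hε1 : ε ≤ 1)
    {A : WUForm (I.prod 𝓘(ℝ, ℝ)) deg U (cyl N ε)} (hA : IsMCHomotopy Q A₀ η ε A) (i : ι) :
    EqOn (A.toFun i) ((ha.fullForm hη hε hε1).toFun i) (cyl N ε) := by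
  rintro ⟨x, t⟩ hp
  have h := ha.unique hη hε hε1 x (c := fun s i => pull inlE (A.toFun i (x, s)))
    (fun i => hA.initial i x) (fun s hs => hasDerivWithinAt_pi.mpr fun i => by
      have hs' : (x, s) ∈ cyl N ε := mem_cyl.mpr hs
      have hz : (extChartAt I x x, s) ∈ (extChartAt I x).target ×ˢ Icc 0 ε :=
        ⟨mem_extChartAt_target x, hs⟩
      have hcurv : curv Q ((extChartAt I x).target ×ˢ Icc 0 ε)
          (fun j => inChart (I.prod 𝓘(ℝ, ℝ)) (x, s) (A.toFun j)) i (extChartAt I x x, s) = 0 := by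
        rw [curv, ← extD_cyl_eq, hA.isMC (x, s) hs' i, WUForm.subst_eq]
        simp only [inChart_self_cyl]
        exact sub_self _
      have key := pull_inl_vert_curv_inChart (Q := Q) hη hε hε1 A hA.vertical (x, s) hz i
      rw [hcurv, map_zero, map_zero, jac_self, pull_id, extChartAt_to_inv] at key
      have hd := hasDerivWithinAt_linearMap_comp (pull inlE).toLinearMap
        (hasDerivWithinAt_time (mem_extChartAt_target x)
          ((((A.isWForm.smooth i).contDiffOn_cyl I (x, s)) _ hz).differentiableWithinAt (by simp)))
      rw [AlgHom.toLinearMap_apply, ← sub_eq_zero.mp key.symm] at *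
      simp only [inChart_self_cyl] at hd
      exact hd) t hp.2
  have h1 : horiz (A.toFun i (x, t)) = pull fstE (a x t i) := by
    rw [horiz_eq_pull, ← pull_pull]
    exact congrArg (pull fstE) (congrFun h i)
  have h2 := hA.vertical i (x, t) hp
  rw [horiz, h2] at h1
  exact sub_eq_iff_eq_add.mp h1

theorem IsFiberSolution.isMCHomotopy (ha : IsFiberSolution Q A₀ η ε a)
    (hη : IsHorizontalNegOne I deg η) (hA₀ : A₀.IsMC Q) (hε : 0 < ε) (hε1 : ε ≤ 1) :
    IsMCHomotopy Q A₀ η ε (ha.fullForm hη hε hε1) := by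
  set A := ha.fullForm hη hε hε1 with hAdef
  have hvert : ∀ i, ∀ p ∈ cyl N ε, vert (A.toFun i p) = η i p := fun i p hp => by
    have h : A.toFun i p = pull fstE (a p.1 p.2 i) + dt * η i p := rfl
    rw [h, map_add, vert_pull_fst, vert_dt_mul, hη.horizontal i p (cyl_mono hε1 hp), mul_zero,
      zero_add, sub_zero]
  have hinl : ∀ i x t, pull inlE (A.toFun i (x, t)) = a x t i := fun i x t => by
    have h : A.toFun i (x, t) = pull fstE (a x t i) + dt * η i (x, t) := rfl
    rw [h, map_add, pull_inl_pull_fst, pull_inl_dt_mul, add_zero]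
  refine ⟨?_, fun i x => (hinl i x 0).trans (ha.initial x i), hvert⟩
  rintro ⟨x, t⟩ hp i
  set S := (extChartAt I x).target ×ˢ Icc 0 ε with hS
  set Â : ι → E × ℝ → Lam (E × ℝ) := fun j => inChart (I.prod 𝓘(ℝ, ℝ)) (x, t) (A.toFun j) with hÂ
  have hsm : ∀ j, ContDiffOn ℝ ∞ (Â j) S := fun j => (A.isWForm.smooth j).contDiffOn_cyl I (x, t)
  have hin : ∀ j, ∀ z ∈ S, Â j z =
      pull (cylJac I x z.1) (A.toFun j ((extChartAt I x).symm z.1, z.2)) := fun j z hz =>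
    inChart_cyl I (x, t) hz.1 z.2 _
  have hÂinl : ∀ j, ∀ z ∈ S, pull inlE (Â j z) =
      pull (jac I x z.1) (a ((extChartAt I x).symm z.1) z.2 j) := fun j z hz => by
    rw [hin j z hz, pull_inl_cylJac, hinl]
  have hh : ∀ z ∈ S, ∀ j, Â j z ∈ ⋀[ℝ]^(deg j) (Module.Dual ℝ (E × ℝ)) := fun z hz j => by
    rw [hin j z hz]
    exact pull_mem _ (A.homog (mem_cyl.mpr hz.2) j)
  have hU : ∀ z ∈ S, (fun j => Â j z) ∈ fiberDom U (E × ℝ) := fun z hz => by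
    rw [show (fun j => Â j z) = fun j => pull (cylJac I x z.1)
      (A.toFun j ((extChartAt I x).symm z.1, z.2)) from funext fun j => hin j z hz]
    exact (pull_mem_fiberDom _ _).mpr (A.mem_fiberDom (mem_cyl.mpr hz.2))
  have hv : ∀ z ∈ S, ∀ j, vert (curv Q S Â j z) = 0 := by
    rintro ⟨y, s⟩ hz j
    refine vert_vert_curv Q S Â j (y, s) ?_
    rw [pull_inl_vert_curv_inChart hη hε hε1 A hvert (x, t) hz j, sub_eq_zero]
    have d1 := hasDerivWithinAt_linearMap_comp (pull inlE).toLinearMap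
      (hasDerivWithinAt_time hz.1 ((hsm j _ hz).differentiableWithinAt (by simp)))
    have d2 := hasDerivWithinAt_linearMap_comp (pull (jac I x y)).toLinearMap
      (hasDerivWithinAt_pi.mp (ha.deriv ((extChartAt I x).symm y) s hz.2) j)
    have d3 := d2.congr (f₁ := fun s => (pull inlE).toLinearMap (Â j (y, s)))
      (fun s' hs' => hÂinl j (y, s') ⟨hz.1, hs'⟩) (hÂinl j (y, s) hz)
    have e := (uniqueDiffOn_Icc hε s hz.2).eq_deriv _ d1 d3
    simp only [hinl]
    exact e
  have h0 : ∀ y ∈ (extChartAt I x).target, ∀ j, curv Q S Â j (y, 0) = 0 := fun y hy j => by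
    have hz : (y, (0 : ℝ)) ∈ S := ⟨hy, left_mem_Icc.mpr hε.le⟩
    refine (eq_pull_of_vert_eq_zero (hv _ hz j)).trans ?_
    have hc : ∀ k, EqOn (fun w => pull inlE (Â k (w, 0))) (inChart I x (A₀.toFun k))
        (extChartAt I x).target := fun k w hw => by
      refine (hÂinl k (w, 0) ⟨hw, hz.2⟩).trans ?_
      rw [ha.initial, inChart_eq_jac I hw]
    have hd : flatD (extChartAt I x).target (inChart I x (A₀.toFun j)) y =
        pull (jac I x y) (extD I univ (A₀.toFun j) ((extChartAt I x).symm y)) := by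
      have h1 := inChart_extD I (A₀.isWForm.smooth j) (p₀ := x) (y := y)
        (by rw [chartSet_univ]; exact uniqueDiffOn_extChartAt_target x)
        (by rw [chartSet_univ]; exact hy)
      rw [chartSet_univ] at h1
      rw [← h1, inChart_eq_jac I hy]
    have hz2 : pull inlE (curv Q S Â j (y, 0)) = 0 := by
      rw [curv, map_sub, pull_inl_flatD (uniqueDiffOn_extChartAt_target x) hy hz.2
        ((hsm j _ hz).differentiableWithinAt (by simp)), flatD_congr hy (hc j), hd,
        hA₀ _ (mem_univ _) j, WUForm.subst_eq, pull_substT, pull_substT, sub_eq_zero]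
      congr 1
      funext k
      exact ((hc k hy).trans (inChart_eq_jac I hy _)).symm
    rw [hz2, map_zero]
  have hz : (extChartAt I x x, t) ∈ S := ⟨mem_extChartAt_target x, hp.2⟩
  have hcurv := curv_eq_zero Q hε (uniqueDiffOn_extChartAt_target x)
    extChartAt_target_subset_closure_interior hsm hh hU hv h0 _ hz i
  rw [extD_cyl_eq, WUForm.subst_eq, sub_eq_zero.mp hcurv]
  congr 1
  funext j
  exact inChart_self_cyl x t t (A.toFun j)

theorem IsFiberSolution.hasUniqueHomotopy (ha : IsFiberSolution Q A₀ η ε a)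
    (hη : IsHorizontalNegOne I deg η) (hA₀ : A₀.IsMC Q) (hε : 0 < ε) (hε1 : ε ≤ 1) :
    HasUniqueHomotopy Q A₀ η ε :=
  ⟨ha.fullForm hη hε hε1, ha.horizForm hη hε hε1, ha.isMCHomotopy hη hA₀ hε hε1,
    fun _ hA => ha.eq_of_isMCHomotopy hη hε hε1 hA, ha.isODESolution hη hε hε1,
    fun _ hB => ha.eq_of_isODESolution hη hε hε1 hB, fun _ _ _ => rfl⟩

end Homotopy

/-! ### Existence on a compact manifold -/

section Existence

universe u v

set_option linter.unusedSectionVars false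

theorem SmoothFormOn.continuousOn_scalar {E : Type*} [NormedAddCommGroup E] [NormedSpace ℝ E]
    [FiniteDimensional ℝ E] {H : Type*} [TopologicalSpace H] {I : ModelWithCorners ℝ E H}
    {M : Type*} [TopologicalSpace M] [ChartedSpace H M] [IsManifold I ∞ M] {s : Set M}
    {α : M → Lam E} (hα : SmoothFormOn I s α) : ContinuousOn (fun p => scalar (α p)) s := by
  intro p hp
  have hsrc : (extChartAt I p).source ∈ nhds p := extChartAt_source_mem_nhds p
  rw [← continuousWithinAt_inter hsrc]
  have h1 : ContinuousWithinAt (inChart I p α) (chartSet I p s) (extChartAt I p p) :=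
    (hα p).continuousOn _ (extChartAt_mem_chartSet I hp)
  have h2 : ContinuousWithinAt (extChartAt I p) (s ∩ (extChartAt I p).source) p :=
    (continuousAt_extChartAt p).continuousWithinAt
  have h3 : MapsTo (extChartAt I p) (s ∩ (extChartAt I p).source) (chartSet I p s) := fun q hq =>
    ⟨(extChartAt I p).map_source hq.2, by
      rw [mem_preimage, (extChartAt I p).left_inv hq.2]
      exact hq.1⟩
  have h4 := (continuous_lam_linear (scalar (V := E)).toLinearMap).continuousAt.comp_continuousWithinAt
    (h1.comp h2 h3)
  have h5 : ∀ q ∈ s ∩ (extChartAt I p).source,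
      scalar (α q) = scalar (inChart I p α (extChartAt I p q)) := fun q hq => by
    rw [inChart_apply I hq.2, scalar_pull]
  exact h4.congr h5 (h5 p ⟨hp, mem_extChartAt_source p⟩)

variable {E : Type u} [NormedAddCommGroup E] [NormedSpace ℝ E] [FiniteDimensional ℝ E]
  {H : Type*} [TopologicalSpace H] {I : ModelWithCorners ℝ E H}
  {N : Type*} [TopologicalSpace N] [ChartedSpace H N] [IsManifold I ∞ N] [CompactSpace N]
  {ι : Type v} {deg : ι → ℕ} [Fintype ι] [DecidableEq ι] {U : Opens (Base deg)}

theorem exists_isFiberSolution (Q : Differential deg U) (A₀ : WUForm I deg U (univ : Set N)) :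
    ∃ μ > 0, ∀ η : ι → N × ℝ → Lam (E × ℝ), IsHorizontalNegOne I deg η → ∀ ε δ : ℝ, 0 < ε → ε ≤ 1 →
      0 ≤ δ → ε * δ ≤ μ → C0NormLE deg η δ → ∃ a, IsFiberSolution Q A₀ η ε a := by
  have hcont : Continuous fun x : N => baseValue (deg := deg) (fun i => A₀.toFun i x) :=
    continuous_pi fun i => continuousOn_univ.mp (A₀.isWForm.smooth i.1).continuousOn_scalar
  obtain ⟨μ, hμ, h⟩ := exists_fiber_solution (E := E) Q (isCompact_range hcont)
    (by rintro _ ⟨x, rfl⟩; exact A₀.mem x (mem_univ x))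
  refine ⟨μ, hμ, fun η hη ε δ hε hε1 hδ hεδ hC => ?_⟩
  have hsub : Icc 0 ε ⊆ Icc (0 : ℝ) 1 := Icc_subset_Icc_right hε1
  have hx := fun x : N => h ε δ hε hδ hεδ (fun i => A₀.toFun i x)
    (fun i => A₀.homog (mem_univ x) i) ⟨x, rfl⟩ (sliceForm η x) (sliceD I η x)
    ((contDiffOn_time x (contDiffOn_sliceForm hη x)).continuousOn.mono hsub)
    ((contDiffOn_time x (contDiffOn_sliceD hη x)).continuousOn.mono hsub)
    (fun t ht i => sliceForm_mem hη (hsub ht) i) (fun t ht i => sliceD_mem hη (hsub ht) i)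
    (fun t ht i hi => sliceD_eq_zero hη (hsub ht) hi)
    (fun t ht i hi => by
      rw [sliceForm, scalar_pull]
      exact hC (x, t) (mem_cyl.mpr (hsub ht)) i hi)
  choose a ha0 ha using hx
  exact ⟨a, fun x i => congrFun (ha0 x) i, fun x t ht => (ha x t ht).1,
    fun x t ht => (ha x t ht).2.1, fun x t ht => (ha x t ht).2.2⟩

theorem exists_C0NormLE {η : ι → N × ℝ → Lam (E × ℝ)} (hη : IsHorizontalNegOne I deg η) :
    ∃ δ : ℝ, 0 ≤ δ ∧ C0NormLE deg η δ := by
  have hc : IsCompact (cyl N 1) := isCompact_univ.prod isCompact_Icc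
  have hcont : ContinuousOn (fun p i => scalar (η i p)) (cyl N 1) :=
    continuousOn_pi.mpr fun i => (hη.isWForm.smooth i).continuousOn_scalar
  obtain ⟨C, hC⟩ := hc.exists_bound_of_continuousOn hcont
  exact ⟨max C 0, le_max_right _ _, fun p hp i _ =>
    (norm_le_pi_norm (fun i => scalar (η i p)) i).trans ((hC p hp).trans (le_max_left _ _))⟩

end Existence

end HtopyMC

end

open HtopyMC in
theorem mainTheorem12
    {E : Type*} [NormedAddCommGroup E] [NormedSpace ℝ E] [FiniteDimensional ℝ E]
    {H : Type*} [TopologicalSpace H] (I : ModelWithCorners ℝ E H)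
    {N : Type*} [TopologicalSpace N] [ChartedSpace H N] [IsManifold I ∞ N]
    [T2Space N] [CompactSpace N]
    {ι : Type*} [Fintype ι] [DecidableEq ι] (deg : ι → ℕ)
    (U : TopologicalSpace.Opens (Base deg)) (Q : Differential deg U)
    (A₀ : WUForm I deg U (Set.univ : Set N)) (hA₀ : A₀.IsMC Q) :
    (∀ η : ι → N × ℝ → Lam (E × ℝ), IsHorizontalNegOne I deg η →
      ∃ ε : ℝ, 0 < ε ∧ ε ≤ 1 ∧ HasUniqueHomotopy Q A₀ η ε) ∧
    ∃ δ : ℝ, 0 < δ ∧ ∀ η : ι → N × ℝ → Lam (E × ℝ), IsHorizontalNegOne I deg η →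
      C0NormLE deg η δ → HasUniqueHomotopy Q A₀ η 1 := by
  obtain ⟨μ, hμ, h⟩ := exists_isFiberSolution Q A₀
  refine ⟨fun η hη => ?_, μ, hμ, fun η hη hC => ?_⟩
  · obtain ⟨δ, hδ, hC⟩ := exists_C0NormLE hη
    have hε : 0 < min 1 (μ / (δ + 1)) := lt_min one_pos (by positivity)
    have hle : min 1 (μ / (δ + 1)) * δ ≤ μ := by
      calc min 1 (μ / (δ + 1)) * δ ≤ μ / (δ + 1) * (δ + 1) :=
            mul_le_mul (min_le_right _ _) (by linarith) hδ (by positivity)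
        _ = μ := div_mul_cancel₀ _ (by positivity)
    obtain ⟨a, ha⟩ := h η hη _ δ hε (min_le_left _ _) hδ hle hC
    exact ⟨_, hε, min_le_left _ _, ha.hasUniqueHomotopy hη hA₀ hε (min_le_left _ _)⟩
  · obtain ⟨a, ha⟩ := h η hη 1 μ one_pos le_rfl hμ.le (one_mul μ).le hC
    exact ha.hasUniqueHomotopy hη hA₀ one_pos le_rfl
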